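/- Theorem. There are a program for the real RAM and functions $T(n)=O(n\log n)$ and $S(n)=O(n)$ such that the program solves the interval separation problem for every $n$ and every $n$ intervals on a line after at most $T(n)$ instructions and using at most $S(n)$ memory cells of each kind. Here the input is a sequence of $n$ nondegenerate closed intervals $[a_i,b_i]$, $a_i<b_i$ real, $i=1,\dots,n$, in arbitrary order (repetitions allowed). Two intervals overlap if their intersection contains more than one point. Moving interval $i$ so that its left endpoint lies at $x_i\in\mathbb R$ turns it into $[x_i,\,x_i+b_i-a_i]$, with moving distance $|x_i-a_i|$ (both directions are allowed). The interval separation problem asks for positions $x_1,\dots,x_n$ such that no two of the moved intervals overlap and the maximum moving distance $\max_i|x_i-a_i|$ is minimum among all positions for which no two moved intervals overlap; the program outputs such $x_1,\dots,x_n$. The real RAM has a memory of exact real numbers and a memory of words of $O(\log n)$ bits (for counting and indirect addressing). Each instruction costs one unit of time: constant assignment (rational, respectively word, constants), copying, indirect load and store, the operations $+,-,\times,\div$ on reals or on words, comparison ($=$, $<$) of two reals or two words with a conditional jump, unconditional jump, and halting. There is no conversion of reals to words. The same finite program is used for all $n$. -/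

import Mathlib

open scoped Asymptotics

/-! ### The interval separation problem -/

namespace IntervalSeparation

/-- Two sets of points on the line overlap if their intersection contains more than one point. -/
def Overlap (s t : Set ℝ) : Prop := ∃ p ∈ s ∩ t, ∃ q ∈ s ∩ t, p ≠ q

/-- The interval `[a i, b i]` after it has been moved so that its left endpoint is `x i`. -/
def moved {n : ℕ} (a b x : Fin n → ℝ) (i : Fin n) : Set ℝ :=
  Set.Icc (x i) (x i + (b i - a i))

/-- The positions `x` (of the left endpoints) leave no two distinct intervals overlapping. -/
def IsSeparated {n : ℕ} (a b x : Fin n → ℝ) : Prop :=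
  ∀ i j : Fin n, i ≠ j → ¬ Overlap (moved a b x i) (moved a b x j)

/-- The maximum moving distance (it is `0` when there are no intervals). -/
noncomputable def maxMove {n : ℕ} (a x : Fin n → ℝ) : ℝ := ⨆ i : Fin n, |x i - a i|

/-- `x` solves the interval separation problem for the intervals `[a i, b i]`: it separates
them, and its maximum moving distance is smallest among all separating positions. Intervals
may move in both directions. -/
def IsOptimalSeparation {n : ℕ} (a b x : Fin n → ℝ) : Prop :=
  IsSeparated a b x ∧ ∀ y : Fin n → ℝ, IsSeparated a b y → maxMove a x ≤ maxMove a y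

end IntervalSeparation

/-! ### The real RAM

A random access machine with two memories: an array of words (bounded natural numbers, used for
counting and addressing) and an array of exact real numbers. There is no way to convert a real
number into a word (no rounding); reals influence the control flow by comparisons only. -/

namespace RealRAM

/-- The four arithmetic operations. -/
inductive Op : Type
  | add
  | sub
  | mul
  | div

/-- Operation on words: truncated subtraction, integer division; division by zero is an error. -/
def Op.onWords : Op → ℕ → ℕ → Option ℕ
  | .add, x, y => some (x + y)
  | .sub, x, y => some (x - y)
  | .mul, x, y => some (x * y)
  | .div, x, y => if y = 0 then none else some (x / y)

open Classical in
/-- Operation on reals, exact; division by zero is an error. -/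
noncomputable def Op.onReals : Op → ℝ → ℝ → Option ℝ
  | .add, x, y => some (x + y)
  | .sub, x, y => some (x - y)
  | .mul, x, y => some (x * y)
  | .div, x, y => if y = 0 then none else some (x / y)

/-- Instructions; `W` is the word memory, `R` the real memory. All arguments of type `ℕ` are
constants of the program: addresses, the word constant `c`, and jump targets `l`. -/
inductive Instr : Type
  /-- `W[d] := c` -/
  | wconst (d c : ℕ)
  /-- `W[d] := W[s]` -/
  | wcopy (d s : ℕ)
  /-- `W[d] := W[W[p]]` -/
  | wload (d p : ℕ)
  /-- `W[W[p]] := W[s]` -/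
  | wstore (p s : ℕ)
  /-- `W[d] := W[s] o W[t]` -/
  | wop (o : Op) (d s t : ℕ)
  /-- `R[d] := q` -/
  | rconst (d : ℕ) (q : ℚ)
  /-- `R[d] := R[s]` -/
  | rcopy (d s : ℕ)
  /-- `R[d] := R[W[p]]` -/
  | rload (d p : ℕ)
  /-- `R[W[p]] := R[s]` -/
  | rstore (p s : ℕ)
  /-- `R[d] := R[s] o R[t]` -/
  | rop (o : Op) (d s t : ℕ)
  /-- go to `l` -/
  | jump (l : ℕ)
  /-- if `W[s] = W[t]` go to `l` -/
  | jumpWEq (s t l : ℕ)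
  /-- if `W[s] < W[t]` go to `l` -/
  | jumpWLt (s t l : ℕ)
  /-- if `R[s] = R[t]` go to `l` -/
  | jumpREq (s t l : ℕ)
  /-- if `R[s] < R[t]` go to `l` -/
  | jumpRLt (s t l : ℕ)
  /-- stop -/
  | halt

/-- A program is a finite list of instructions. -/
abbrev Program : Type := List Instr

/-- A configuration: the program counter and the contents of both memories. -/
structure Config : Type where
  pc : ℕ
  W : ℕ → ℕ
  R : ℕ → ℝ

namespace Config

/-- Read a word; `S` is the number of available cells, access beyond them is an error. -/
def getW (S : ℕ) (σ : Config) (i : ℕ) : Option ℕ :=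
  if i < S then some (σ.W i) else none

/-- Read a real number. -/
noncomputable def getR (S : ℕ) (σ : Config) (i : ℕ) : Option ℝ :=
  if i < S then some (σ.R i) else none

/-- Write a word and proceed to the next instruction; words of value `B` or more do not fit into
a cell, and trying to write one is an error. -/
def setW (S B : ℕ) (σ : Config) (i v : ℕ) : Option Config :=
  if i < S ∧ v < B then
    some { pc := σ.pc + 1, W := Function.update σ.W i v, R := σ.R } else none

/-- Write a real number and proceed to the next instruction. -/
noncomputable def setR (S : ℕ) (σ : Config) (i : ℕ) (v : ℝ) : Option Config :=
  if i < S then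
    some { pc := σ.pc + 1, W := σ.W, R := Function.update σ.R i v } else none

open Classical in
/-- Go to `l` if `c` holds, and to the next instruction otherwise. -/
noncomputable def branch (σ : Config) (c : Prop) (l : ℕ) : Config :=
  { pc := if c then l else σ.pc + 1, W := σ.W, R := σ.R }

end Config

/-- Execution of one instruction on a machine with `S` word cells, `S` real cells and words
smaller than `B`. The value `none` is an error (`halt` has no successor either). -/
noncomputable def exec (S B : ℕ) (σ : Config) : Instr → Option Config
  | .wconst d c => σ.setW S B d c
  | .wcopy d s => (σ.getW S s).bind fun v => σ.setW S B d v
  | .wload d p => (σ.getW S p).bind fun i => (σ.getW S i).bind fun v => σ.setW S B d v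
  | .wstore p s => (σ.getW S p).bind fun i => (σ.getW S s).bind fun v => σ.setW S B i v
  | .wop o d s t => (σ.getW S s).bind fun x => (σ.getW S t).bind fun y =>
      (o.onWords x y).bind fun v => σ.setW S B d v
  | .rconst d q => σ.setR S d (q : ℝ)
  | .rcopy d s => (σ.getR S s).bind fun v => σ.setR S d v
  | .rload d p => (σ.getW S p).bind fun i => (σ.getR S i).bind fun v => σ.setR S d v
  | .rstore p s => (σ.getW S p).bind fun i => (σ.getR S s).bind fun v => σ.setR S i v
  | .rop o d s t => (σ.getR S s).bind fun x => (σ.getR S t).bind fun y =>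
      (o.onReals x y).bind fun v => σ.setR S d v
  | .jump l => some (σ.branch True l)
  | .jumpWEq s t l => (σ.getW S s).bind fun x => (σ.getW S t).bind fun y =>
      some (σ.branch (x = y) l)
  | .jumpWLt s t l => (σ.getW S s).bind fun x => (σ.getW S t).bind fun y =>
      some (σ.branch (x < y) l)
  | .jumpREq s t l => (σ.getR S s).bind fun x => (σ.getR S t).bind fun y =>
      some (σ.branch (x = y) l)
  | .jumpRLt s t l => (σ.getR S s).bind fun x => (σ.getR S t).bind fun y =>
      some (σ.branch (x < y) l)
  | .halt => none

/-- One step of the program `P`; leaving the program is an error. -/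
noncomputable def step (P : Program) (S B : ℕ) (σ : Config) : Option Config :=
  P[σ.pc]?.bind (exec S B σ)

/-- `HaltsIn P S B t σ τ`: on a machine with `S` cells in each memory and words smaller than `B`,
program `P` started in `σ` executes exactly `t` instructions without an error and then stands
in configuration `τ` at a `halt` instruction. -/
inductive HaltsIn (P : Program) (S B : ℕ) : ℕ → Config → Config → Prop
  | halt (σ : Config) (h : P[σ.pc]? = some Instr.halt) : HaltsIn P S B 0 σ σ
  | step (t : ℕ) (σ τ ρ : Config) (h : step P S B σ = some τ) (h' : HaltsIn P S B t τ ρ) :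
      HaltsIn P S B (t + 1) σ ρ

end RealRAM

namespace IntervalSeparation

/-- The initial configuration for the intervals `[a i, b i]`, `i < n`, in the given (arbitrary)
order: `W[0] = n`, `R[2 i] = a i`, `R[2 i + 1] = b i`, and all other cells are zero. -/
noncomputable def input {n : ℕ} (a b : Fin n → ℝ) : RealRAM.Config where
  pc := 0
  W := fun k => if k = 0 then n else 0
  R := fun k => if h : k / 2 < n then (if k % 2 = 0 then a ⟨k / 2, h⟩ else b ⟨k / 2, h⟩) else 0

/-- The output: the new position of the left endpoint of interval `i` is read from `R[i]`. -/
def output (n : ℕ) (τ : RealRAM.Config) : Fin n → ℝ := fun i => τ.R i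

end IntervalSeparation

/-! Adding a constant to all positions turns moves by at most `D / 2` in both directions into moves
to the right by at most `D`. So the problem is to schedule jobs with release times `a i` and lengths
`b i - a i` on one machine such that the largest delay is minimum; subtracting half of that delay
from every start solves the original problem (`IsSchedule.isOptimalSeparation`).

Sort by left endpoints, and call an interval a champion if no earlier right endpoint exceeds its
own. The champions cut the sorted sequence into blocks. It suffices to consider schedules that treat
the blocks in order and are determined, within the block of a champion `M`, by an index `χ M`: the
intervals up to `χ M` run in order, then `M`, then the others, always holding back the one with the
largest right endpoint. When `M` is done, all intervals of its block have been released, so the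
machine idles no more until the next champion. Hence the first `j + 1` intervals take the time
`total (j + 1)` plus the largest `idle (χ M')` so far, and the delays in the block are bounded by
the sums `idle (χ M') + Q (χ M)`, `M' ≤ M`, where `Q r` depends on `r` only. This gives the
criterion `Feasible`.

The criterion is necessary (`IsSchedule.feasible`): in an arbitrary schedule, look at the interval
that ends last among `0, …, j`, for every `j`. The ends of these intervals bound the idle times from
above, their delays bound `Q`, and `IsSchedule.exists_choice` reads off one suitable index per
champion. It is sufficient because of a greedy construction, whose invariant `EmitInv` carries the
delays along: the champion is moved behind the first `r` for which the known minimum `D` allows it,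
and this happens no later than at `χ M`.

The minimum is found by a dynamic program over the sorted intervals. For a bound `x` on the idle
times, let `f x` be the least delay for the champions so far. Only the values of `idle` matter for
`x`, so `f` is a decreasing function of a rank `v`; it is stored as the suffix maxima of an array.
The best delay for a choice behind `r` is the minimum over `v` of the maximum of a decreasing
function, `f`, and an increasing one, `Vs v + Q r`, and lies where they cross (`isLocalOpt_of`). The
optimum of a block can be taken over its choices independently of `x`
(`IsRanking.feasibleBefore_iff`), so passing from one interval to the next is a single point update
(`DPInv.step`, `DPInv.step_champ`). A tournament tree supports update and search in logarithmic
time, and sorts as well. The values `Q` come from a backward scan along links to the next interval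
with no smaller right endpoint (`IsTailDelay.step`), in amortized linear time.

The algorithm is written in a small structured language with a tick count and verified with a
weakest precondition calculus; compilation to the machine costs a constant factor (`Exec.steps`). -/

namespace RealRAM

/-! ### A structured language on top of the real RAM -/

/-- The state of a structured program: word and real registers, arrays of words and of reals. -/
structure Store : Type where
  w : ℕ → ℕ
  r : ℕ → ℝ
  A : ℕ → ℕ → ℕ
  F : ℕ → ℕ → ℝ

/-- Total version of `Op.onWords`. -/
def Op.wval : Op → ℕ → ℕ → ℕ
  | .add, x, y => x + y
  | .sub, x, y => x - y
  | .mul, x, y => x * y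
  | .div, x, y => x / y

/-- The word operation succeeds and its result is smaller than `B`. -/
def Op.wok (B : ℕ) : Op → ℕ → ℕ → Prop
  | .add, x, y => x + y < B
  | .sub, _, _ => True
  | .mul, x, y => x * y < B
  | .div, _, y => y ≠ 0

/-- Total version of `Op.onReals`. -/
noncomputable def Op.rval : Op → ℝ → ℝ → ℝ
  | .add, x, y => x + y
  | .sub, x, y => x - y
  | .mul, x, y => x * y
  | .div, x, y => x / y

/-- The real operation succeeds. -/
def Op.rok : Op → ℝ → Prop
  | .div, y => y ≠ 0
  | _, _ => True

/-- Word expressions. -/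
inductive WExp : Type
  | reg (i : ℕ)
  | const (c : ℕ)
  | arr (k : ℕ) (e : WExp)
  | op (o : Op) (e₁ e₂ : WExp)

/-- Real expressions. -/
inductive RExp : Type
  | reg (i : ℕ)
  | const (q : ℚ)
  | arr (k : ℕ) (e : WExp)
  | op (o : Op) (e₁ e₂ : RExp)

/-- Conditions. -/
inductive BExp : Type
  | wlt (e₁ e₂ : WExp)
  | weq (e₁ e₂ : WExp)
  | rlt (e₁ e₂ : RExp)

/-- Structured programs. -/
inductive Cmd : Type
  | wset (d : ℕ) (e : WExp)
  | aset (k : ℕ) (i e : WExp)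
  | rset (d : ℕ) (e : RExp)
  | fset (k : ℕ) (i : WExp) (e : RExp)
  | seq (c₁ c₂ : Cmd)
  | ite (b : BExp) (c₁ c₂ : Cmd)
  | while (b : BExp) (c : Cmd)

/-- Valid indices of the real array `k`; array `16` is the raw input and output area. -/
def FIdx (n k i : ℕ) : Prop := if k = 16 then 64 ≤ i ∧ i < 2 * n + 64 else i < 4 * n + 64

def WExp.eval (s : Store) : WExp → ℕ
  | reg i => s.w i
  | const c => c
  | arr k e => s.A k (e.eval s)
  | op o e₁ e₂ => o.wval (e₁.eval s) (e₂.eval s)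

/-- Arrays of `4 * n + 64` cells have room for a tournament tree whose number of leaves is a power
of two up to `2 * n + 2`. -/
def WExp.ok (n B : ℕ) (s : Store) : WExp → Prop
  | reg _ => True
  | const _ => True
  | arr _ e => e.ok n B s ∧ e.eval s < 4 * n + 64
  | op o e₁ e₂ => e₁.ok n B s ∧ e₂.ok n B s ∧ o.wok B (e₁.eval s) (e₂.eval s)

noncomputable def RExp.eval (s : Store) : RExp → ℝ
  | reg i => s.r i
  | const q => q
  | arr k e => s.F k (e.eval s)
  | op o e₁ e₂ => o.rval (e₁.eval s) (e₂.eval s)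

def RExp.ok (n B : ℕ) (s : Store) : RExp → Prop
  | reg _ => True
  | const _ => True
  | arr k e => e.ok n B s ∧ FIdx n k (e.eval s)
  | op o e₁ e₂ => e₁.ok n B s ∧ e₂.ok n B s ∧ o.rok (e₂.eval s)

def BExp.eval (s : Store) : BExp → Prop
  | wlt e₁ e₂ => e₁.eval s < e₂.eval s
  | weq e₁ e₂ => e₁.eval s = e₂.eval s
  | rlt e₁ e₂ => e₁.eval s < e₂.eval s

def BExp.ok (n B : ℕ) (s : Store) : BExp → Prop
  | wlt e₁ e₂ => e₁.ok n B s ∧ e₂.ok n B s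
  | weq e₁ e₂ => e₁.ok n B s ∧ e₂.ok n B s
  | rlt e₁ e₂ => e₁.ok n B s ∧ e₂.ok n B s

namespace Store

def setW (s : Store) (d v : ℕ) : Store := { s with w := Function.update s.w d v }

def setR (s : Store) (d : ℕ) (v : ℝ) : Store := { s with r := Function.update s.r d v }

def setA (s : Store) (k i v : ℕ) : Store :=
  { s with A := Function.update s.A k (Function.update (s.A k) i v) }

def setF (s : Store) (k i : ℕ) (v : ℝ) : Store :=
  { s with F := Function.update s.F k (Function.update (s.F k) i v) }

end Store

/-- `Exec n B c s t s'`: the structured program `c`, started in `s`, ends in `s'` after `t` ticks;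
all array accesses are within bounds and all words stay below `B`. -/
inductive Exec (n B : ℕ) : Cmd → Store → ℕ → Store → Prop
  | wset (d e s) (h : WExp.ok n B s e) : Exec n B (.wset d e) s 1 (s.setW d (e.eval s))
  | aset (k i e s) (hi : WExp.ok n B s i) (he : WExp.ok n B s e) (hk : i.eval s < 4 * n + 64) :
      Exec n B (.aset k i e) s 1 (s.setA k (i.eval s) (e.eval s))
  | rset (d e s) (h : RExp.ok n B s e) : Exec n B (.rset d e) s 1 (s.setR d (e.eval s))
  | fset (k i e s) (hi : WExp.ok n B s i) (he : RExp.ok n B s e) (hk : FIdx n k (i.eval s)) :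
      Exec n B (.fset k i e) s 1 (s.setF k (i.eval s) (e.eval s))
  | seq (c₁ c₂ s t₁ s₁ t₂ s₂) (h₁ : Exec n B c₁ s t₁ s₁) (h₂ : Exec n B c₂ s₁ t₂ s₂) :
      Exec n B (.seq c₁ c₂) s (t₁ + t₂) s₂
  | ite_true (b c₁ c₂ s t s') (hb : BExp.ok n B s b) (h : b.eval s) (h₁ : Exec n B c₁ s t s') :
      Exec n B (.ite b c₁ c₂) s (t + 1) s'
  | ite_false (b c₁ c₂ s t s') (hb : BExp.ok n B s b) (h : ¬ b.eval s)
      (h₁ : Exec n B c₂ s t s') : Exec n B (.ite b c₁ c₂) s (t + 1) s'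
  | while_true (b c s t₁ s₁ t₂ s₂) (hb : BExp.ok n B s b) (h : b.eval s)
      (h₁ : Exec n B c s t₁ s₁) (h₂ : Exec n B (.while b c) s₁ t₂ s₂) :
      Exec n B (.while b c) s (t₁ + 1 + t₂) s₂
  | while_false (b c s) (hb : BExp.ok n B s b) (h : ¬ b.eval s) : Exec n B (.while b c) s 1 s

/-! ### Compilation -/

/-- Code that turns the index in `W[32 + t]` into the address of the word array element. -/
def wordPtrCode (k t : ℕ) : List Instr :=
  [.wconst (33 + t) 8, .wop .mul (32 + t) (32 + t) (33 + t), .wconst (33 + t) (64 + k),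
    .wop .add (32 + t) (32 + t) (33 + t)]

/-- Code that leaves the value of the expression in `W[32 + t]`. -/
def WExp.code : WExp → ℕ → List Instr
  | reg i, t => [.wcopy (32 + t) (1 + i)]
  | const c, t => [.wconst (32 + t) c]
  | arr k e, t => e.code t ++ (wordPtrCode k t ++ [.wload (32 + t) (32 + t)])
  | op o e₁ e₂, t => e₁.code t ++ e₂.code (t + 1) ++ [.wop o (32 + t) (32 + t) (33 + t)]

/-- Code that turns the index in `W[32]` into the address of the real array element. -/
def ptrCode (k : ℕ) : List Instr :=
  if k = 16 then [] else
    [.wconst 33 16, .wop .mul 32 32 33, .wop .add 33 0 0, .wop .add 32 32 33,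
      .wconst 33 (64 + k), .wop .add 32 32 33]

/-- Code that leaves the value of the expression in `R[32 + t]`. -/
def RExp.code : RExp → ℕ → List Instr
  | reg i, t => [.rcopy (32 + t) i]
  | const q, t => [.rconst (32 + t) q]
  | arr k e, t => e.code 0 ++ (ptrCode k ++ [.rload (32 + t) 32])
  | op o e₁ e₂, t => e₁.code t ++ e₂.code (t + 1) ++ [.rop o (32 + t) (32 + t) (33 + t)]

/-- Code that prepares the operands of a comparison. -/
def BExp.code : BExp → List Instr
  | wlt e₁ e₂ => e₁.code 0 ++ e₂.code 1
  | weq e₁ e₂ => e₁.code 0 ++ e₂.code 1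
  | rlt e₁ e₂ => e₁.code 0 ++ e₂.code 1

/-- The conditional jump of a comparison. -/
def BExp.jump (l : ℕ) : BExp → Instr
  | wlt _ _ => .jumpWLt 32 33 l
  | weq _ _ => .jumpWEq 32 33 l
  | rlt _ _ => .jumpRLt 32 33 l

/-- The length of the compiled program. -/
def Cmd.len : Cmd → ℕ
  | wset _ e => (e.code 0).length + 1
  | aset k i e => (i.code 0).length + ((wordPtrCode k 0).length + ((e.code 1).length + 1))
  | rset _ e => (e.code 0).length + 1
  | fset k i e => (e.code 0).length + ((i.code 0).length + ((ptrCode k).length + 1))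
  | seq c₁ c₂ => c₁.len + c₂.len
  | ite b c₁ c₂ => b.code.length + (1 + (c₂.len + (1 + c₁.len)))
  | .while b c => b.code.length + (2 + (c.len + 1))

/-- The compiled program, to be placed at address `p`. -/
def Cmd.code : Cmd → ℕ → List Instr
  | wset d e, _ => e.code 0 ++ [.wcopy (1 + d) 32]
  | aset k i e, _ => i.code 0 ++ (wordPtrCode k 0 ++ (e.code 1 ++ [.wstore 32 33]))
  | rset d e, _ => e.code 0 ++ [.rcopy d 32]
  | fset k i e, _ => e.code 0 ++ (i.code 0 ++ (ptrCode k ++ [.rstore 32 32]))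
  | seq c₁ c₂, p => c₁.code p ++ c₂.code (p + c₁.len)
  | ite b c₁ c₂, p => b.code ++ ([b.jump (p + b.code.length + 1 + c₂.len + 1)] ++
      (c₂.code (p + b.code.length + 1) ++ ([.jump (p + b.code.length + 1 + c₂.len + 1 + c₁.len)] ++
        c₁.code (p + b.code.length + 1 + c₂.len + 1))))
  | .while b c, p => b.code ++ ([b.jump (p + b.code.length + 2),
      .jump (p + b.code.length + 2 + c.len + 1)] ++ (c.code (p + b.code.length + 2) ++ [.jump p]))

theorem Cmd.length_code (c : Cmd) (p : ℕ) : (c.code p).length = c.len := by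
  induction c generalizing p <;> simp only [Cmd.code, Cmd.len, List.length_append, List.length_cons,
    List.length_nil, *]

/-- The largest number of instructions executed in one tick. -/
def Cmd.width : Cmd → ℕ
  | seq c₁ c₂ => max c₁.width c₂.width
  | ite b c₁ c₂ => max (b.code.length + 2) (max c₁.width c₂.width)
  | .while b c => max (b.code.length + 2) c.width
  | c => c.len

/-! Static checks: registers and array names are in range and temporaries suffice. -/

def WExp.wf : WExp → ℕ → Bool
  | reg i, t => decide (i < 31) && decide (t < 31)
  | const c, t => decide (c < 1024) && decide (t < 31)
  | arr k e, t => e.wf t && (decide (k < 8) && decide (t < 31))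
  | op _ e₁ e₂, t => e₁.wf t && e₂.wf (t + 1)

def RExp.wf : RExp → ℕ → Bool
  | reg i, t => decide (i < 32) && decide (t < 31)
  | const _, t => decide (t < 31)
  | arr k e, t => e.wf 0 && (decide (k ≤ 16) && decide (t < 31))
  | op _ e₁ e₂, t => e₁.wf t && e₂.wf (t + 1)

def BExp.wf : BExp → Bool
  | wlt e₁ e₂ => e₁.wf 0 && e₂.wf 1
  | weq e₁ e₂ => e₁.wf 0 && e₂.wf 1
  | rlt e₁ e₂ => e₁.wf 0 && e₂.wf 1

def Cmd.wf : Cmd → Bool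
  | wset d e => e.wf 0 && decide (d < 31)
  | aset k i e => i.wf 0 && e.wf 1 && decide (k < 8)
  | rset d e => e.wf 0 && decide (d < 32)
  | fset k i e => i.wf 0 && e.wf 0 && decide (k ≤ 16)
  | seq c₁ c₂ => c₁.wf && c₂.wf
  | ite b c₁ c₂ => b.wf && c₁.wf && c₂.wf
  | .while b c => b.wf && c.wf

/-! ### Straight-line code -/

/-- Execute a list of instructions one after the other. -/
noncomputable def execList (S B : ℕ) : List Instr → Config → Option Config
  | [], σ => some σ
  | i :: l, σ => (exec S B σ i).bind (execList S B l)

theorem execList_append (S B : ℕ) (l₁ l₂ : List Instr) (σ : Config) :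
    execList S B (l₁ ++ l₂) σ = (execList S B l₁ σ).bind (execList S B l₂) := by
  induction l₁ generalizing σ with
  | nil => rfl
  | cons i l ih =>
    simp only [List.cons_append, execList]
    cases exec S B σ i <;> simp [ih]

/-- The instruction is neither a jump nor `halt`. -/
def Instr.IsLinear : Instr → Prop
  | .jump _ => False
  | .jumpWEq _ _ _ => False
  | .jumpWLt _ _ _ => False
  | .jumpREq _ _ _ => False
  | .jumpRLt _ _ _ => False
  | .halt => False
  | _ => True

theorem pc_of_exec {S B : ℕ} {σ τ : Config} {i : Instr} (hi : i.IsLinear)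
    (h : exec S B σ i = some τ) : τ.pc = σ.pc + 1 := by
  have hW : ∀ a v, σ.setW S B a v = some τ → τ.pc = σ.pc + 1 := by
    intro a v h; unfold Config.setW at h; split_ifs at h; cases h; rfl
  have hR : ∀ a v, σ.setR S a v = some τ → τ.pc = σ.pc + 1 := by
    intro a v h; unfold Config.setR at h; split_ifs at h; cases h; rfl
  cases i <;> simp only [exec, Instr.IsLinear, Option.bind_eq_some_iff] at h hi
  case wconst => exact hW _ _ h
  case wcopy => obtain ⟨_, _, h⟩ := h; exact hW _ _ h
  case wload => obtain ⟨_, _, _, _, h⟩ := h; exact hW _ _ h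
  case wstore => obtain ⟨_, _, _, _, h⟩ := h; exact hW _ _ h
  case wop => obtain ⟨_, _, _, _, _, _, h⟩ := h; exact hW _ _ h
  case rconst => exact hR _ _ h
  case rcopy => obtain ⟨_, _, h⟩ := h; exact hR _ _ h
  case rload => obtain ⟨_, _, _, _, h⟩ := h; exact hR _ _ h
  case rstore => obtain ⟨_, _, _, _, h⟩ := h; exact hR _ _ h
  case rop => obtain ⟨_, _, _, _, _, _, h⟩ := h; exact hR _ _ h

/-- `t` steps of the machine. -/
inductive Steps (P : Program) (S B : ℕ) : ℕ → Config → Config → Prop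
  | refl (σ) : Steps P S B 0 σ σ
  | head (t σ τ ρ) (h : step P S B σ = some τ) (h' : Steps P S B t τ ρ) : Steps P S B (t + 1) σ ρ

theorem Steps.trans {P : Program} {S B t t' : ℕ} {σ τ ρ : Config} (h : Steps P S B t σ τ)
    (h' : Steps P S B t' τ ρ) : Steps P S B (t + t') σ ρ := by
  induction h with
  | refl => simpa using h'
  | head t σ τ ρ h _ ih => rw [Nat.add_right_comm]; exact .head _ _ _ _ h (ih h')

theorem Steps.haltsIn {P : Program} {S B t : ℕ} {σ τ : Config} (h : Steps P S B t σ τ)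
    (h' : P[τ.pc]? = some Instr.halt) : HaltsIn P S B t σ τ := by
  induction h with
  | refl => exact .halt _ h'
  | head t σ τ ρ h _ ih => exact .step _ _ _ _ h (ih h')

/-- The list `l` of instructions stands at address `p` of the program `P`. -/
def CodeAt (P : Program) (p : ℕ) (l : List Instr) : Prop :=
  ∀ i < l.length, P[p + i]? = l[i]?

theorem codeAt_append {P : Program} {p : ℕ} {l₁ l₂ : List Instr} :
    CodeAt P p (l₁ ++ l₂) ↔ CodeAt P p l₁ ∧ CodeAt P (p + l₁.length) l₂ := by
  constructor
  · intro h
    refine ⟨fun i hi => ?_, fun i hi => ?_⟩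
    · rw [h i (by simp; omega), List.getElem?_append_left hi]
    · rw [Nat.add_assoc, h _ (by simp; omega), List.getElem?_append_right (by omega)]
      simp
  · rintro ⟨h₁, h₂⟩ i hi
    by_cases h : i < l₁.length
    · rw [h₁ i h, List.getElem?_append_left h]
    · have := h₂ (i - l₁.length) (by simp at hi; omega)
      rw [List.getElem?_append_right (by omega), ← this]
      congr 1; omega

theorem codeAt_cons {P : Program} {p : ℕ} {i : Instr} {l : List Instr} :
    CodeAt P p (i :: l) ↔ P[p]? = some i ∧ CodeAt P (p + 1) l := by
  rw [← List.singleton_append, codeAt_append]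
  simp [CodeAt]

theorem steps_of_execList {P : Program} {S B : ℕ} {l : List Instr} {σ τ : Config}
    (hl : ∀ i ∈ l, i.IsLinear) (hP : CodeAt P σ.pc l) (h : execList S B l σ = some τ) :
    Steps P S B l.length σ τ ∧ τ.pc = σ.pc + l.length := by
  induction l generalizing σ with
  | nil => cases h; exact ⟨.refl _, rfl⟩
  | cons i l ih =>
    simp only [execList, Option.bind_eq_some_iff] at h
    obtain ⟨ρ, h₁, h₂⟩ := h
    rw [codeAt_cons] at hP
    have hpc := pc_of_exec (hl i (by simp)) h₁
    obtain ⟨h₃, h₄⟩ := ih (fun j hj => hl j (by simp [hj])) (by rw [hpc]; exact hP.2) h₂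
    refine ⟨.head _ _ _ _ ?_ h₃, by rw [h₄, hpc, List.length_cons]; omega⟩
    simp [step, hP.1, h₁]

theorem WExp.isLinear_of_mem_code (e : WExp) (t : ℕ) : ∀ i ∈ e.code t, i.IsLinear := by
  induction e generalizing t with
  | reg | const => simp [WExp.code, Instr.IsLinear]
  | arr k e ih =>
    simp only [WExp.code, List.mem_append]
    rintro i (h | h | h)
    · exact ih _ _ h
    · revert i; simp [wordPtrCode, Instr.IsLinear]
    · revert i; simp [Instr.IsLinear]
  | op o e₁ e₂ ih₁ ih₂ =>
    simp only [WExp.code, List.mem_append]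
    rintro i ((h | h) | h)
    · exact ih₁ _ _ h
    · exact ih₂ _ _ h
    · revert i; simp [Instr.IsLinear]

theorem isLinear_of_mem_ptrCode (k : ℕ) : ∀ i ∈ ptrCode k, i.IsLinear := by
  unfold ptrCode; split_ifs <;> simp [Instr.IsLinear]

theorem RExp.isLinear_of_mem_code (e : RExp) (t : ℕ) : ∀ i ∈ e.code t, i.IsLinear := by
  induction e generalizing t with
  | reg | const => simp [RExp.code, Instr.IsLinear]
  | arr k e =>
    simp only [RExp.code, List.mem_append]
    rintro i (h | h | h)
    · exact e.isLinear_of_mem_code _ _ h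
    · exact isLinear_of_mem_ptrCode _ _ h
    · revert i; simp [Instr.IsLinear]
  | op o e₁ e₂ ih₁ ih₂ =>
    simp only [RExp.code, List.mem_append]
    rintro i ((h | h) | h)
    · exact ih₁ _ _ h
    · exact ih₂ _ _ h
    · revert i; simp [Instr.IsLinear]

theorem BExp.isLinear_of_mem_code (b : BExp) : ∀ i ∈ b.code, i.IsLinear := by
  intro i h
  cases b <;> simp only [BExp.code, List.mem_append] at h
  · exact h.elim (WExp.isLinear_of_mem_code _ _ _) (WExp.isLinear_of_mem_code _ _ _)
  · exact h.elim (WExp.isLinear_of_mem_code _ _ _) (WExp.isLinear_of_mem_code _ _ _)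
  · exact h.elim (RExp.isLinear_of_mem_code _ _ _) (RExp.isLinear_of_mem_code _ _ _)

end RealRAM

/-! ### Simulation of expressions by straight-line code -/

namespace RealRAM

/-- The code transforms the memories `W`, `R` into `W'`, `R'`. -/
def RunsTo (n B : ℕ) (l : List Instr) (W : ℕ → ℕ) (R : ℕ → ℝ) (W' : ℕ → ℕ) (R' : ℕ → ℝ) : Prop :=
  ∀ p, execList (66 * n + 1200) B l ⟨p, W, R⟩ = some ⟨p + l.length, W', R'⟩

theorem RunsTo.append {n B : ℕ} {l₁ l₂ : List Instr} {W W' W'' : ℕ → ℕ} {R R' R'' : ℕ → ℝ}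
    (h₁ : RunsTo n B l₁ W R W' R') (h₂ : RunsTo n B l₂ W' R' W'' R'') :
    RunsTo n B (l₁ ++ l₂) W R W'' R'' := by
  intro p
  rw [execList_append, h₁ p, Option.bind_some, h₂, List.length_append, Nat.add_assoc]

theorem RunsTo.cons {n B : ℕ} {i : Instr} {l₂ : List Instr} {W W' W'' : ℕ → ℕ}
    {R R' R'' : ℕ → ℝ} (h₁ : RunsTo n B [i] W R W' R') (h₂ : RunsTo n B l₂ W' R' W'' R'') :
    RunsTo n B (i :: l₂) W R W'' R'' :=
  RunsTo.append h₁ h₂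

section

variable {n B : ℕ} {W : ℕ → ℕ} {R : ℕ → ℝ}

theorem runsTo_nil : RunsTo n B [] W R W R := fun _ => rfl

theorem runsTo_wconst {d c : ℕ} (hd : d < 66 * n + 1200) (hc : c < B) :
    RunsTo n B [.wconst d c] W R (Function.update W d c) R := by
  intro p; simp [execList, exec, Config.setW, hd, hc]

theorem runsTo_wcopy {d s : ℕ} (hd : d < 66 * n + 1200) (hs : s < 66 * n + 1200) (hc : W s < B) :
    RunsTo n B [.wcopy d s] W R (Function.update W d (W s)) R := by
  intro p; simp [execList, exec, Config.setW, Config.getW, hd, hc, hs]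

theorem runsTo_wload {d q : ℕ} (hd : d < 66 * n + 1200) (hq : q < 66 * n + 1200)
    (hi : W q < 66 * n + 1200) (hc : W (W q) < B) :
    RunsTo n B [.wload d q] W R (Function.update W d (W (W q))) R := by
  intro p; simp [execList, exec, Config.setW, Config.getW, hd, hc, hq, hi]

theorem runsTo_wstore {s q : ℕ} (hs : s < 66 * n + 1200) (hq : q < 66 * n + 1200)
    (hi : W q < 66 * n + 1200) (hc : W s < B) :
    RunsTo n B [.wstore q s] W R (Function.update W (W q) (W s)) R := by
  intro p; simp [execList, exec, Config.setW, Config.getW, hs, hc, hq, hi]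

theorem runsTo_wop {o : Op} {d s t : ℕ} (hd : d < 66 * n + 1200) (hs : s < 66 * n + 1200)
    (ht : t < 66 * n + 1200) (ho : o.wok B (W s) (W t)) (hB : W s < B) :
    RunsTo n B [.wop o d s t] W R (Function.update W d (o.wval (W s) (W t))) R := by
  intro p
  cases o <;> simp only [Op.wok] at ho <;>
    simp [execList, exec, Config.setW, Config.getW, hd, hs, ht, ho, Op.onWords, Op.wval]
  · omega
  · exact (Nat.div_le_self _ _).trans_lt hB

theorem runsTo_rconst {d : ℕ} {q : ℚ} (hd : d < 66 * n + 1200) :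
    RunsTo n B [.rconst d q] W R W (Function.update R d q) := by
  intro p; simp [execList, exec, Config.setR, hd]

theorem runsTo_rcopy {d s : ℕ} (hd : d < 66 * n + 1200) (hs : s < 66 * n + 1200) :
    RunsTo n B [.rcopy d s] W R W (Function.update R d (R s)) := by
  intro p; simp [execList, exec, Config.setR, Config.getR, hd, hs]

theorem runsTo_rload {d q : ℕ} (hd : d < 66 * n + 1200) (hq : q < 66 * n + 1200)
    (hi : W q < 66 * n + 1200) :
    RunsTo n B [.rload d q] W R W (Function.update R d (R (W q))) := by
  intro p; simp [execList, exec, Config.setR, Config.getR, Config.getW, hd, hq, hi]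

theorem runsTo_rstore {s q : ℕ} (hs : s < 66 * n + 1200) (hq : q < 66 * n + 1200)
    (hi : W q < 66 * n + 1200) :
    RunsTo n B [.rstore q s] W R W (Function.update R (W q) (R s)) := by
  intro p; simp [execList, exec, Config.setR, Config.getR, Config.getW, hs, hq, hi]

theorem runsTo_rop {o : Op} {d s t : ℕ} (hd : d < 66 * n + 1200) (hs : s < 66 * n + 1200)
    (ht : t < 66 * n + 1200) (ho : o.rok (R t)) :
    RunsTo n B [.rop o d s t] W R W (Function.update R d (o.rval (R s) (R t))) := by
  intro p
  cases o <;> simp only [Op.rok] at ho <;>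
    simp [execList, exec, Config.setR, Config.getR, hd, hs, ht, Op.onReals, Op.rval, ho]

end

/-- The address of an element of a real array. -/
def realAddr (n k i : ℕ) : ℕ := if k = 16 then i else 2 * n + 64 + 16 * i + k

/-- Real cells below 32 are registers, those from 32 to 63 temporaries, those from 64 to `2 * n +
63` belong to the raw area, and the arrays `0, …, 15` are interleaved behind it. The largest
address, `2 * n + 64 + 16 * (4 * n + 63) + 15`, is the reason for the memory size `66 * n + 1200`.
-/
theorem realAddr_lt {n k i : ℕ} (hk : k ≤ 16) (h : FIdx n k i) :
    64 ≤ realAddr n k i ∧ realAddr n k i < 66 * n + 1200 := by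
  unfold FIdx at h; unfold realAddr; split_ifs at h ⊢ <;> omega

theorem realAddr_inj {n k i k' i' : ℕ} (hk : k ≤ 16) (hk' : k' ≤ 16) (h : FIdx n k i)
    (h' : FIdx n k' i') (he : realAddr n k i = realAddr n k' i') : k = k' ∧ i = i' := by
  unfold FIdx at h h'; unfold realAddr at he; split_ifs at h h' he <;> omega

/-- The memories `W` and `R` of the machine represent the store `s`. -/
structure Sim (n B : ℕ) (s : Store) (W : ℕ → ℕ) (R : ℕ → ℝ) : Prop where
  size : W 0 = n
  small : ∀ a, W a < B
  w : ∀ i < 31, W (1 + i) = s.w i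
  A : ∀ k < 8, ∀ i < 4 * n + 64, W (64 + 8 * i + k) = s.A k i
  r : ∀ i < 32, R i = s.r i
  F : ∀ k ≤ 16, ∀ i, FIdx n k i → R (realAddr n k i) = s.F k i

/-- Cells 32 to 63 of both memories are scratch space and represent nothing. -/
theorem Sim.congr {n B : ℕ} {s : Store} {W W' : ℕ → ℕ} {R R' : ℕ → ℝ} (h : Sim n B s W R)
    (hs : ∀ a, W' a < B) (hW : ∀ a, a < 32 ∨ 64 ≤ a → W' a = W a)
    (hR : ∀ a, a < 32 ∨ 64 ≤ a → R' a = R a) : Sim n B s W' R' where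
  size := by rw [hW _ (by omega), h.size]
  small := hs
  w i hi := by rw [hW _ (by omega), h.w i hi]
  A k hk i hi := by rw [hW _ (by omega), h.A k hk i hi]
  r i hi := by rw [hR _ (by omega), h.r i hi]
  F k hk i hi := by rw [hR _ (Or.inr (realAddr_lt hk hi).1), h.F k hk i hi]

theorem update_lt {W : ℕ → ℕ} {B d v : ℕ} (h : ∀ a, W a < B) (hv : v < B) :
    ∀ a, Function.update W d v a < B := by
  intro a; by_cases ha : a = d
  · subst ha; simpa
  · simpa [Function.update_of_ne ha] using h a

theorem Op.wval_lt {o : Op} {B x y : ℕ} (h : o.wok B x y) (hx : x < B) : o.wval x y < B := by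
  cases o <;> simp only [Op.wok, Op.wval] at *
  · exact h
  · omega
  · exact h
  · exact (Nat.div_le_self _ _).trans_lt hx

section

variable {n B : ℕ} (hB : 66 * n + 1200 ≤ B)
include hB

theorem wordPtrCode_spec {W : ℕ → ℕ} {R : ℕ → ℝ} {k t i : ℕ} (hk : k < 8) (ht : t < 31)
    (hi : i < 4 * n + 64) (hs : ∀ a, W a < B) (hW : W (32 + t) = i) :
    ∃ W', RunsTo n B (wordPtrCode k t) W R W' R ∧ W' (32 + t) = 64 + 8 * i + k ∧
      (∀ a, a ≠ 32 + t → a ≠ 33 + t → W' a = W a) ∧ ∀ a, W' a < B := by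
  refine ⟨_, .cons (runsTo_wconst (by omega) (by omega)) (.cons (runsTo_wop (by omega) (by omega)
    (by omega) ?_ ?_) (.cons (runsTo_wconst (by omega) (by omega)) (runsTo_wop (by omega)
    (by omega) (by omega) ?_ ?_))), ?_, ?_, ?_⟩
  · simp [Op.wok, hW]; omega
  · simp [hW]; omega
  · simp [Op.wok, Op.wval, hW]; omega
  · simp [Op.wval, hW]; omega
  · simp [Op.wval, hW]; omega
  · intro a h₁ h₂; simp [h₁, h₂]
  · refine update_lt (update_lt (update_lt (update_lt hs (by omega)) ?_) (by omega)) ?_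
    · simp [Op.wval, hW]; omega
    · simp [Op.wval, hW]; omega

/-- The temporaries form a stack: evaluation at depth `t` leaves those below `32 + t` alone, so the
left operand of an operation survives the evaluation of the right one at depth `t + 1`. -/
theorem WExp.code_spec {s : Store} {R : ℕ → ℝ} (e : WExp) (t : ℕ) {W : ℕ → ℕ}
    (sim : Sim n B s W R) (wf : e.wf t = true) (ok : e.ok n B s) :
    ∃ W', RunsTo n B (e.code t) W R W' R ∧ W' (32 + t) = e.eval s ∧
      (∀ a, a < 32 + t ∨ 64 ≤ a → W' a = W a) ∧ ∀ a, W' a < B := by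
  induction e generalizing t W with
  | reg i =>
    simp only [WExp.wf, Bool.and_eq_true, decide_eq_true_eq] at wf
    refine ⟨_, runsTo_wcopy (by omega) (by omega) (sim.small _), ?_, ?_,
      update_lt sim.small (sim.small _)⟩
    · simp [WExp.eval, sim.w i wf.1]
    · intro a ha; exact Function.update_of_ne (by omega) _ _
  | const c =>
    simp only [WExp.wf, Bool.and_eq_true, decide_eq_true_eq] at wf
    refine ⟨_, runsTo_wconst (by omega) (by omega), ?_, ?_,
      update_lt sim.small (by omega)⟩
    · simp [WExp.eval]
    · intro a ha; exact Function.update_of_ne (by omega) _ _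
  | arr k e ih =>
    simp only [WExp.wf, Bool.and_eq_true, decide_eq_true_eq] at wf
    obtain ⟨W₁, h₁, v₁, f₁, s₁⟩ := ih t sim wf.1 ok.1
    obtain ⟨W₂, h₂, v₂, f₂, s₂⟩ := wordPtrCode_spec hB (R := R) wf.2.1 wf.2.2 ok.2 s₁ v₁
    refine ⟨_, h₁.append (h₂.append (runsTo_wload (by omega) (by omega) ?_ (s₂ _))), ?_, ?_,
      update_lt s₂ (s₂ _)⟩
    · rw [v₂]; have := ok.2; omega
    · rw [Function.update_self, v₂, f₂ _ (by omega) (by omega), f₁ _ (by omega),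
        sim.A k wf.2.1 _ ok.2]; rfl
    · intro a ha
      rw [Function.update_of_ne (by omega), f₂ _ (by omega) (by omega), f₁ _ ha]
  | op o e₁ e₂ ih₁ ih₂ =>
    simp only [WExp.wf, Bool.and_eq_true] at wf
    obtain ⟨W₁, h₁, v₁, f₁, s₁⟩ := ih₁ t sim wf.1 ok.1
    obtain ⟨W₂, h₂, v₂, f₂, s₂⟩ := ih₂ (t + 1)
      (sim.congr s₁ (fun a ha => f₁ a (by omega)) (fun _ _ => rfl)) wf.2 ok.2.1
    have ht : t + 1 < 31 := by
      have : ∀ (e : WExp) (t : ℕ), e.wf t = true → t < 31 := by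
        intro e; induction e <;> intro t h <;>
          simp only [WExp.wf, Bool.and_eq_true, decide_eq_true_eq] at h
        · exact h.2
        · exact h.2
        · exact h.2.2
        · rename_i ih _; exact ih _ h.1
      exact this _ _ wf.2
    have e₁' : W₂ (32 + t) = e₁.eval s := by rw [f₂ _ (by omega), v₁]
    have e₂' : W₂ (33 + t) = e₂.eval s := by
      rw [← v₂]; congr 1; omega
    have hok : o.wok B (W₂ (32 + t)) (W₂ (33 + t)) := by rw [e₁', e₂']; exact ok.2.2
    refine ⟨_, (h₁.append h₂).append (runsTo_wop (by omega) (by omega) (by omega) hok (s₂ _)),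
      ?_, ?_, update_lt s₂ (Op.wval_lt hok (s₂ _))⟩
    · rw [Function.update_self, e₁', e₂']; rfl
    · intro a ha
      rw [Function.update_of_ne (by omega), f₂ _ (by omega), f₁ _ ha]

theorem ptrCode_spec {W : ℕ → ℕ} {R : ℕ → ℝ} {k i : ℕ} (hk : k ≤ 16) (h0 : W 0 = n)
    (hi : FIdx n k i) (hs : ∀ a, W a < B) (hW : W 32 = i) :
    ∃ W', RunsTo n B (ptrCode k) W R W' R ∧ W' 32 = realAddr n k i ∧
      (∀ a, a ≠ 32 → a ≠ 33 → W' a = W a) ∧ ∀ a, W' a < B := by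
  unfold ptrCode realAddr FIdx at *
  split_ifs at hi ⊢
  · exact ⟨W, runsTo_nil, hW, fun _ _ _ => rfl, hs⟩
  · refine ⟨_, .cons (runsTo_wconst (by omega) (by omega)) (.cons (runsTo_wop (by omega) (by omega)
      (by omega) ?_ ?_) (.cons (runsTo_wop (by omega) (by omega) (by omega) ?_ ?_)
      (.cons (runsTo_wop (by omega) (by omega) (by omega) ?_ ?_)
      (.cons (runsTo_wconst (by omega) (by omega)) (runsTo_wop (by omega)
      (by omega) (by omega) ?_ ?_))))), ?_, ?_, ?_⟩
    · simp [Op.wok, hW]; omega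
    · simp [hW]; omega
    · simp [Op.wok, Op.wval, hW, h0]; omega
    · simp [Op.wval, hW, h0]; omega
    · simp [Op.wok, Op.wval, hW, h0]; omega
    · simp [Op.wval, hW]; omega
    · simp [Op.wok, Op.wval, hW, h0]; omega
    · simp [Op.wval, hW, h0]; omega
    · simp [Op.wval, hW, h0]; omega
    · intro a h₁ h₂; simp [h₁, h₂]
    · refine update_lt (update_lt (update_lt (update_lt (update_lt (update_lt hs (by omega)) ?_) ?_)
        ?_) (by omega)) ?_ <;>
      · simp [Op.wval, hW, h0]; omega

omit hB in
theorem RExp.lt_of_wf (e : RExp) {t : ℕ} (h : e.wf t = true) : t < 31 := by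
  induction e generalizing t <;>
    simp only [RExp.wf, Bool.and_eq_true, decide_eq_true_eq] at h
  · exact h.2
  · exact h
  · exact h.2.2
  · rename_i ih _; exact ih h.1

/-- Only the real temporaries are stacked. Every array index is evaluated at depth 0 of the word
temporaries, because no word value has to survive while a real expression is evaluated. -/
theorem RExp.code_spec {s : Store} (e : RExp) (t : ℕ) {W : ℕ → ℕ} {R : ℕ → ℝ}
    (sim : Sim n B s W R) (wf : e.wf t = true) (ok : e.ok n B s) :
    ∃ W' R', RunsTo n B (e.code t) W R W' R' ∧ R' (32 + t) = e.eval s ∧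
      (∀ a, a < 32 ∨ 64 ≤ a → W' a = W a) ∧ (∀ a, W' a < B) ∧
      (∀ a, a < 32 + t ∨ 64 ≤ a → R' a = R a) := by
  have ht := e.lt_of_wf wf
  induction e generalizing t W R with
  | reg i =>
    simp only [RExp.wf, Bool.and_eq_true, decide_eq_true_eq] at wf
    refine ⟨_, _, runsTo_rcopy (by omega) (by omega), ?_, fun _ _ => rfl, sim.small, ?_⟩
    · simp [RExp.eval, sim.r i wf.1]
    · intro a ha; exact Function.update_of_ne (by omega) _ _
  | const q =>
    refine ⟨_, _, runsTo_rconst (by omega), ?_, fun _ _ => rfl, sim.small, ?_⟩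
    · simp [RExp.eval]
    · intro a ha; exact Function.update_of_ne (by omega) _ _
  | arr k e =>
    simp only [RExp.wf, Bool.and_eq_true, decide_eq_true_eq] at wf
    obtain ⟨W₁, h₁, v₁, f₁, s₁⟩ := e.code_spec hB 0 sim wf.1 ok.1
    obtain ⟨W₂, h₂, v₂, f₂, s₂⟩ := ptrCode_spec hB (R := R) wf.2.1
      (by rw [f₁ _ (by omega), sim.size]) ok.2 s₁ v₁
    have hlt := realAddr_lt wf.2.1 ok.2
    refine ⟨_, _, h₁.append (h₂.append (runsTo_rload (by omega) (by omega) ?_)), ?_, ?_, s₂, ?_⟩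
    · rw [v₂]; exact hlt.2
    · rw [Function.update_self, v₂, sim.F k wf.2.1 _ ok.2]; rfl
    · intro a ha
      rw [f₂ _ (by omega) (by omega), f₁ _ (by omega)]
    · intro a ha; exact Function.update_of_ne (by omega) _ _
  | op o e₁ e₂ ih₁ ih₂ =>
    simp only [RExp.wf, Bool.and_eq_true] at wf
    have ht' := e₂.lt_of_wf wf.2
    obtain ⟨W₁, R₁, h₁, v₁, f₁, s₁, g₁⟩ := ih₁ t sim wf.1 ok.1 ht
    obtain ⟨W₂, R₂, h₂, v₂, f₂, s₂, g₂⟩ := ih₂ (t + 1)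
      (sim.congr s₁ f₁ (fun a ha => g₁ a (by omega))) wf.2 ok.2.1 ht'
    have e₁' : R₂ (32 + t) = e₁.eval s := by rw [g₂ _ (by omega), v₁]
    have e₂' : R₂ (33 + t) = e₂.eval s := by
      rw [← v₂]; congr 1; omega
    refine ⟨_, _, (h₁.append h₂).append (runsTo_rop (by omega) (by omega) (by omega) ?_),
      ?_, ?_, s₂, ?_⟩
    · rw [e₂']; exact ok.2.2
    · rw [Function.update_self, e₁', e₂']; rfl
    · intro a ha; rw [f₂ _ ha, f₁ _ ha]
    · intro a ha
      rw [Function.update_of_ne (by omega), g₂ _ (by omega), g₁ _ ha]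

end

/-! ### Simulation of control flow and of whole programs -/

theorem RunsTo.steps {n B : ℕ} {l : List Instr} {W W' : ℕ → ℕ} {R R' : ℕ → ℝ} {P : Program}
    {p : ℕ} (h : RunsTo n B l W R W' R') (hl : ∀ i ∈ l, i.IsLinear) (hP : CodeAt P p l) :
    Steps P (66 * n + 1200) B l.length ⟨p, W, R⟩ ⟨p + l.length, W', R'⟩ :=
  (steps_of_execList hl hP (h p)).1

theorem steps_jump {P : Program} {S B p l : ℕ} {W : ℕ → ℕ} {R : ℕ → ℝ}
    (h : P[p]? = some (.jump l)) : Steps P S B 1 ⟨p, W, R⟩ ⟨l, W, R⟩ := by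
  refine .head _ _ _ _ ?_ (.refl _)
  simp [step, h, exec, Config.branch]

open Classical in
theorem BExp.code_spec {n B : ℕ} (hB : 66 * n + 1200 ≤ B) {s : Store} (b : BExp) {W : ℕ → ℕ}
    {R : ℕ → ℝ} {P : Program} {p l : ℕ} (sim : Sim n B s W R) (wf : b.wf = true)
    (ok : b.ok n B s) (hP : CodeAt P p (b.code ++ [b.jump l])) :
    ∃ W' R', Steps P (66 * n + 1200) B (b.code.length + 1) ⟨p, W, R⟩
      ⟨if b.eval s then l else p + b.code.length + 1, W', R'⟩ ∧ Sim n B s W' R' := by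
  rw [codeAt_append, codeAt_cons] at hP
  obtain ⟨hP₁, hP₂, -⟩ := hP
  have key : ∃ W' R', RunsTo n B b.code W R W' R' ∧ Sim n B s W' R' ∧
      exec (66 * n + 1200) B ⟨p + b.code.length, W', R'⟩ (b.jump l) =
        some ⟨if b.eval s then l else p + b.code.length + 1, W', R'⟩ := by
    cases b with
    | wlt e₁ e₂ | weq e₁ e₂ =>
      simp only [BExp.wf, Bool.and_eq_true] at wf
      obtain ⟨W₁, h₁, v₁, f₁, s₁⟩ := e₁.code_spec hB 0 sim wf.1 ok.1
      have sim₁ := sim.congr s₁ (fun a ha => f₁ a (by omega)) (fun _ _ => rfl)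
      obtain ⟨W₂, h₂, v₂, f₂, s₂⟩ := e₂.code_spec hB 1 sim₁ wf.2 ok.2
      refine ⟨_, _, h₁.append h₂,
        sim₁.congr s₂ (fun a ha => f₂ a (by omega)) (fun _ _ => rfl), ?_⟩
      have e₁' : W₂ 32 = e₁.eval s := by rw [f₂ _ (by omega), ← v₁]
      have e₂' : W₂ 33 = e₂.eval s := v₂
      simp only [BExp.jump, exec, Config.getW, Config.branch, BExp.eval, e₁', e₂', Option.bind_some,
        if_pos (show 32 < 66 * n + 1200 by omega), if_pos (show 33 < 66 * n + 1200 by omega)]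
      congr
    | rlt e₁ e₂ =>
      simp only [BExp.wf, Bool.and_eq_true] at wf
      obtain ⟨W₁, R₁, h₁, v₁, f₁, s₁, g₁⟩ := e₁.code_spec hB 0 sim wf.1 ok.1
      have sim₁ := sim.congr s₁ f₁ (fun a ha => g₁ a (by omega))
      obtain ⟨W₂, R₂, h₂, v₂, f₂, s₂, g₂⟩ := e₂.code_spec hB 1 sim₁ wf.2 ok.2
      refine ⟨_, _, h₁.append h₂, sim₁.congr s₂ f₂ (fun a ha => g₂ a (by omega)), ?_⟩
      have e₁' : R₂ 32 = e₁.eval s := by rw [g₂ _ (by omega), ← v₁]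
      have e₂' : R₂ 33 = e₂.eval s := v₂
      simp only [BExp.jump, exec, Config.getR, Config.branch, BExp.eval, e₁', e₂', Option.bind_some,
        if_pos (show 32 < 66 * n + 1200 by omega), if_pos (show 33 < 66 * n + 1200 by omega)]
      congr
  obtain ⟨W', R', h₁, h₂, h₃⟩ := key
  refine ⟨W', R', (h₁.steps b.isLinear_of_mem_code hP₁).trans (.head _ _ _ _ ?_ (.refl _)), h₂⟩
  simp [step, hP₂, h₃]

theorem Sim.setW {n B : ℕ} {s : Store} {W : ℕ → ℕ} {R : ℕ → ℝ} (h : Sim n B s W R) {d v : ℕ}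
    (hd : d < 31) (hv : v < B) : Sim n B (s.setW d v) (Function.update W (1 + d) v) R where
  size := by rw [Function.update_of_ne (by omega), h.size]
  small := update_lt h.small hv
  w i hi := by
    by_cases hid : i = d
    · subst hid; simp [Store.setW]
    · rw [Function.update_of_ne (by omega), h.w i hi]; simp [Store.setW, hid]
  A k hk i hi := by rw [Function.update_of_ne (by omega), h.A k hk i hi]; rfl
  r := h.r
  F := h.F

theorem Sim.setR {n B : ℕ} {s : Store} {W : ℕ → ℕ} {R : ℕ → ℝ} (h : Sim n B s W R) {d : ℕ} {v : ℝ}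
    (hd : d < 32) : Sim n B (s.setR d v) W (Function.update R d v) where
  size := h.size
  small := h.small
  w := h.w
  A := h.A
  r i hi := by
    by_cases hid : i = d
    · subst hid; simp [Store.setR]
    · rw [Function.update_of_ne hid, h.r i hi]; simp [Store.setR, hid]
  F k hk i hi := by
    have := realAddr_lt hk hi
    rw [Function.update_of_ne (by omega), h.F k hk i hi]; rfl

theorem Sim.setA {n B : ℕ} {s : Store} {W : ℕ → ℕ} {R : ℕ → ℝ} (h : Sim n B s W R) {k i v : ℕ}
    (hk : k < 8) (hv : v < B) :
    Sim n B (s.setA k i v) (Function.update W (64 + 8 * i + k) v) R where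
  size := by rw [Function.update_of_ne (by omega), h.size]
  small := update_lt h.small hv
  w j hj := by rw [Function.update_of_ne (by omega), h.w j hj]; rfl
  A k' hk' j hj := by
    by_cases hkk : k' = k
    · subst hkk
      by_cases hij : j = i
      · subst hij; simp [Store.setA]
      · rw [Function.update_of_ne (by omega), h.A _ hk' j hj]; simp [Store.setA, hij]
    · rw [Function.update_of_ne (by omega), h.A _ hk' j hj]; simp [Store.setA, hkk]
  r := h.r
  F := h.F

theorem Sim.setF {n B : ℕ} {s : Store} {W : ℕ → ℕ} {R : ℕ → ℝ} (h : Sim n B s W R) {k i : ℕ}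
    {v : ℝ} (hk : k ≤ 16) (hi : FIdx n k i) :
    Sim n B (s.setF k i v) W (Function.update R (realAddr n k i) v) where
  size := h.size
  small := h.small
  w := h.w
  A := h.A
  r j hj := by
    have := realAddr_lt hk hi
    rw [Function.update_of_ne (by omega), h.r j hj]; rfl
  F k' hk' j hj := by
    by_cases hkk : k' = k ∧ j = i
    · obtain ⟨rfl, rfl⟩ := hkk; simp [Store.setF]
    · rw [Function.update_of_ne (fun he => hkk (realAddr_inj hk' hk hj hi he)), h.F _ hk' j hj]
      by_cases hk2 : k' = k
      · subst hk2
        have : j ≠ i := fun h => hkk ⟨rfl, h⟩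
        simp [Store.setF, this]
      · simp [Store.setF, hk2]

/-- The compiled program simulates the structured program. -/
theorem Exec.steps {n B : ℕ} (hB : 66 * n + 1200 ≤ B) {c : Cmd} {s s' : Store} {t : ℕ}
    (h : Exec n B c s t s') {P : Program} {p K : ℕ} {W : ℕ → ℕ} {R : ℕ → ℝ} (wf : c.wf = true)
    (hK : c.width ≤ K) (hP : CodeAt P p (c.code p)) (sim : Sim n B s W R) :
    ∃ t' W' R', t' ≤ K * t ∧ Steps P (66 * n + 1200) B t' ⟨p, W, R⟩ ⟨p + c.len, W', R'⟩ ∧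
      Sim n B s' W' R' := by
  induction h generalizing p W R with
  | wset d e s ok =>
    simp only [Cmd.wf, Bool.and_eq_true, decide_eq_true_eq] at wf
    obtain ⟨W₁, h₁, v₁, f₁, s₁⟩ := e.code_spec hB 0 sim wf.1 ok
    have sim₁ := sim.congr s₁ (fun a ha => f₁ a (by omega)) (fun _ _ => rfl)
    rw [← Cmd.length_code _ p]
    refine ⟨_, _, _, ?_, (h₁.append (runsTo_wcopy (d := 1 + d) (s := 32) (by omega) (by omega)
      (s₁ _))).steps ?_ hP, ?_⟩
    · simpa [Cmd.width, Cmd.len] using hK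
    · simp only [List.mem_append]
      rintro i (h | h)
      · exact e.isLinear_of_mem_code _ _ h
      · revert i; simp [Instr.IsLinear]
    · rw [← v₁]; exact sim₁.setW wf.2 (s₁ _)
  | aset k i e s ok ok' hk =>
    simp only [Cmd.wf, Bool.and_eq_true, decide_eq_true_eq] at wf
    obtain ⟨W₁, h₁, v₁, f₁, s₁⟩ := i.code_spec hB 0 sim wf.1.1 ok
    obtain ⟨W₂, h₂, v₂, f₂, s₂⟩ := wordPtrCode_spec hB (R := R) (t := 0) wf.2 (by omega) hk s₁ v₁
    have sim₂ := sim.congr s₂ (R' := R) (fun a ha => by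
      rw [f₂ _ (by omega) (by omega), f₁ a (by omega)]) (fun _ _ => rfl)
    obtain ⟨W₃, h₃, v₃, f₃, s₃⟩ := e.code_spec hB 1 sim₂ wf.1.2 ok'
    have sim₃ := sim₂.congr s₃ (R' := R) (fun a ha => f₃ a (by omega)) (fun _ _ => rfl)
    have hp : W₃ 32 = 64 + 8 * i.eval s + k := by rw [f₃ _ (by omega)]; exact v₂
    rw [← Cmd.length_code _ p]
    refine ⟨_, _, _, ?_, (h₁.append (h₂.append (h₃.append (runsTo_wstore (s := 33) (q := 32)
      (by omega) (by omega) (by rw [hp]; omega) (s₃ _))))).steps ?_ hP, ?_⟩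
    · simpa [Cmd.width, Cmd.len] using hK
    · simp only [List.mem_append]
      rintro i (h | h | h | h)
      · exact WExp.isLinear_of_mem_code _ _ _ h
      · revert i; simp [wordPtrCode, Instr.IsLinear]
      · exact WExp.isLinear_of_mem_code _ _ _ h
      · revert i; simp [Instr.IsLinear]
    · rw [hp, ← show W₃ 33 = e.eval s from v₃]; exact sim₃.setA wf.2 (s₃ _)
  | rset d e s ok =>
    simp only [Cmd.wf, Bool.and_eq_true, decide_eq_true_eq] at wf
    obtain ⟨W₁, R₁, h₁, v₁, f₁, s₁, g₁⟩ := e.code_spec hB 0 sim wf.1 ok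
    have sim₁ := sim.congr s₁ f₁ (fun a ha => g₁ a (by omega))
    rw [← Cmd.length_code _ p]
    refine ⟨_, _, _, ?_, (h₁.append (runsTo_rcopy (d := d) (s := 32) (by omega)
      (by omega))).steps ?_ hP, ?_⟩
    · simpa [Cmd.width, Cmd.len] using hK
    · simp only [List.mem_append]
      rintro i (h | h)
      · exact e.isLinear_of_mem_code _ _ h
      · revert i; simp [Instr.IsLinear]
    · rw [← v₁]; exact sim₁.setR wf.2
  -- The value is computed before the index: it waits in a real temporary, which the index
  -- computation does not touch.
  | fset k i e s ok ok' hk =>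
    simp only [Cmd.wf, Bool.and_eq_true, decide_eq_true_eq] at wf
    obtain ⟨W₁, R₁, h₁, v₁, f₁, s₁, g₁⟩ := e.code_spec hB 0 sim wf.1.2 ok'
    have sim₁ := sim.congr s₁ f₁ (fun a ha => g₁ a (by omega))
    obtain ⟨W₂, h₂, v₂, f₂, s₂⟩ := i.code_spec hB 0 sim₁ wf.1.1 ok
    have sim₂ := sim₁.congr s₂ (R' := R₁) (fun a ha => f₂ a (by omega)) (fun _ _ => rfl)
    obtain ⟨W₃, h₃, v₃, f₃, s₃⟩ := ptrCode_spec hB (R := R₁) wf.2 sim₂.size hk s₂ v₂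
    have sim₃ := sim₂.congr s₃ (R' := R₁) (fun a ha => f₃ a (by omega) (by omega))
      (fun _ _ => rfl)
    rw [← Cmd.length_code _ p]
    refine ⟨_, _, _, ?_, (h₁.append (h₂.append (h₃.append (runsTo_rstore (s := 32) (q := 32)
      (by omega) (by omega) (by rw [v₃]; exact (realAddr_lt wf.2 hk).2))))).steps ?_ hP, ?_⟩
    · simpa [Cmd.width, Cmd.len] using hK
    · simp only [List.mem_append]
      rintro i (h | h | h | h)
      · exact RExp.isLinear_of_mem_code _ _ _ h
      · exact WExp.isLinear_of_mem_code _ _ _ h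
      · exact isLinear_of_mem_ptrCode _ _ h
      · revert i; simp [Instr.IsLinear]
    · rw [v₃, ← show R₁ 32 = e.eval s from v₁]; exact sim₃.setF wf.2 hk
  | seq c₁ c₂ s t₁ s₁ t₂ s₂ _ _ ih₁ ih₂ =>
    simp only [Cmd.wf, Bool.and_eq_true] at wf
    simp only [Cmd.width, max_le_iff] at hK
    rw [Cmd.code, codeAt_append, Cmd.length_code] at hP
    obtain ⟨t₁', W₁, R₁, l₁, st₁, sim₁⟩ := ih₁ wf.1 hK.1 hP.1 sim
    obtain ⟨t₂', W₂, R₂, l₂, st₂, sim₂⟩ := ih₂ wf.2 hK.2 hP.2 sim₁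
    refine ⟨_, W₂, R₂, ?_, st₁.trans (by simpa [Cmd.len, Nat.add_assoc] using st₂), sim₂⟩
    rw [Nat.mul_add]; omega
  | ite_true b c₁ c₂ s t s' ok hb _ ih =>
    simp only [Cmd.wf, Bool.and_eq_true] at wf
    simp only [Cmd.width, max_le_iff] at hK
    rw [Cmd.code, ← List.append_assoc] at hP
    obtain ⟨hP₁, hP₂⟩ := codeAt_append.1 hP
    obtain ⟨hP₂, hP₃⟩ := codeAt_append.1 hP₂
    obtain ⟨hP₃, hP₄⟩ := codeAt_append.1 hP₃
    simp only [List.length_append, List.length_singleton, Cmd.length_code, ← Nat.add_assoc]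
      at hP₂ hP₃ hP₄
    obtain ⟨W₁, R₁, st₁, sim₁⟩ := b.code_spec hB sim wf.1.1 ok hP₁
    rw [if_pos hb] at st₁
    obtain ⟨t₂', W₂, R₂, l₂, st₂, sim₂⟩ := ih wf.1.2 hK.2.1 hP₄ sim₁
    refine ⟨_, W₂, R₂, ?_, st₁.trans (by convert st₂ using 2; simp [Cmd.len]; omega), sim₂⟩
    rw [Nat.mul_add]; omega
  | ite_false b c₁ c₂ s t s' ok hb _ ih =>
    simp only [Cmd.wf, Bool.and_eq_true] at wf
    simp only [Cmd.width, max_le_iff] at hK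
    rw [Cmd.code, ← List.append_assoc] at hP
    obtain ⟨hP₁, hP₂⟩ := codeAt_append.1 hP
    obtain ⟨hP₂, hP₃⟩ := codeAt_append.1 hP₂
    obtain ⟨hP₃, hP₄⟩ := codeAt_append.1 hP₃
    simp only [List.length_append, List.length_singleton, Cmd.length_code, ← Nat.add_assoc]
      at hP₂ hP₃ hP₄
    obtain ⟨W₁, R₁, st₁, sim₁⟩ := b.code_spec hB sim wf.1.1 ok hP₁
    rw [if_neg hb] at st₁
    obtain ⟨t₂', W₂, R₂, l₂, st₂, sim₂⟩ := ih wf.2 hK.2.2 hP₂ sim₁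
    have hj := (codeAt_cons.1 hP₃).1
    -- The jump over the other branch is the second of the two extra instructions that `Cmd.width`
    -- allows for a condition.
    refine ⟨_, W₂, R₂, ?_, (st₁.trans st₂).trans (t' := 1) ?_, sim₂⟩
    · rw [Nat.mul_add]; omega
    · convert steps_jump (W := W₂) (R := R₂) (S := 66 * n + 1200) (B := B)
        hj using 2
      simp [Cmd.len]; omega
  | while_true b c s t₁ s₁ t₂ s₂ ok hb _ _ ih₁ ih₂ =>
    have wf' := wf
    have hK' := hK
    have hP' := hP
    simp only [Cmd.wf, Bool.and_eq_true] at wf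
    simp only [Cmd.width, max_le_iff] at hK
    rw [Cmd.code, show ∀ a b : Instr, [a, b] = [a] ++ [b] from fun _ _ => rfl, List.append_assoc,
      ← List.append_assoc b.code] at hP
    obtain ⟨hP₁, hP₂⟩ := codeAt_append.1 hP
    obtain ⟨hP₂, hP₃⟩ := codeAt_append.1 hP₂
    obtain ⟨hP₃, hP₄⟩ := codeAt_append.1 hP₃
    simp only [List.length_append, List.length_singleton, Cmd.length_code, ← Nat.add_assoc]
      at hP₂ hP₃ hP₄
    obtain ⟨W₁, R₁, st₁, sim₁⟩ := b.code_spec hB sim wf.1 ok hP₁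
    rw [if_pos hb] at st₁
    obtain ⟨t₂', W₂, R₂, l₂, st₂, sim₂⟩ := ih₁ wf.2 hK.2 hP₃ sim₁
    have hj := (codeAt_cons.1 hP₄).1
    have st₃ := steps_jump (W := W₂) (R := R₂) (S := 66 * n + 1200) (B := B) hj
    obtain ⟨t₄', W₄, R₄, l₄, st₄, sim₄⟩ := ih₂ wf' hK' hP' sim₂
    refine ⟨_, W₄, R₄, ?_, ((st₁.trans st₂).trans (t' := 1) ?_).trans st₄, sim₄⟩
    · rw [Nat.mul_add, Nat.mul_add]; omega
    · exact st₃
  | while_false b c s ok hb =>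
    simp only [Cmd.wf, Bool.and_eq_true] at wf
    simp only [Cmd.width, max_le_iff] at hK
    rw [Cmd.code, show ∀ a b : Instr, [a, b] = [a] ++ [b] from fun _ _ => rfl, List.append_assoc,
      ← List.append_assoc b.code] at hP
    obtain ⟨hP₁, hP₂⟩ := codeAt_append.1 hP
    obtain ⟨hP₂, hP₃⟩ := codeAt_append.1 hP₂
    obtain ⟨hP₃, hP₄⟩ := codeAt_append.1 hP₃
    simp only [List.length_append, List.length_singleton, Cmd.length_code, ← Nat.add_assoc]
      at hP₂ hP₃ hP₄
    obtain ⟨W₁, R₁, st₁, sim₁⟩ := b.code_spec hB sim wf.1 ok hP₁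
    rw [if_neg hb] at st₁
    have hj := (codeAt_cons.1 hP₂).1
    refine ⟨_, W₁, R₁, ?_, st₁.trans (t' := 1) ?_, sim₁⟩
    · omega
    · convert steps_jump (W := W₁) (R := R₁) (S := 66 * n + 1200) (B := B) hj using 2
      simp [Cmd.len]; omega

end RealRAM

namespace RealRAM

/-! ### Program logic -/

instance : Add WExp := ⟨.op .add⟩
instance : Sub WExp := ⟨.op .sub⟩
instance : Div WExp := ⟨.op .div⟩
instance : Add RExp := ⟨.op .add⟩
instance : Sub RExp := ⟨.op .sub⟩
instance : Mul RExp := ⟨.op .mul⟩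

/-- Word register. -/
abbrev wr (i : ℕ) : WExp := .reg i
/-- Word constant. -/
abbrev wc (c : ℕ) : WExp := .const c
/-- Element of a word array. -/
abbrev wa (k : ℕ) (e : WExp) : WExp := .arr k e
/-- Real register. -/
abbrev rr (i : ℕ) : RExp := .reg i
/-- Real constant. -/
abbrev rc (q : ℚ) : RExp := .const q
/-- Element of a real array. -/
abbrev ra (k : ℕ) (e : WExp) : RExp := .arr k e

infixr:60 " ;; " => Cmd.seq

attribute [simp] WExp.eval WExp.ok RExp.eval RExp.ok BExp.eval BExp.ok Op.wval Op.wok Op.rval Op.rok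
  FIdx

@[simp] theorem WExp.eval_add (s : Store) (a b : WExp) :
    (a + b).eval s = a.eval s + b.eval s := rfl
@[simp] theorem WExp.eval_sub (s : Store) (a b : WExp) :
    (a - b).eval s = a.eval s - b.eval s := rfl
@[simp] theorem WExp.eval_div (s : Store) (a b : WExp) :
    (a / b).eval s = a.eval s / b.eval s := rfl
@[simp] theorem RExp.eval_add (s : Store) (a b : RExp) :
    (a + b).eval s = a.eval s + b.eval s := rfl
@[simp] theorem RExp.eval_sub (s : Store) (a b : RExp) :
    (a - b).eval s = a.eval s - b.eval s := rfl
@[simp] theorem RExp.eval_mul (s : Store) (a b : RExp) :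
    (a * b).eval s = a.eval s * b.eval s := rfl

@[simp] theorem WExp.ok_add (n B : ℕ) (s : Store) (a b : WExp) : (a + b).ok n B s ↔
    a.ok n B s ∧ b.ok n B s ∧ Op.add.wok B (a.eval s) (b.eval s) := Iff.rfl
@[simp] theorem WExp.ok_sub (n B : ℕ) (s : Store) (a b : WExp) : (a - b).ok n B s ↔
    a.ok n B s ∧ b.ok n B s ∧ Op.sub.wok B (a.eval s) (b.eval s) := Iff.rfl
@[simp] theorem WExp.ok_div (n B : ℕ) (s : Store) (a b : WExp) : (a / b).ok n B s ↔
    a.ok n B s ∧ b.ok n B s ∧ Op.div.wok B (a.eval s) (b.eval s) := Iff.rfl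
@[simp] theorem RExp.ok_add (n B : ℕ) (s : Store) (a b : RExp) : (a + b).ok n B s ↔
    a.ok n B s ∧ b.ok n B s ∧ Op.add.rok (b.eval s) := Iff.rfl
@[simp] theorem RExp.ok_sub (n B : ℕ) (s : Store) (a b : RExp) : (a - b).ok n B s ↔
    a.ok n B s ∧ b.ok n B s ∧ Op.sub.rok (b.eval s) := Iff.rfl
@[simp] theorem RExp.ok_mul (n B : ℕ) (s : Store) (a b : RExp) : (a * b).ok n B s ↔
    a.ok n B s ∧ b.ok n B s ∧ Op.mul.rok (b.eval s) := Iff.rfl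

namespace Store

variable (s : Store) (d k i v : ℕ) (x : ℝ)

@[simp] theorem setW_w (j : ℕ) : (s.setW d v).w j = if j = d then v else s.w j :=
  Function.update_apply _ _ _ _
@[simp] theorem setW_r : (s.setW d v).r = s.r := rfl
@[simp] theorem setW_A : (s.setW d v).A = s.A := rfl
@[simp] theorem setW_F : (s.setW d v).F = s.F := rfl
@[simp] theorem setR_w : (s.setR d x).w = s.w := rfl
@[simp] theorem setR_r (j : ℕ) : (s.setR d x).r j = if j = d then x else s.r j :=
  Function.update_apply _ _ _ _
@[simp] theorem setR_A : (s.setR d x).A = s.A := rfl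
@[simp] theorem setR_F : (s.setR d x).F = s.F := rfl
@[simp] theorem setA_w : (s.setA k i v).w = s.w := rfl
@[simp] theorem setA_r : (s.setA k i v).r = s.r := rfl
@[simp] theorem setA_A (j : ℕ) :
    (s.setA k i v).A j = if j = k then Function.update (s.A k) i v else s.A j :=
  Function.update_apply _ _ _ _
@[simp] theorem setA_F : (s.setA k i v).F = s.F := rfl
@[simp] theorem setF_w : (s.setF k i x).w = s.w := rfl
@[simp] theorem setF_r : (s.setF k i x).r = s.r := rfl
@[simp] theorem setF_A : (s.setF k i x).A = s.A := rfl
@[simp] theorem setF_F (j : ℕ) :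
    (s.setF k i x).F j = if j = k then Function.update (s.F k) i x else s.F j :=
  Function.update_apply _ _ _ _

end Store

/-- `c`, started in `s`, terminates after `t` ticks in a state `s'` such that `Q t s'`. -/
def WP (n B : ℕ) (c : Cmd) (s : Store) (Q : ℕ → Store → Prop) : Prop :=
  ∃ t s', Exec n B c s t s' ∧ Q t s'

section rules

variable {n B : ℕ} {s : Store} {Q : ℕ → Store → Prop}

theorem WP.mono {c : Cmd} {Q' : ℕ → Store → Prop} (h : WP n B c s Q)
    (h' : ∀ t s', Q t s' → Q' t s') : WP n B c s Q' :=
  let ⟨t, s', h₁, h₂⟩ := h; ⟨t, s', h₁, h' _ _ h₂⟩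

@[simp] theorem wp_wset {d : ℕ} {e : WExp} :
    WP n B (.wset d e) s Q ↔ e.ok n B s ∧ Q 1 (s.setW d (e.eval s)) :=
  ⟨fun ⟨_, _, h, hQ⟩ => by cases h; exact ⟨‹_›, hQ⟩, fun h => ⟨_, _, .wset _ _ _ h.1, h.2⟩⟩

@[simp] theorem wp_rset {d : ℕ} {e : RExp} :
    WP n B (.rset d e) s Q ↔ e.ok n B s ∧ Q 1 (s.setR d (e.eval s)) :=
  ⟨fun ⟨_, _, h, hQ⟩ => by cases h; exact ⟨‹_›, hQ⟩, fun h => ⟨_, _, .rset _ _ _ h.1, h.2⟩⟩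

@[simp] theorem wp_aset {k : ℕ} {i e : WExp} :
    WP n B (.aset k i e) s Q ↔ (i.ok n B s ∧ e.ok n B s ∧ i.eval s < 4 * n + 64) ∧
      Q 1 (s.setA k (i.eval s) (e.eval s)) :=
  ⟨fun ⟨_, _, h, hQ⟩ => by cases h; exact ⟨⟨‹_›, ‹_›, ‹_›⟩, hQ⟩,
    fun h => ⟨_, _, .aset _ _ _ _ h.1.1 h.1.2.1 h.1.2.2, h.2⟩⟩

@[simp] theorem wp_fset {k : ℕ} {i : WExp} {e : RExp} :
    WP n B (.fset k i e) s Q ↔ (i.ok n B s ∧ e.ok n B s ∧ FIdx n k (i.eval s)) ∧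
      Q 1 (s.setF k (i.eval s) (e.eval s)) :=
  ⟨fun ⟨_, _, h, hQ⟩ => by cases h; exact ⟨⟨‹_›, ‹_›, ‹_›⟩, hQ⟩,
    fun h => ⟨_, _, .fset _ _ _ _ h.1.1 h.1.2.1 h.1.2.2, h.2⟩⟩

@[simp] theorem wp_seq {c₁ c₂ : Cmd} :
    WP n B (c₁ ;; c₂) s Q ↔ WP n B c₁ s fun t s' => WP n B c₂ s' fun t' => Q (t + t') :=
  ⟨fun ⟨_, _, h, hQ⟩ => by cases h; exact ⟨_, _, ‹_›, _, _, ‹_›, hQ⟩,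
    fun ⟨_, _, h, _, _, h', hQ⟩ => ⟨_, _, .seq _ _ _ _ _ _ _ h h', hQ⟩⟩

@[simp] theorem wp_ite {b : BExp} {c₁ c₂ : Cmd} :
    WP n B (.ite b c₁ c₂) s Q ↔ b.ok n B s ∧ (b.eval s → WP n B c₁ s fun t => Q (t + 1)) ∧
      (¬ b.eval s → WP n B c₂ s fun t => Q (t + 1)) := by
  constructor
  · rintro ⟨_, _, h, hQ⟩
    cases h with
    | ite_true _ _ _ _ _ _ hb h h' => exact ⟨hb, fun _ => ⟨_, _, h', hQ⟩, fun h'' => absurd h h''⟩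
    | ite_false _ _ _ _ _ _ hb h h' => exact ⟨hb, fun h'' => absurd h'' h, fun _ => ⟨_, _, h', hQ⟩⟩
  · rintro ⟨hb, h₁, h₂⟩
    by_cases h : b.eval s
    · obtain ⟨_, _, h', hQ⟩ := h₁ h
      exact ⟨_, _, .ite_true _ _ _ _ _ _ hb h h', hQ⟩
    · obtain ⟨_, _, h', hQ⟩ := h₂ h
      exact ⟨_, _, .ite_false _ _ _ _ _ _ hb h h', hQ⟩

end rules

/-! ### Write sets and frames -/

def Cmd.writesW : Cmd → ℕ → Bool
  | wset d _, i => decide (i = d)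
  | aset _ _ _, _ => false
  | rset _ _, _ => false
  | fset _ _ _, _ => false
  | seq c₁ c₂, i => c₁.writesW i || c₂.writesW i
  | ite _ c₁ c₂, i => c₁.writesW i || c₂.writesW i
  | .while _ c, i => c.writesW i

def Cmd.writesR : Cmd → ℕ → Bool
  | wset _ _, _ => false
  | aset _ _ _, _ => false
  | rset d _, i => decide (i = d)
  | fset _ _ _, _ => false
  | seq c₁ c₂, i => c₁.writesR i || c₂.writesR i
  | ite _ c₁ c₂, i => c₁.writesR i || c₂.writesR i
  | .while _ c, i => c.writesR i

def Cmd.writesA : Cmd → ℕ → Bool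
  | wset _ _, _ => false
  | aset k _ _, i => decide (i = k)
  | rset _ _, _ => false
  | fset _ _ _, _ => false
  | seq c₁ c₂, i => c₁.writesA i || c₂.writesA i
  | ite _ c₁ c₂, i => c₁.writesA i || c₂.writesA i
  | .while _ c, i => c.writesA i

def Cmd.writesF : Cmd → ℕ → Bool
  | wset _ _, _ => false
  | aset _ _ _, _ => false
  | rset _ _, _ => false
  | fset k _ _, i => decide (i = k)
  | seq c₁ c₂, i => c₁.writesF i || c₂.writesF i
  | ite _ c₁ c₂, i => c₁.writesF i || c₂.writesF i
  | .while _ c, i => c.writesF i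

/-- `s` and `s'` agree on everything that `c` does not write. -/
structure Frame (c : Cmd) (s s' : Store) : Prop where
  w : ∀ i, c.writesW i = false → s'.w i = s.w i
  r : ∀ i, c.writesR i = false → s'.r i = s.r i
  A : ∀ i, c.writesA i = false → s'.A i = s.A i
  F : ∀ i, c.writesF i = false → s'.F i = s.F i

theorem Frame.refl (c : Cmd) (s : Store) : Frame c s s :=
  ⟨fun _ _ => rfl, fun _ _ => rfl, fun _ _ => rfl, fun _ _ => rfl⟩

theorem Frame.trans {c : Cmd} {s s' s'' : Store} (h : Frame c s s') (h' : Frame c s' s'') :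
    Frame c s s'' :=
  ⟨fun i hi => (h'.w i hi).trans (h.w i hi), fun i hi => (h'.r i hi).trans (h.r i hi),
    fun i hi => (h'.A i hi).trans (h.A i hi), fun i hi => (h'.F i hi).trans (h.F i hi)⟩

/-- The write sets are computed syntactically, so for concrete programs most frame conditions hold
by `rfl`, and loop invariants need to mention only what the body changes. -/
theorem Exec.frame {n B : ℕ} {c : Cmd} {s s' : Store} {t : ℕ} (h : Exec n B c s t s') :
    Frame c s s' := by
  induction h with
  | wset d e s =>
    refine ⟨fun i hi => ?_, fun _ _ => rfl, fun _ _ => rfl, fun _ _ => rfl⟩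
    simp only [Cmd.writesW, decide_eq_false_iff_not] at hi
    simp [hi]
  | aset k i e s =>
    refine ⟨fun _ _ => rfl, fun _ _ => rfl, fun i hi => ?_, fun _ _ => rfl⟩
    simp only [Cmd.writesA, decide_eq_false_iff_not] at hi
    simp [hi]
  | rset d e s =>
    refine ⟨fun _ _ => rfl, fun i hi => ?_, fun _ _ => rfl, fun _ _ => rfl⟩
    simp only [Cmd.writesR, decide_eq_false_iff_not] at hi
    simp [hi]
  | fset k i e s =>
    refine ⟨fun _ _ => rfl, fun _ _ => rfl, fun _ _ => rfl, fun i hi => ?_⟩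
    simp only [Cmd.writesF, decide_eq_false_iff_not] at hi
    simp [hi]
  | seq c₁ c₂ s t₁ s₁ t₂ s₂ _ _ ih₁ ih₂ =>
    refine ⟨fun i hi => ?_, fun i hi => ?_, fun i hi => ?_, fun i hi => ?_⟩
    · simp only [Cmd.writesW, Bool.or_eq_false_iff] at hi
      rw [ih₂.w i hi.2, ih₁.w i hi.1]
    · simp only [Cmd.writesR, Bool.or_eq_false_iff] at hi
      rw [ih₂.r i hi.2, ih₁.r i hi.1]
    · simp only [Cmd.writesA, Bool.or_eq_false_iff] at hi
      rw [ih₂.A i hi.2, ih₁.A i hi.1]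
    · simp only [Cmd.writesF, Bool.or_eq_false_iff] at hi
      rw [ih₂.F i hi.2, ih₁.F i hi.1]
  | ite_true b c₁ c₂ s t s' _ _ _ ih =>
    refine ⟨fun i hi => ?_, fun i hi => ?_, fun i hi => ?_, fun i hi => ?_⟩
    · simp only [Cmd.writesW, Bool.or_eq_false_iff] at hi; exact ih.w i hi.1
    · simp only [Cmd.writesR, Bool.or_eq_false_iff] at hi; exact ih.r i hi.1
    · simp only [Cmd.writesA, Bool.or_eq_false_iff] at hi; exact ih.A i hi.1
    · simp only [Cmd.writesF, Bool.or_eq_false_iff] at hi; exact ih.F i hi.1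
  | ite_false b c₁ c₂ s t s' _ _ _ ih =>
    refine ⟨fun i hi => ?_, fun i hi => ?_, fun i hi => ?_, fun i hi => ?_⟩
    · simp only [Cmd.writesW, Bool.or_eq_false_iff] at hi; exact ih.w i hi.2
    · simp only [Cmd.writesR, Bool.or_eq_false_iff] at hi; exact ih.r i hi.2
    · simp only [Cmd.writesA, Bool.or_eq_false_iff] at hi; exact ih.A i hi.2
    · simp only [Cmd.writesF, Bool.or_eq_false_iff] at hi; exact ih.F i hi.2
  | while_true b c s t₁ s₁ t₂ s₂ _ _ _ _ ih₁ ih₂ =>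
    exact ⟨fun i hi => (ih₂.w i hi).trans (ih₁.w i hi), fun i hi => (ih₂.r i hi).trans (ih₁.r i hi),
      fun i hi => (ih₂.A i hi).trans (ih₁.A i hi), fun i hi => (ih₂.F i hi).trans (ih₁.F i hi)⟩
  | while_false b c s => exact .refl _ _

theorem WP.frame {n B : ℕ} {c : Cmd} {s : Store} {Q : ℕ → Store → Prop} (h : WP n B c s Q) :
    WP n B c s fun t s' => Q t s' ∧ Frame c s s' :=
  let ⟨t, s', h₁, h₂⟩ := h; ⟨t, s', h₁, h₂, h₁.frame⟩

/-- Loop rule: `Φ` bounds the number of ticks that remain. -/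
theorem WP.while {n B : ℕ} {b : BExp} {c : Cmd} {s₀ : Store} (Inv : Store → Prop) (Φ : Store → ℕ)
    (h₀ : Inv s₀)
    (hb : ∀ s, Inv s → Frame c s₀ s → b.ok n B s ∧
      (b.eval s → WP n B c s fun t s' => Inv s' ∧ t + 1 + Φ s' ≤ Φ s)) :
    WP n B (.while b c) s₀ fun t s' =>
      Inv s' ∧ ¬ b.eval s' ∧ Frame (.while b c) s₀ s' ∧ t ≤ Φ s₀ + 1 := by
  suffices ∀ k s, Φ s = k → Inv s → Frame c s₀ s → WP n B (.while b c) s fun t s' =>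
      Inv s' ∧ ¬ b.eval s' ∧ t ≤ Φ s + 1 by
    obtain ⟨t, s', h, h₁, h₂, h₃⟩ := this _ _ rfl h₀ (.refl _ _)
    exact ⟨t, s', h, h₁, h₂, h.frame, h₃⟩
  intro k
  induction k using Nat.strong_induction_on with
  | _ k ih =>
    rintro s rfl hI hF
    obtain ⟨hok, hw⟩ := hb s hI hF
    by_cases h : b.eval s
    · obtain ⟨t, s', he, hI', ht⟩ := hw h
      obtain ⟨t', s'', he', hI'', hn, ht'⟩ := ih (Φ s') (by omega) s' rfl hI' (hF.trans he.frame)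
      exact ⟨_, _, .while_true _ _ _ _ _ _ _ hok h he he', hI'', hn, by omega⟩
    · exact ⟨_, _, .while_false _ _ _ hok h, hI, h, by omega⟩

end RealRAM

namespace RealRAM

/-! ### Tournament trees -/

open Classical in
/-- The winner of two players: the one with the smaller key; the value `m` means "no player". -/
noncomputable def winner (m : ℕ) (κ : ℕ → ℝ) (x y : ℕ) : ℕ :=
  if x = m then y else if y = m then x else if κ y < κ x then y else x

/-- `T` is a tournament tree with the `m` leaves `m, …, 2 m - 1` and the players `al`; the
entries of the nodes in `X` may be wrong. -/
structure IsTree (m : ℕ) (κ : ℕ → ℝ) (al X : Set ℕ) (T : ℕ → ℕ) : Prop where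
  mem : ∀ i < m, i ∈ al → T (m + i) = i
  notMem : ∀ i < m, i ∉ al → T (m + i) = m
  le : ∀ v, 1 ≤ v → v < m → v ∉ X → T v ≤ m
  node : ∀ v, 1 ≤ v → v < m → v ∉ X → T v = winner m κ (T (v + v)) (T (v + v + 1))

/-- The entry of a node is the best player among the leaves below it. -/
theorem IsTree.node_spec {m : ℕ} {κ : ℕ → ℝ} {al : Set ℕ} {T : ℕ → ℕ} (h : IsTree m κ al ∅ T)
    (hm : 0 < m) (d v : ℕ) (h₁ : m ≤ v * 2 ^ d) (h₂ : (v + 1) * 2 ^ d ≤ 2 * m) :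
    (T v = m ∧ ∀ i ∈ al, v * 2 ^ d ≤ m + i → ¬ m + i < (v + 1) * 2 ^ d) ∨
    (T v ∈ al ∧ v * 2 ^ d ≤ m + T v ∧ m + T v < (v + 1) * 2 ^ d ∧
      ∀ i ∈ al, v * 2 ^ d ≤ m + i → m + i < (v + 1) * 2 ^ d → κ (T v) ≤ κ i) := by
  -- A node `v` at height `d` has the leaves from `v * 2 ^ d` up to, but excluding, `(v + 1) * 2 ^
  -- d`; its children are `v + v` and `v + v + 1`.
  induction d generalizing v with
  | zero =>
    obtain ⟨i, rfl⟩ := Nat.exists_eq_add_of_le (by simpa using h₁ : m ≤ v)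
    by_cases hi : i ∈ al
    · right
      have hT := h.mem i (by simp at h₂; omega) hi
      rw [hT]
      refine ⟨hi, by simp, by simp, fun j _ hj hj' => ?_⟩
      have : j = i := by simp at hj hj'; omega
      rw [this]
    · left
      refine ⟨h.notMem i (by simp at h₂; omega) hi, fun j hj hj₁ hj₂ => ?_⟩
      have : j = i := by simp at hj₁ hj₂; omega
      exact hi (this ▸ hj)
  | succ d ih =>
    have hd : 0 < 2 ^ d := by positivity
    have e₁ : v * 2 ^ (d + 1) = (v + v) * 2 ^ d := by ring
    have e₂ : (v + v + 1) * 2 ^ d = (v + v) * 2 ^ d + 2 ^ d := by ring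
    have e₃ : (v + 1) * 2 ^ (d + 1) = (v + v) * 2 ^ d + 2 ^ d + 2 ^ d := by ring
    have e₄ : (v + v + 1 + 1) * 2 ^ d = (v + v) * 2 ^ d + 2 ^ d + 2 ^ d := by ring
    rw [e₁] at h₁ ⊢
    rw [e₃] at h₂ ⊢
    have hv : 1 ≤ v := by
      rcases Nat.eq_zero_or_pos v with rfl | h'
      · simp at h₁; omega
      · exact h'
    have hvm : v < m := by
      have : (v + v) * 1 ≤ (v + v) * 2 ^ d := Nat.mul_le_mul_left _ hd
      omega
    have ihl := ih (v + v) h₁ (by omega)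
    have ihr := ih (v + v + 1) (by omega) (by omega)
    rw [e₂] at ihl ihr
    rw [e₄] at ihr
    rw [h.node v hv hvm (by simp)]
    generalize T (v + v) = x at ihl
    generalize T (v + v + 1) = y at ihr
    generalize (v + v) * 2 ^ d = p at *
    generalize 2 ^ d = q at *
    unfold winner
    rcases ihl with ⟨hx, hx'⟩ | ⟨hx₁, hx₂, hx₃, hx₄⟩
    · rw [if_pos hx]
      rcases ihr with ⟨hy, hy'⟩ | ⟨hy₁, hy₂, hy₃, hy₄⟩
      · left
        refine ⟨hy, fun i hi h₁ h₂ => ?_⟩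
        by_cases hip : m + i < p + q
        · exact hx' i hi h₁ hip
        · exact hy' i hi (by omega) h₂
      · right
        refine ⟨hy₁, by omega, by omega, fun i hi h₁ h₂ => ?_⟩
        by_cases hip : m + i < p + q
        · exact absurd hip (hx' i hi h₁)
        · exact hy₄ i hi (by omega) h₂
    · right
      rw [if_neg (by omega)]
      rcases ihr with ⟨hy, hy'⟩ | ⟨hy₁, hy₂, hy₃, hy₄⟩
      · rw [if_pos hy]
        refine ⟨hx₁, by omega, by omega, fun i hi h₁ h₂ => ?_⟩
        by_cases hip : m + i < p + q
        · exact hx₄ i hi h₁ hip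
        · exact absurd h₂ (hy' i hi (by omega))
      · rw [if_neg (by omega)]
        split_ifs with hxy
        · refine ⟨hy₁, by omega, by omega, fun i hi h₁ h₂ => ?_⟩
          by_cases hip : m + i < p + q
          · exact hxy.le.trans (hx₄ i hi h₁ hip)
          · exact hy₄ i hi (by omega) h₂
        · refine ⟨hx₁, by omega, by omega, fun i hi h₁ h₂ => ?_⟩
          by_cases hip : m + i < p + q
          · exact hx₄ i hi h₁ hip
          · exact (not_lt.1 hxy).trans (hy₄ i hi (by omega) h₂)

theorem IsTree.mono {m : ℕ} {κ : ℕ → ℝ} {al X X' : Set ℕ} {T : ℕ → ℕ} (h : IsTree m κ al X T)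
    (hX : ∀ u, 1 ≤ u → u ∈ X → u ∈ X') : IsTree m κ al X' T where
  mem := h.mem
  notMem := h.notMem
  le v hv hvm hX' := h.le v hv hvm fun hv' => hX' (hX v hv hv')
  node v hv hvm hX' := h.node v hv hvm fun hv' => hX' (hX v hv hv')

theorem IsTree.le_of_notMem {m : ℕ} {κ : ℕ → ℝ} {al X : Set ℕ} {T : ℕ → ℕ}
    (h : IsTree m κ al X T) {u : ℕ} (hu : 1 ≤ u) (hum : u < 2 * m) (hX : u ∉ X) : T u ≤ m := by
  by_cases hlt : u < m
  · exact h.le u hu hlt hX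
  · obtain ⟨i, rfl⟩ := Nat.exists_eq_add_of_le (not_lt.1 hlt)
    by_cases hi : i ∈ al
    · rw [h.mem i (by omega) hi]; omega
    · exact (h.notMem i (by omega) hi).le

/-- Since no wrong node has an index above `v`, the children of `v` are right, and recomputing `v`
repairs it. This may spoil the parent of `v`, which therefore has to be in `X'` together with the
other nodes of `X`. -/
theorem IsTree.update {m : ℕ} {κ : ℕ → ℝ} {al X X' : Set ℕ} {T : ℕ → ℕ} {v : ℕ}
    (h : IsTree m κ al X T) (hv : 1 ≤ v) (hvm : v < m) (hX : ∀ u ∈ X, u ≤ v)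
    (hX' : ∀ u, 1 ≤ u → u ∉ X' → u = v ∨ (u ∉ X ∧ u + u ≠ v ∧ u + u + 1 ≠ v)) :
    IsTree m κ al X' (Function.update T v (winner m κ (T (v + v)) (T (v + v + 1)))) where
  mem i hi hal := by rw [Function.update_of_ne (by omega), h.mem i hi hal]
  notMem i hi hal := by rw [Function.update_of_ne (by omega), h.notMem i hi hal]
  le u hu hum hux := by
    by_cases huv : u = v
    · subst huv
      rw [Function.update_self]
      have h₁ := h.le_of_notMem (u := u + u) (by omega) (by omega) fun h => by
        have := hX _ h; omega
      have h₂ := h.le_of_notMem (u := u + u + 1) (by omega) (by omega) fun h => by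
        have := hX _ h; omega
      unfold winner; split_ifs <;> assumption
    · rw [Function.update_of_ne huv]
      exact h.le u hu hum (((hX' u hu hux).resolve_left huv).1)
  node u hu hum hux := by
    by_cases huv : u = v
    · subst huv
      rw [Function.update_self, Function.update_of_ne (by omega), Function.update_of_ne (by omega)]
    · obtain ⟨h₁, h₂, h₃⟩ := (hX' u hu hux).resolve_left huv
      rw [Function.update_of_ne huv, Function.update_of_ne h₂, Function.update_of_ne h₃,
        h.node u hu hum h₁]

theorem IsTree.root_spec {h : ℕ} {κ : ℕ → ℝ} {al : Set ℕ} {T : ℕ → ℕ}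
    (hT : IsTree (2 ^ h) κ al ∅ T) (hal : ∀ i ∈ al, i < 2 ^ h) (hne : al.Nonempty) :
    T 1 ∈ al ∧ ∀ i ∈ al, κ (T 1) ≤ κ i := by
  rcases hT.node_spec (by positivity) h 1 (by simp) (by simp) with ⟨_, h₂⟩ | ⟨h₁, _, _, h₂⟩
  · obtain ⟨i, hi⟩ := hne
    exact absurd (by have := hal i hi; omega) (h₂ i hi (by omega))
  · exact ⟨h₁, fun i hi => h₂ i hi (by omega) (by have := hal i hi; omega)⟩

/-- Recompute the entry of node `w 3`. The leaves are counted by `w 1`, the keys are in the real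
array `k`, and the tree is the word array `0`. -/
def pull (k : ℕ) : Cmd :=
  .wset 4 (wa 0 (wr 3 + wr 3)) ;; .wset 5 (wa 0 (wr 3 + wr 3 + wc 1)) ;;
  .ite (.weq (wr 4) (wr 1)) (.aset 0 (wr 3) (wr 5))
    (.ite (.weq (wr 5) (wr 1)) (.aset 0 (wr 3) (wr 4))
      (.ite (.rlt (ra k (wr 5)) (ra k (wr 4))) (.aset 0 (wr 3) (wr 5)) (.aset 0 (wr 3) (wr 4))))

/-- Recompute the entries of all proper ancestors of node `w 3`. -/
def walkUp (k : ℕ) : Cmd :=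
  .while (.wlt (wc 1) (wr 3)) (.wset 3 (wr 3 / wc 2) ;; pull k)

/-- Build the tree for the players `0, …, w 6 - 1`. -/
def build (k : ℕ) : Cmd :=
  .wset 3 (wc 0) ;;
  .while (.wlt (wr 3) (wr 1))
    (.ite (.wlt (wr 3) (wr 6)) (.aset 0 (wr 1 + wr 3) (wr 3)) (.aset 0 (wr 1 + wr 3) (wr 1)) ;;
      .wset 3 (wr 3 + wc 1)) ;;
  .wset 3 (wr 1) ;;
  .while (.wlt (wc 1) (wr 3)) (.wset 3 (wr 3 - wc 1) ;; pull k)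

section

variable {n B : ℕ} (hB : 66 * n + 1200 ≤ B)
include hB

theorem pull_spec {k : ℕ} (hk : k ≠ 16) {s : Store} {al X X' : Set ℕ} (hm : s.w 1 ≤ 2 * n + 2)
    (hv : 1 ≤ s.w 3) (hvm : s.w 3 < s.w 1) (hT : IsTree (s.w 1) (s.F k) al X (s.A 0))
    (hX : ∀ u ∈ X, u ≤ s.w 3)
    (hX' : ∀ u, 1 ≤ u → u ∉ X' → u = s.w 3 ∨ (u ∉ X ∧ u + u ≠ s.w 3 ∧ u + u + 1 ≠ s.w 3)) :
    WP n B (pull k) s fun t s' => t ≤ 6 ∧ s'.w 3 = s.w 3 ∧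
      IsTree (s.w 1) (s.F k) al X' (s'.A 0) := by
  have h₁ := hT.le_of_notMem (u := s.w 3 + s.w 3) (by omega) (by omega) fun h => by
    have := hX _ h; omega
  have h₂ := hT.le_of_notMem (u := s.w 3 + s.w 3 + 1) (by omega) (by omega) fun h => by
    have := hX _ h; omega
  have hup := hT.update hv hvm hX hX'
  unfold winner at hup
  simp [pull, hk]
  refine ⟨by omega, by omega, fun h => ?_, fun h => ⟨fun h' => ?_, fun h' => ⟨⟨by omega, by omega⟩,
    fun h'' => ?_, fun h'' => ?_⟩⟩⟩
  · rw [if_pos h] at hup; exact ⟨by omega, hup⟩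
  · rw [if_neg h, if_pos h'] at hup; exact ⟨by omega, hup⟩
  · rw [if_neg h, if_neg h', if_pos h''] at hup; exact ⟨by omega, hup⟩
  · rw [if_neg h, if_neg h', if_neg (not_lt.2 h'')] at hup; exact ⟨by omega, hup⟩

/-- The proper ancestors of `v` are the quotients `v / 2 ^ (d + 1)`; for large `d` these are `0`,
which is not a node. Each round repairs the lowest wrong ancestor and lowers the binary logarithm of
the node by one. -/
theorem walkUp_spec {k : ℕ} (hk : k ≠ 16) {s : Store} {al : Set ℕ} (hm : s.w 1 ≤ 2 * n + 2)
    (hv : 1 ≤ s.w 3) (hvm : s.w 3 < 2 * s.w 1)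
    (hT : IsTree (s.w 1) (s.F k) al {u | ∃ d, u = s.w 3 / 2 ^ (d + 1)} (s.A 0)) :
    WP n B (walkUp k) s fun t s' => t ≤ 8 * Nat.log 2 (s.w 3) + 1 ∧
      IsTree (s.w 1) (s.F k) al ∅ (s'.A 0) := by
  refine (WP.while (fun s' => 1 ≤ s'.w 3 ∧ s'.w 3 < 2 * s.w 1 ∧
    IsTree (s.w 1) (s.F k) al {u | ∃ d, u = s'.w 3 / 2 ^ (d + 1)} (s'.A 0))
    (fun s' => 8 * Nat.log 2 (s'.w 3)) ⟨hv, hvm, hT⟩ ?_).mono ?_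
  · rintro s' ⟨h₁, h₂, h₃⟩ hF
    have hw1 : s'.w 1 = s.w 1 := hF.w 1 rfl
    have hFk : s'.F k = s.F k := hF.F k rfl
    refine ⟨by simp, fun hb => ?_⟩
    simp at hb
    rw [wp_seq, wp_wset]
    refine ⟨by simp, ?_⟩
    refine (pull_spec hB hk (al := al) (X := {u | ∃ d, u = s'.w 3 / 2 ^ (d + 1)})
      (X' := {u | ∃ d, u = s'.w 3 / 2 / 2 ^ (d + 1)}) ?_ ?_ ?_ ?_ ?_ ?_).mono ?_
    · simp [hw1, hm]
    · simp; omega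
    · simp [hw1]; omega
    · simpa [hw1, hFk] using h₃
    · rintro u ⟨d, rfl⟩
      simp only [Store.setW_w, if_true, WExp.eval_div, WExp.eval]
      rw [pow_succ', ← Nat.div_div_eq_div_mul]
      exact Nat.div_le_self _ _
    · intro u hu hu'
      simp only [Store.setW_w, if_true, WExp.eval_div, WExp.eval]
      by_cases huv : u = s'.w 3 / 2
      · exact Or.inl huv
      · refine Or.inr ⟨?_, fun h => hu' ⟨0, ?_⟩, fun h => hu' ⟨0, ?_⟩⟩
        · rintro ⟨d, hd⟩
          cases d with
          | zero => exact huv (by simpa using hd)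
          | succ d =>
            refine hu' ⟨d, ?_⟩
            rw [hd, Nat.div_div_eq_div_mul, ← pow_succ']
        · simp; omega
        · simp; omega
    · rintro t s'' ⟨ht, h4, h5⟩
      simp only [Store.setW_w, if_true, WExp.eval_div, WExp.eval] at h4 h5
      simp [hw1, hFk] at h5
      rw [h4]
      refine ⟨⟨by omega, by omega, h5⟩, ?_⟩
      have : Nat.log 2 (s'.w 3) = Nat.log 2 (s'.w 3 / 2) + 1 :=
        Nat.log_of_one_lt_of_le one_lt_two hb
      omega
  · rintro t s' ⟨⟨h₁, h₂, h₃⟩, hb, _, ht⟩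
    refine ⟨ht, h₃.mono ?_⟩
    rintro u hu ⟨d, rfl⟩
    simp at hb
    have : s'.w 3 = 1 := by omega
    rw [this, pow_succ'] at hu
    have : 0 < 2 ^ d := by positivity
    rw [Nat.div_eq_of_lt (by omega)] at hu
    omega

theorem build_spec {k : ℕ} (hk : k ≠ 16) {s : Store} (hm : s.w 1 ≤ 2 * n + 2) (hm' : 1 ≤ s.w 1) :
    WP n B (build k) s fun t s' => t ≤ 13 * s.w 1 + 10 ∧
      IsTree (s.w 1) (s.F k) {i | i < s.w 6} ∅ (s'.A 0) := by
  rw [build, wp_seq, wp_wset]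
  refine ⟨by simp, ?_⟩
  rw [wp_seq]
  refine (WP.while (fun s' => s'.w 3 ≤ s.w 1 ∧ (∀ i < s'.w 3, i < s.w 6 → s'.A 0 (s.w 1 + i) = i) ∧
    (∀ i < s'.w 3, ¬ i < s.w 6 → s'.A 0 (s.w 1 + i) = s.w 1))
    (fun s' => 5 * (s.w 1 - s'.w 3)) ?_ ?_).mono ?_
  · simp
  · rintro s' ⟨h₁, h₂, h₃⟩ hF
    have hw1 : s'.w 1 = s.w 1 := by rw [hF.w 1 rfl]; simp
    have hw6 : s'.w 6 = s.w 6 := by rw [hF.w 6 rfl]; simp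
    refine ⟨by simp, fun hb => ?_⟩
    simp [hw1] at hb
    have key : ∀ x i, Function.update (s'.A 0) (s.w 1 + s'.w 3) x (s.w 1 + i) =
        if i = s'.w 3 then x else s'.A 0 (s.w 1 + i) := by
      intro x i
      simp [Function.update_apply]
    simp [hw1, hw6]
    refine ⟨fun h => ⟨⟨by omega, by omega⟩, by omega,
        ⟨by omega, fun i hi hi' => ?_, fun i hi hi' => ?_⟩, by omega⟩,
      fun h => ⟨⟨by omega, by omega⟩, by omega,
        ⟨by omega, fun i hi hi' => ?_, fun i hi hi' => ?_⟩, by omega⟩⟩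
    all_goals
      rw [key]; split_ifs with hi3
    · exact hi3.symm
    · exact h₂ i (by omega) hi'
    · omega
    · exact h₃ i (by omega) (by omega)
    · omega
    · exact h₂ i (by omega) hi'
    · rfl
    · exact h₃ i (by omega) (by omega)
  · rintro t s' ⟨⟨h₁, h₂, h₃⟩, hb, hF, ht⟩
    have hw1 : s'.w 1 = s.w 1 := by rw [hF.w 1 rfl]; simp
    have hFk : s'.F k = s.F k := by rw [hF.F k rfl]; simp
    simp [hw1] at hb ht
    have h3 : s'.w 3 = s.w 1 := by omega
    rw [wp_seq, wp_wset]
    refine ⟨by simp, ?_⟩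
    -- Inner nodes are computed in decreasing order, hence children before parents; those with an
    -- index below `w 3` are still arbitrary.
    refine (WP.while (fun s'' => 1 ≤ s''.w 3 ∧ s''.w 3 ≤ s.w 1 ∧
      IsTree (s.w 1) (s.F k) {i | i < s.w 6} {u | u < s''.w 3} (s''.A 0))
      (fun s' => 8 * s'.w 3) ?_ ?_).mono ?_
    · refine ⟨by simp [hw1, hm'], by simp [hw1], ?_⟩
      simp only [Store.setW_w, if_true, WExp.eval, hw1, Store.setW_A]
      exact ⟨fun i hi hi' => h₂ i (by omega) hi', fun i hi hi' => h₃ i (by omega) hi',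
        fun v _ hv hv' => absurd hv hv', fun v _ hv hv' => absurd hv hv'⟩
    · rintro s'' ⟨g₁, g₂, g₃⟩ hF'
      have hw1' : s''.w 1 = s.w 1 := by rw [hF'.w 1 rfl]; simp [hw1]
      have hFk' : s''.F k = s.F k := by rw [hF'.F k rfl]; simp [hFk]
      refine ⟨by simp, fun hb' => ?_⟩
      simp at hb'
      rw [wp_seq, wp_wset]
      refine ⟨by simp, ?_⟩
      refine (pull_spec hB hk (al := {i | i < s.w 6}) (X := {u | u < s''.w 3})
        (X' := {u | u < s''.w 3 - 1}) ?_ ?_ ?_ ?_ ?_ ?_).mono ?_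
      · simp [hw1', hm]
      · simp; omega
      · simp [hw1']; omega
      · simpa [hw1', hFk'] using g₃
      · intro u hu
        simp at hu ⊢; omega
      · intro u hu hu'
        simp at hu' ⊢; omega
      · rintro t' s₃ ⟨ht', h4, h5⟩
        simp [hw1', hFk'] at h4 h5
        rw [h4]
        exact ⟨⟨by omega, by omega, h5⟩, by omega⟩
    · rintro t' s'' ⟨⟨g₁, g₂, g₃⟩, hb', _, ht'⟩
      simp [hw1] at ht' hb'
      refine ⟨by omega, g₃.mono fun u hu hu' => ?_⟩
      simp at hu'; omega

end

end RealRAM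

namespace RealRAM

/-! ### Sorting -/

/-- Changing the status and the key of player `i` affects only the ancestors of its leaf. -/
theorem IsTree.change {h : ℕ} {κ κ' : ℕ → ℝ} {al al' : Set ℕ} {T : ℕ → ℕ} {i x : ℕ}
    (hT : IsTree (2 ^ h) κ al ∅ T) (hi : i < 2 ^ h) (hκ : ∀ j, j ≠ i → κ' j = κ j)
    (hal : ∀ j, j ≠ i → (j ∈ al' ↔ j ∈ al))
    (hx : (i ∈ al' ∧ x = i) ∨ (i ∉ al' ∧ x = 2 ^ h)) :
    IsTree (2 ^ h) κ' al' {u | ∃ d, u = (2 ^ h + i) / 2 ^ (d + 1)}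
      (Function.update T (2 ^ h + i) x) where
  mem j hj hjal := by
    by_cases hji : j = i
    · subst hji
      rcases hx with ⟨_, hx⟩ | ⟨h', _⟩
      · simpa using hx
      · exact absurd hjal h'
    · rw [Function.update_of_ne (by omega), hT.mem j hj ((hal j hji).1 hjal)]
  notMem j hj hjal := by
    by_cases hji : j = i
    · subst hji
      rcases hx with ⟨h', _⟩ | ⟨_, hx⟩
      · exact absurd h' hjal
      · simpa using hx
    · rw [Function.update_of_ne (by omega), hT.notMem j hj fun h' => hjal ((hal j hji).2 h')]
  le v hv hvm _ := by
    rw [Function.update_of_ne (by omega)]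
    exact hT.le v hv hvm (by simp)
  node v hv hvm hX := by
    have key : ∀ u d, u * 2 ^ d ≤ 2 ^ h + i → 2 ^ h + i < (u + 1) * 2 ^ d →
        (2 ^ h + i) / 2 ^ d = u := fun u d h₁ h₂ =>
      Nat.div_eq_of_lt_le h₁ h₂
    -- An entry `i` can only occur on the path from the leaf of `i` to the root. So the children of
    -- a node off this path keep their entries, and the keys of these entries have not changed. The
    -- height of a node `u` is `h - Nat.log 2 u`.
    have hd : ∀ u, 1 ≤ u → u < 2 * 2 ^ h → u ≠ 2 ^ h + i → (u / 2 = v) →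
        Function.update T (2 ^ h + i) x u = T u ∧ T u ≠ i ∧ T u ≤ 2 ^ h := by
      intro u hu hum hui huv
      rw [Function.update_of_ne hui]
      refine ⟨rfl, fun hTu => ?_, hT.le_of_notMem hu hum (by simp)⟩
      have hl := Nat.lt_pow_succ_log_self one_lt_two u
      have hl' := Nat.pow_log_le_self 2 (show u ≠ 0 by omega)
      have hle : Nat.log 2 u ≤ h := by
        by_contra hlt
        have := Nat.pow_le_pow_right (n := 2) (by norm_num) (show h + 1 ≤ Nat.log 2 u by omega)
        rw [pow_succ] at this; omega
      have e : 2 ^ h = 2 ^ Nat.log 2 u * 2 ^ (h - Nat.log 2 u) := by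
        rw [← pow_add]; congr 1; omega
      rcases hT.node_spec (by positivity) (h - Nat.log 2 u) u
        (by rw [e]; exact Nat.mul_le_mul_right _ hl')
        (by
          rw [e, ← mul_assoc]
          refine Nat.mul_le_mul_right _ ?_
          rw [pow_succ] at hl; omega) with ⟨h₁, _⟩ | ⟨_, h₁, h₂, _⟩
      · omega
      · rw [hTu] at h₁ h₂
        have := key _ _ h₁ h₂
        refine hX ⟨h - Nat.log 2 u, ?_⟩
        rw [pow_succ, ← Nat.div_div_eq_div_mul, this, huv]
    have hne : ∀ u, u / 2 = v → u ≠ 2 ^ h + i := by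
      rintro u huv rfl
      exact hX ⟨0, by simp [huv]⟩
    obtain ⟨a₁, a₂, a₃⟩ := hd (v + v) (by omega) (by omega) (hne _ (by omega)) (by omega)
    obtain ⟨b₁, b₂, b₃⟩ := hd (v + v + 1) (by omega) (by omega) (hne _ (by omega)) (by omega)
    rw [Function.update_of_ne (by omega), hT.node v hv hvm (by simp), a₁, b₁]
    unfold winner
    rw [hκ _ a₂, hκ _ b₂]

/-- `σ` enumerates the indices below `n` in the order of the keys `κ`. -/
structure SortedBy (n : ℕ) (κ : ℕ → ℝ) (σ : ℕ → ℕ) : Prop where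
  lt : ∀ i < n, σ i < n
  ne : ∀ i < n, ∀ j < i, σ j ≠ σ i
  le : ∀ i < n, ∀ j < i, κ (σ j) ≤ κ (σ i)

/-- Sort the indices below `w 0` by the keys in the real array `k` into the word array `out`. -/
def sort (k out : ℕ) : Cmd :=
  .wset 6 (wr 0) ;; build k ;; .wset 2 (wc 0) ;;
  .while (.wlt (wr 2) (wr 0))
    (.aset out (wr 2) (wa 0 (wc 1)) ;; .wset 3 (wr 1 + wa 0 (wc 1)) ;;
      .aset 0 (wr 3) (wr 1) ;; walkUp k ;; .wset 2 (wr 2 + wc 1))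

/-- Tournament sort: each round outputs the root and deletes its leaf, which costs one walk to the
root. The order is right because no key that has been output exceeds a key that remains. -/
theorem sort_spec {n B : ℕ} (hB : 66 * n + 1200 ≤ B) {k out : ℕ} (hk : k ≠ 16) (ho : out ≠ 0)
    {s : Store} {h : ℕ} (h0 : s.w 0 = n) (h1 : s.w 1 = 2 ^ h) (hm : 2 ^ h ≤ 2 * n + 2)
    (hn : n ≤ 2 ^ h) :
    WP n B (sort k out) s fun t s' => t ≤ 13 * 2 ^ h + n * (8 * h + 6) + 15 ∧
      SortedBy n (s.F k) (s'.A out) := by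
  have hpos : 1 ≤ 2 ^ h := Nat.one_le_two_pow
  rw [sort, wp_seq, wp_wset]
  refine ⟨by simp, ?_⟩
  rw [wp_seq]
  refine (build_spec hB hk ?_ ?_).frame.mono ?_
  · simp [h1, hm]
  · simp [h1, hpos]
  rintro t₁ s₁ ⟨⟨ht₁, hT₁⟩, hF₁⟩
  have hw0 : s₁.w 0 = n := by rw [hF₁.w 0 rfl]; simp [h0]
  have hw1 : s₁.w 1 = 2 ^ h := by rw [hF₁.w 1 rfl]; simp [h1]
  have hFk : s₁.F k = s.F k := by rw [hF₁.F k rfl]; simp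
  simp [h0, h1] at ht₁ hT₁
  rw [wp_seq, wp_wset]
  refine ⟨by simp, ?_⟩
  refine (WP.while (fun s' => s'.w 2 ≤ n ∧
    IsTree (2 ^ h) (s.F k) {x | x < n ∧ ∀ j < s'.w 2, s'.A out j ≠ x} ∅ (s'.A 0) ∧
    (∀ i < s'.w 2, s'.A out i < n) ∧ (∀ i < s'.w 2, ∀ j < i, s'.A out j ≠ s'.A out i) ∧
    (∀ i < s'.w 2, ∀ j < i, s.F k (s'.A out j) ≤ s.F k (s'.A out i)) ∧
    (∀ i < s'.w 2, ∀ x < n, (∀ j < s'.w 2, s'.A out j ≠ x) → s.F k (s'.A out i) ≤ s.F k x)) (fun s' => (8 * h + 6) * (n - s'.w 2)) ?_ ?_).mono ?_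
  · refine ⟨by simp, ?_, by simp, by simp, by simp, by simp⟩
    simpa using hT₁
  · rintro s' ⟨g₁, g₂, g₃, g₄, g₅, g₆⟩ hF
    have hw0' : s'.w 0 = n := by rw [hF.w 0 rfl]; simp [hw0]
    have hw1' : s'.w 1 = 2 ^ h := by rw [hF.w 1 rfl]; simp [hw1]
    have hFk' : s'.F k = s.F k := by rw [hF.F k rfl]; simp [hFk]
    refine ⟨by simp, fun hb => ?_⟩
    simp [hw0'] at hb
    -- Fewer than `n` values have been output, so they cannot exhaust the indices below `n`.
    have hne : {x | x < n ∧ ∀ j < s'.w 2, s'.A out j ≠ x}.Nonempty := by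
      obtain ⟨x, hx, hx'⟩ := Finset.exists_mem_notMem_of_card_lt_card
        (s := (Finset.range (s'.w 2)).image (s'.A out)) (t := Finset.range n)
        (by simpa using Finset.card_image_le.trans_lt (by simpa using hb))
      refine ⟨x, by simpa using hx, fun j hj hjx => hx' ?_⟩
      exact Finset.mem_image.2 ⟨j, by simpa using hj, hjx⟩
    obtain ⟨⟨hr, hr'⟩, hr''⟩ := g₂.root_spec (fun i hi => hi.1.trans_le hn) hne
    generalize hρ : s'.A 0 1 = ρ at hr hr' hr''
    have e₀ : s'.A 0 1 = ρ := hρ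
    simp only [wp_seq, wp_wset, wp_aset]
    refine ⟨by simp; omega, by simp [ho.symm, hw1', e₀]; omega, by simp [hw1', e₀, ho.symm]; omega, ?_⟩
    have hup : ∀ y, (Function.update (s'.A out) (s'.w 2) ρ) y = if y = s'.w 2 then ρ else
      s'.A out y := fun y => Function.update_apply _ _ _ _
    refine (walkUp_spec hB hk (al := {x | x < n ∧ ∀ j < s'.w 2 + 1,
      Function.update (s'.A out) (s'.w 2) ρ j ≠ x}) ?_ ?_ ?_ ?_).frame.mono ?_
    · simp [hw1', hm]
    · simp [hw1', ho.symm, e₀]; omega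
    · simp [hw1', ho.symm, e₀]; omega
    · simp only [Store.setW_w, Store.setW_A, Store.setW_F, Store.setA_w, Store.setA_A, Store.setA_F,
        WExp.eval, if_neg ho.symm, if_true, e₀, hw1', hFk']
      simp only [show (1 : ℕ) ≠ 3 by norm_num, if_false]
      refine g₂.change (by omega) (fun _ _ => rfl) (fun j hj => ?_) (Or.inr ⟨fun h' => ?_, rfl⟩)
      · simp only [Set.mem_ofPred_eq, hup]
        refine and_congr_right fun _ => ⟨fun h' i hi => ?_, fun h' i hi => ?_⟩
        · simpa [hi.ne] using h' i (by omega)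
        · split_ifs with hi'
          · exact Ne.symm hj
          · exact h' i (by omega)
      · exact h'.2 (s'.w 2) (by omega) (by simp)
    · rintro t₂ s₂ ⟨⟨ht₂, hT₂⟩, hF₂⟩
      have hw2 : s₂.w 2 = s'.w 2 := by rw [hF₂.w 2 rfl]; simp
      have hA : s₂.A out = Function.update (s'.A out) (s'.w 2) ρ := by
        rw [hF₂.A out (by simp [walkUp, pull, Cmd.writesA, ho])]; simp [ho, e₀]
      simp [hw1', hFk', ho.symm, e₀, -ne_eq] at ht₂ hT₂
      have hlog : Nat.log 2 (2 ^ h + ρ) ≤ h := by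
        refine Nat.lt_succ_iff.1 (Nat.log_lt_of_lt_pow (by omega) ?_)
        rw [pow_succ]; omega
      simp only [Store.setW_w, Store.setW_A, WExp.eval, Op.wval, if_true, hw2, hA, hup]
      refine ⟨by simp [hw2]; omega, ⟨by omega, ?_, ?_, ?_, ?_, ?_⟩, ?_⟩
      · simpa only [hup, Nat.lt_succ_iff] using hT₂
      · intro i hi
        split_ifs with hi'
        · exact hr
        · exact g₃ i (by omega)
      · intro i hi j hj
        rw [if_neg (by omega)]
        split_ifs with hi'
        · exact hr' j (by omega)
        · exact g₄ i (by omega) j hj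
      · intro i hi j hj
        rw [if_neg (by omega)]
        split_ifs with hi'
        · exact g₆ j (by omega) ρ hr hr'
        · exact g₅ i (by omega) j hj
      · intro i hi x hx hx'
        have hx₂ : ∀ j < s'.w 2, s'.A out j ≠ x := fun j hj => by
          simpa [hj.ne] using hx' j (by omega)
        split_ifs with hi'
        · exact hr'' x ⟨hx, hx₂⟩
        · exact g₆ i (by omega) x hx hx₂
      · obtain ⟨e, he⟩ : ∃ e, n - s'.w 2 = e + 1 := ⟨n - s'.w 2 - 1, by omega⟩
        rw [he, show n - (s'.w 2 + 1) = e by omega, Nat.mul_succ]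
        omega
  · rintro t₂ s₂ ⟨⟨g₁, g₂, g₃, g₄, g₅, g₆⟩, hb, hF, ht₂⟩
    have hw0' : s₂.w 0 = n := by rw [hF.w 0 rfl]; simp [hw0]
    simp [hw0'] at hb ht₂
    have : s₂.w 2 = n := by omega
    rw [this] at g₃ g₄ g₅
    refine ⟨?_, g₃, g₄, g₅⟩
    rw [mul_comm n]; omega

end RealRAM

namespace IntervalSeparation

/-! ### Scheduling intervals to the right: a feasibility criterion -/

/-- Total length of the first `j` intervals. -/
noncomputable def total (a b : ℕ → ℝ) (j : ℕ) : ℝ := ∑ k ∈ Finset.range j, (b k - a k)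

open Classical in
/-- The last of the intervals `0, …, j` whose right endpoint is largest. -/
noncomputable def champ (b : ℕ → ℝ) : ℕ → ℕ
  | 0 => 0
  | j + 1 => if b (champ b j) ≤ b (j + 1) then j + 1 else champ b j

open Classical in
/-- The idle time before the end of the intervals `0, …, r`, when the champion is moved behind
all of them. -/
noncomputable def idle (a b : ℕ → ℝ) : ℕ → ℝ
  | 0 => a 0
  | j + 1 => if b (champ b j) ≤ b (j + 1) then a (j + 1) - total a b (j + 1) else
      max (idle a b j) (a (j + 1) - total a b (j + 1) + (b (champ b j) - a (champ b j)))

theorem total_succ (a b : ℕ → ℝ) (j : ℕ) : total a b (j + 1) = total a b j + (b j - a j) :=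
  Finset.sum_range_succ _ _

theorem champ_le (b : ℕ → ℝ) (j : ℕ) : champ b j ≤ j := by
  induction j with
  | zero => rfl
  | succ j ih => rw [champ]; split_ifs <;> omega

theorem le_champ (b : ℕ → ℝ) {i j : ℕ} (h : i ≤ j) : b i ≤ b (champ b j) := by
  induction j with
  | zero => rw [Nat.le_zero.1 h]; exact le_rfl
  | succ j ih =>
    rw [champ]
    rcases Nat.lt_or_eq_of_le h with h | rfl
    · split_ifs with h'
      · exact (ih (by omega)).trans h'
      · exact ih (by omega)
    · split_ifs with h'
      · exact le_rfl
      · exact (not_le.1 h').le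

theorem champ_succ_eq_self_iff {b : ℕ → ℝ} {j : ℕ} :
    champ b (j + 1) = j + 1 ↔ b (champ b j) ≤ b (j + 1) := by
  rw [champ]
  split_ifs with h
  · simp [h]
  · have := champ_le b j
    simp only [h, iff_false]; omega

theorem champ_succ_eq {b : ℕ → ℝ} {j : ℕ} (h : champ b (j + 1) ≠ j + 1) :
    champ b (j + 1) = champ b j := by
  rw [Ne, champ_succ_eq_self_iff] at h
  rw [champ, if_neg h]

/-- The champion changes only when a new index becomes champion, so it is constant from its own
position up to `j`: blocks are contiguous. -/
theorem champ_eq_of_le {b : ℕ → ℝ} {i j : ℕ} (h : champ b j ≤ i) (hij : i ≤ j) :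
    champ b i = champ b j := by
  induction j with
  | zero => rw [Nat.le_zero.1 hij]
  | succ j ih =>
    rcases Nat.lt_or_eq_of_le hij with h' | rfl
    · have : champ b (j + 1) = champ b j := champ_succ_eq (by omega)
      rw [this] at h ⊢
      exact ih h (by omega)
    · rfl

theorem champ_champ (b : ℕ → ℝ) (j : ℕ) : champ b (champ b j) = champ b j :=
  champ_eq_of_le le_rfl (champ_le b j)

theorem champ_mono (b : ℕ → ℝ) : Monotone (champ b) := by
  refine monotone_nat_of_le_succ fun j => ?_
  have := champ_le b j
  rw [champ]; split_ifs <;> omega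

theorem idle_of_champ {a b : ℕ → ℝ} {M : ℕ} (h : champ b M = M) :
    idle a b M = a M - total a b M := by
  cases M with
  | zero => simp [idle, total]
  | succ j => rw [idle, if_pos (champ_succ_eq_self_iff.1 h)]

theorem idle_succ {a b : ℕ → ℝ} {j : ℕ} (h : champ b (j + 1) ≠ j + 1) :
    idle a b (j + 1) = max (idle a b j)
      (a (j + 1) - total a b (j + 1) + (b (champ b j) - a (champ b j))) := by
  rw [idle, if_neg (mt champ_succ_eq_self_iff.2 h)]

/-- Inside a block, `idle` is a running maximum. Across blocks it need not be monotone, which is why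
the criterion compares all earlier champions. -/
theorem idle_mono {a b : ℕ → ℝ} {i j : ℕ} (hij : i ≤ j) (h : champ b i = champ b j) :
    idle a b i ≤ idle a b j := by
  induction j with
  | zero => rw [Nat.le_zero.1 hij]
  | succ j ih =>
    rcases Nat.lt_or_eq_of_le hij with h' | rfl
    · have hi := champ_le b i
      have hc : champ b (j + 1) ≠ j + 1 := by omega
      rw [idle_succ hc]
      exact (ih (by omega) (h.trans (champ_succ_eq hc))).trans (le_max_left _ _)
    · exact le_rfl

/-- An upper bound for `idle`. -/
theorem idle_le {a b : ℕ → ℝ} {r : ℕ} {x : ℝ}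
    (h₁ : a (champ b r) - total a b (champ b r) ≤ x)
    (h₂ : ∀ k, champ b r < k → k ≤ r →
      a k - total a b k + (b (champ b r) - a (champ b r)) ≤ x) : idle a b r ≤ x := by
  induction r with
  | zero => simpa [idle, total, champ] using h₁
  | succ j ih =>
    by_cases hc : champ b (j + 1) = j + 1
    · rw [idle_of_champ hc]; rwa [hc] at h₁
    · rw [idle_succ hc]
      have e := champ_succ_eq hc
      have := champ_le b (j + 1)
      rw [e] at h₁ h₂
      refine max_le (ih h₁ fun k hk hk' => h₂ k hk (by omega)) (h₂ _ (by omega) le_rfl)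

/-- `Q r` is the largest delay of the champion `champ b r` and the following intervals of the
same champion, when the champion is moved behind the interval `r`. -/
def IsDelayBound (n : ℕ) (a b Q : ℕ → ℝ) : Prop :=
  ∀ r < n, ∀ D, Q r ≤ D ↔ total a b (r + 1) - b (champ b r) ≤ D ∧
    ∀ j, r < j → j < n → champ b j = champ b r → ∃ k, r < k ∧ k ≤ j ∧ total a b (j + 1) - b k ≤ D

/-- Every champion `M` can be moved behind the interval `χ M` such that no delay exceeds `D`. -/
def Feasible (n : ℕ) (a b Q : ℕ → ℝ) (D : ℝ) : Prop :=
  ∃ χ : ℕ → ℕ, ∀ M < n, champ b M = M → χ M < n ∧ champ b (χ M) = M ∧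
    ∀ M' ≤ M, champ b M' = M' → idle a b (χ M') + Q (χ M) ≤ D

/-- Disjoint jobs between `t` and `T` have total length at most `T - t`. -/
theorem sum_le_of_disjoint {s p : ℕ → ℝ} {t : ℝ} (S : Finset ℕ) (hp : ∀ i ∈ S, 0 < p i)
    (hd : ∀ i ∈ S, ∀ j ∈ S, i ≠ j → s i + p i ≤ s j ∨ s j + p j ≤ s i)
    (ht : ∀ i ∈ S, t ≤ s i) {T : ℝ} (hT : ∀ i ∈ S, s i + p i ≤ T) (htT : t ≤ T) :
    ∑ i ∈ S, p i ≤ T - t := by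
  classical
  -- The job that starts last is split off; all the others end before its start, which becomes the
  -- new `T`.
  induction S using Finset.induction_on_max_value s generalizing T with
  | empty => simpa using htT
  | insert i S hi hmax ih =>
    rw [Finset.sum_insert hi]
    have := ih (T := s i) (fun j hj => hp j (Finset.mem_insert_of_mem hj))
      (fun j hj k hk => hd j (Finset.mem_insert_of_mem hj) k (Finset.mem_insert_of_mem hk))
      (fun j hj => ht j (Finset.mem_insert_of_mem hj))
      (fun j hj => by
        rcases hd i (Finset.mem_insert_self _ _) j (Finset.mem_insert_of_mem hj)
          (fun h => hi (h ▸ hj)) with h | h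
        · have := hmax j hj
          have := hp i (Finset.mem_insert_self _ _)
          linarith
        · exact h) (ht i (Finset.mem_insert_self _ _))
    have := hT i (Finset.mem_insert_self _ _)
    linarith

/-- `s` schedules the intervals `[a i, b i]`, `i < n`, disjointly, with delays at most `D`. -/
structure IsSchedule (n : ℕ) (a b : ℕ → ℝ) (D : ℝ) (s : ℕ → ℝ) : Prop where
  le : ∀ i < n, a i ≤ s i
  delay : ∀ i < n, s i ≤ a i + D
  disj : ∀ i < n, ∀ j < n, i ≠ j → s i + (b i - a i) ≤ s j ∨ s j + (b j - a j) ≤ s i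

/-- The last interval of a schedule among the intervals `0, …, j`. -/
theorem exists_last (f : ℕ → ℝ) (j : ℕ) : ∃ l ≤ j, ∀ i ≤ j, f i ≤ f l := by
  obtain ⟨l, hl, h⟩ := Finset.exists_max_image (Finset.range (j + 1)) f ⟨0, by simp⟩
  exact ⟨l, by simpa [Nat.lt_succ_iff] using hl,
    fun i hi => h i (by simpa [Nat.lt_succ_iff] using hi)⟩

variable {n : ℕ} {a b Q : ℕ → ℝ} {D : ℝ} {s : ℕ → ℝ}

theorem total_sub (a b : ℕ → ℝ) {k j : ℕ} (h : k ≤ j) :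
    total a b j - total a b k = ∑ i ∈ Finset.Ico k j, (b i - a i) :=
  (Finset.sum_Ico_eq_sub _ h).symm

theorem total_mono (hab : ∀ i < n, a i < b i) {k j : ℕ} (h : k ≤ j) (hj : j ≤ n) :
    total a b k ≤ total a b j := by
  rw [← sub_nonneg, total_sub a b h]
  refine Finset.sum_nonneg fun i hi => ?_
  have := hab i (by simp at hi; omega)
  linarith

theorem IsSchedule.total_le (hs : IsSchedule n a b D s) (hab : ∀ i < n, a i < b i)
    {k j : ℕ} (hkj : k ≤ j) (hj : j ≤ n) {t T : ℝ} (ht : ∀ i, k ≤ i → i < j → t ≤ s i)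
    (hT : ∀ i, k ≤ i → i < j → s i + (b i - a i) ≤ T) (htT : t ≤ T) :
    total a b j - total a b k ≤ T - t := by
  rw [total_sub a b hkj]
  refine sum_le_of_disjoint (s := s) _ (fun i hi => ?_) (fun i hi i' hi' => ?_) (fun i hi => ?_)
    (fun i hi => ?_) htT
  · simp at hi; have := hab i (by omega); linarith
  · simp at hi hi'; exact hs.disj i (by omega) i' (by omega)
  · simp at hi; exact ht i hi.1 hi.2
  · simp at hi; exact hT i hi.1 hi.2

/-- The same count of work in a time window, for a run of consecutive intervals together with a
champion `M` that precedes them in sorted order but may be postponed. -/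
theorem IsSchedule.total_add_le (hs : IsSchedule n a b D s) (hab : ∀ i < n, a i < b i)
    {M k j : ℕ} (hMk : M < k) (hkj : k ≤ j) (hj : j ≤ n) (hM : M < n) {t T : ℝ}
    (ht : ∀ i, k ≤ i → i < j → t ≤ s i)
    (hT : ∀ i, k ≤ i → i < j → s i + (b i - a i) ≤ T) (ht' : t ≤ s M)
    (hT' : s M + (b M - a M) ≤ T) :
    total a b j - total a b k + (b M - a M) ≤ T - t := by
  have hMab := hab M hM
  have hnot : M ∉ Finset.Ico k j := by simp; omega
  rw [total_sub a b hkj, add_comm, ← Finset.sum_insert hnot (f := fun i => b i - a i)]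
  have key : ∀ i ∈ insert M (Finset.Ico k j), i < n ∧ t ≤ s i ∧ s i + (b i - a i) ≤ T := by
    intro i hi
    rcases Finset.mem_insert.1 hi with rfl | hi
    · exact ⟨hM, ht', hT'⟩
    · simp at hi; exact ⟨by omega, ht i hi.1 hi.2, hT i hi.1 hi.2⟩
  refine sum_le_of_disjoint (s := s) _ (fun i hi => ?_)
    (fun i hi i' hi' => hs.disj i (key i hi).1 i' (key i' hi').1) (fun i hi => (key i hi).2.1)
    (fun i hi => (key i hi).2.2) (by linarith)
  have := hab i (key i hi).1; linarith

end IntervalSeparation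

/-! ### Necessity of the criterion -/

namespace IntervalSeparation

variable {n : ℕ} {a b Q : ℕ → ℝ} {D : ℝ} {s : ℕ → ℝ}

/-- For one champion `M`: where to move it, given a schedule whose makespans are `mk`. -/
theorem IsSchedule.exists_choice (hs : IsSchedule n a b D s) (ha : ∀ j < n, ∀ i ≤ j, a i ≤ a j)
    (hab : ∀ i < n, a i < b i) (hQ : IsDelayBound n a b Q) {ℓ : ℕ → ℕ}
    (hℓ : ∀ j, ℓ j ≤ j ∧ ∀ i ≤ j, s i + (b i - a i) ≤ s (ℓ j) + (b (ℓ j) - a (ℓ j)))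
    {M : ℕ} (hM : M < n) (hMc : champ b M = M) :
    ∃ r < n, champ b r = M ∧
      (∀ j, r ≤ j → j < n →
        idle a b r + total a b (j + 1) ≤ s (ℓ j) + (b (ℓ j) - a (ℓ j))) ∧
      idle a b r + Q r ≤ D ∧
      ∀ c, (∀ j, M ≤ j → j < n → c + total a b (j + 1) ≤ s (ℓ j) + (b (ℓ j) - a (ℓ j))) →
        c + Q r ≤ D := by
  classical
  have hpos : ∀ i < n, 0 < b i - a i := fun i hi => sub_pos.2 (hab i hi)
  have hend : ∀ i < n, s i + (b i - a i) ≤ b i + D := fun i hi => by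
    have := hs.delay i hi; linarith
  have hmk : ∀ i j, i ≤ j → s (ℓ i) + (b (ℓ i) - a (ℓ i)) ≤ s (ℓ j) + (b (ℓ j) - a (ℓ j)) :=
    fun i j hij => (hℓ j).2 _ ((hℓ i).1.trans hij)
  have hlast : ∀ j < n, ∀ i ≤ j, i ≠ ℓ j → s i + (b i - a i) ≤ s (ℓ j) := by
    intro j hj i hij hne
    rcases hs.disj i (by omega) (ℓ j) (by have := (hℓ j).1; omega) hne with h | h
    · exact h
    · have := (hℓ j).2 i hij
      have := hpos i (by omega)
      linarith
  -- the work bound for the intervals `M, …, j`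
  have hMwork : ∀ j, M ≤ j → j < n →
      a M - total a b M + total a b (j + 1) ≤ s (ℓ j) + (b (ℓ j) - a (ℓ j)) := by
    intro j hMj hj
    have := hs.total_le (k := M) (j := j + 1) hab (by omega) (by omega) (t := a M)
      (T := s (ℓ j) + (b (ℓ j) - a (ℓ j)))
      (fun i hi hi' => (ha i (by omega) M hi).trans (hs.le i (by omega)))
      (fun i _ hi' => (hℓ j).2 i (by omega))
      (by have := (hℓ j).2 M hMj; have := hs.le M hM; have := hpos M hM; linarith)
    linarith
  -- `r₀` is the last index of the block for which the interval ending last among `0, …, r₀` is `M`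
  -- or comes before `M`. Such an index exists because `M` itself qualifies.
  obtain ⟨r₀, ⟨hr₀n, hr₀c, hr₀⟩, hmax⟩ : ∃ r₀, (r₀ < n ∧ champ b r₀ = M ∧ ℓ r₀ ≤ M) ∧
      ∀ j, r₀ < j → j < n → champ b j = M → M < ℓ j := by
    let S := (Finset.range n).filter fun r => champ b r = M ∧ ℓ r ≤ M
    have hne : S.Nonempty := ⟨M, by simp [S, hM, hMc, (hℓ M).1]⟩
    have hS := S.max'_mem hne
    simp only [S, Finset.mem_filter, Finset.mem_range] at hS
    refine ⟨S.max' hne, ⟨hS.1, hS.2.1, hS.2.2⟩, fun j hj hjn hjc => ?_⟩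
    by_contra hlt
    have := S.le_max' j (by simp [S, hjn, hjc, not_lt.1 hlt])
    omega
  have hMr₀ : M ≤ r₀ := hr₀c ▸ champ_le b r₀
  -- intervals after `r₀`
  have hafter : ∀ c, (∀ j, r₀ ≤ j → j < n →
      c + total a b (j + 1) ≤ s (ℓ j) + (b (ℓ j) - a (ℓ j))) →
      ∀ j, r₀ < j → j < n → champ b j = M → ∃ k, r₀ < k ∧ k ≤ j ∧
        total a b (j + 1) - b k ≤ D - c := by
    intro c hc j hj hjn hjc
    -- The interval ending last among `0, …, j` comes after `M`. Were it at most `r₀`, it would end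
    -- before `ℓ r₀` starts and could not end last.
    refine ⟨ℓ j, ?_, (hℓ j).1, ?_⟩
    · by_contra hlt
      have h₁ := hmax j hj hjn hjc
      have hne : ℓ j ≠ ℓ r₀ := by omega
      have h₂ := hlast r₀ hr₀n (ℓ j) (by omega) hne
      have h₃ := (hℓ j).2 (ℓ r₀) (by omega)
      have := hpos (ℓ r₀) (by omega)
      linarith
    · have := hc j hj.le hjn
      have := hend (ℓ j) (by have := (hℓ j).1; omega)
      linarith
  rcases Nat.lt_or_eq_of_le hr₀ with hlt | heq
  · -- the champion is not last
    let S := (Finset.range (r₀ + 1)).filter fun r => M ≤ r ∧ ∀ j, M ≤ j → j < n →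
      idle a b r + total a b (j + 1) ≤ s (ℓ j) + (b (ℓ j) - a (ℓ j))
    have hne : S.Nonempty := ⟨M, by
      simp only [S, Finset.mem_filter, Finset.mem_range, idle_of_champ hMc]
      exact ⟨by omega, le_rfl, hMwork⟩⟩
    -- The largest index up to `r₀` whose idle time is compatible with all the given makespans from
    -- `M` on.
    obtain ⟨r, hrS, hrmax⟩ : ∃ r ∈ S, ∀ k ∈ S, k ≤ r :=
      ⟨S.max' hne, S.max'_mem hne, fun k hk => S.le_max' k hk⟩
    simp only [S, Finset.mem_filter, Finset.mem_range] at hrS hrmax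
    obtain ⟨hr, hMr, hV⟩ := hrS
    have hrc : champ b r = M := by rw [← hr₀c]; exact champ_eq_of_le (by omega) (by omega)
    have hmain : ∀ c, (∀ j, M ≤ j → j < n →
        c + total a b (j + 1) ≤ s (ℓ j) + (b (ℓ j) - a (ℓ j))) → c + Q r ≤ D := by
      intro c hc
      rw [← le_sub_iff_add_le', hQ r (by omega), hrc]
      refine ⟨?_, fun j hj hjn hjc => ?_⟩
      -- The delay of the champion is controlled by that of `ℓ r₀`, which ends no earlier than
      -- everything up to `r` and, preceding `M`, has no larger right endpoint.
      · have h₁ := hc r hMr (by omega)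
        have h₂ := hmk r r₀ (by omega)
        have h₃ := hend (ℓ r₀) (by omega)
        have h₄ := le_champ b hlt.le
        rw [hMc] at h₄
        linarith
      · rcases Nat.lt_or_ge r₀ j with hj₀ | hj₀
        · obtain ⟨k, hk, hk', h⟩ := hafter c (fun j hj => hc j (by omega)) j hj₀ hjn hjc
          exact ⟨k, by omega, hk', h⟩
        · refine ⟨r + 1, by omega, by omega, ?_⟩
          have hk : ¬ ∀ j, M ≤ j → j < n →
              idle a b (r + 1) + total a b (j + 1) ≤ s (ℓ j) + (b (ℓ j) - a (ℓ j)) := fun h => by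
            have := hrmax (r + 1) ⟨by omega, by omega, h⟩
            omega
          push Not at hk
          obtain ⟨j₀, hMj₀, hj₀n, hj₀⟩ := hk
          have hc' : champ b (r + 1) ≠ r + 1 := by
            have : champ b (r + 1) ≤ champ b r₀ := champ_mono b (by omega)
            omega
          rw [idle_succ hc', hrc] at hj₀
          have h₁ := hV j₀ hMj₀ hj₀n
          have h₂ := hc j₀ hMj₀ hj₀n
          have h₃ : max (idle a b r) (a (r + 1) - total a b (r + 1) + (b M - a M)) =
              a (r + 1) - total a b (r + 1) + (b M - a M) := by
            rcases max_choice (idle a b r) (a (r + 1) - total a b (r + 1) + (b M - a M)) with h | h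
            · rw [h] at hj₀; linarith
            · exact h
          rw [h₃] at hj₀
          have h₄ := total_succ a b (r + 1)
          have hlr := (hℓ r₀).1
          have h₅ := hs.total_add_le (M := M) (k := r + 1 + 1) (j := j + 1) hab (by omega)
            (by omega) (by omega) hM (t := a (ℓ r₀)) (T := s (ℓ r₀))
            (fun i hi hi' => (ha i (by omega) _ (by omega)).trans (hs.le i (by omega)))
            (fun i hi hi' => hlast r₀ hr₀n i (by omega) (by omega))
            ((ha M hM _ hr₀).trans (hs.le M hM)) (hlast r₀ hr₀n M hMr₀ (by omega))
          have := hs.delay (ℓ r₀) (by omega)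
          linarith
    exact ⟨r, by omega, hrc, fun j hj hjn => hV j (by omega) hjn, hmain _ hV, hmain⟩
  · -- the champion is last
    have hV : ∀ j, r₀ ≤ j → j < n →
        idle a b r₀ + total a b (j + 1) ≤ s (ℓ j) + (b (ℓ j) - a (ℓ j)) := by
      intro j hj hjn
      rw [← le_sub_iff_add_le]
      -- As `M` ends last among `0, …, r₀`, it starts after `k` has ended. So `M` and the intervals
      -- `k, …, j` all run after `a k`, and their work bounds the makespan.
      refine idle_le ?_ fun k hk hk' => ?_
      · rw [hr₀c]
        have := hMwork j (by omega) hjn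
        linarith
      · rw [hr₀c] at hk ⊢
        have h₁ := hlast r₀ hr₀n k hk' (by omega)
        rw [heq] at h₁
        have h₂ := hs.le k (by omega)
        have h₃ := hpos k (by omega)
        have h₄ := hs.total_add_le (M := M) (k := k) (j := j + 1) hab hk (by omega) (by omega) hM
          (t := a k) (T := s (ℓ j) + (b (ℓ j) - a (ℓ j)))
          (fun i hi hi' => (ha i (by omega) k hi).trans (hs.le i (by omega)))
          (fun i hi hi' => (hℓ j).2 i (by omega)) (by linarith) ((hℓ j).2 M (by omega))
        linarith
    have hmain : ∀ c, (∀ j, r₀ ≤ j → j < n →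
        c + total a b (j + 1) ≤ s (ℓ j) + (b (ℓ j) - a (ℓ j))) → c + Q r₀ ≤ D := by
      intro c hc
      rw [← le_sub_iff_add_le', hQ r₀ hr₀n, hr₀c]
      refine ⟨?_, hafter c hc⟩
      have h₁ := hc r₀ le_rfl hr₀n
      have h₂ := hend M hM
      rw [heq] at h₁
      linarith
    exact ⟨r₀, hr₀n, hr₀c, hV, hmain _ hV, fun c hc => hmain c fun j hj => hc j (by omega)⟩

/-- The criterion is necessary. -/
theorem IsSchedule.feasible (hs : IsSchedule n a b D s) (ha : ∀ j < n, ∀ i ≤ j, a i ≤ a j)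
    (hab : ∀ i < n, a i < b i) (hQ : IsDelayBound n a b Q) : Feasible n a b Q D := by
  choose ℓ hℓ using exists_last (fun i => s i + (b i - a i))
  have := fun M (hM : M < n ∧ champ b M = M) => hs.exists_choice ha hab hQ hℓ hM.1 hM.2
  choose! χ hχ using this
  refine ⟨χ, fun M hM hMc => ⟨(hχ M ⟨hM, hMc⟩).1, (hχ M ⟨hM, hMc⟩).2.1, fun M' hM' hMc' => ?_⟩⟩
  obtain ⟨_, _, _, h₁, h₂⟩ := hχ M ⟨hM, hMc⟩
  rcases Nat.lt_or_eq_of_le hM' with hlt | rfl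
  · obtain ⟨h₃, h₄, h₅, _⟩ := hχ M' ⟨by omega, hMc'⟩
    -- The makespan bound for `M'` holds from `χ M'` on, and `χ M'` precedes `M` since it lies in an
    -- earlier block.
    refine h₂ _ fun j hj hjn => h₅ j ?_ hjn
    by_contra hcon
    have := champ_mono b (show j ≤ χ M' by omega)
    have := champ_mono b hj
    omega
  · exact h₁

end IntervalSeparation

namespace IntervalSeparation

/-! ### Computing the smallest feasible delay -/

/-- `Vs` enumerates the values of `idle` in increasing order, and `ρ r` is the first position of
`idle r`. -/
structure IsRanking (n : ℕ) (a b Vs : ℕ → ℝ) (ρ : ℕ → ℕ) : Prop where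
  mono : ∀ v < n, ∀ u ≤ v, Vs u ≤ Vs v
  lt : ∀ r < n, ρ r < n
  le_iff : ∀ r < n, ∀ v < n, ρ r ≤ v ↔ idle a b r ≤ Vs v
  eq : ∀ r < n, Vs (ρ r) = idle a b r

/-- The champions before `M` can be moved with delays at most `D` and idle times at most `x`. -/
def FeasibleBefore (n : ℕ) (a b Q : ℕ → ℝ) (M : ℕ) (x D : ℝ) : Prop :=
  ∃ χ : ℕ → ℕ, ∀ M' < M, champ b M' = M' → χ M' < n ∧ champ b (χ M') = M' ∧
    idle a b (χ M') ≤ x ∧ ∀ M'' ≤ M', champ b M'' = M'' → idle a b (χ M'') + Q (χ M') ≤ D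

/-- The champions up to that of `r` can be moved, the last one behind `r`. -/
def FeasibleAt (n : ℕ) (a b Q Vs : ℕ → ℝ) (r : ℕ) (D : ℝ) : Prop :=
  0 ≤ D ∧ ∃ v < n, idle a b r ≤ Vs v ∧ FeasibleBefore n a b Q (champ b r) (Vs v) D ∧ Vs v + Q r ≤ D

variable {n : ℕ} {a b Q Vs : ℕ → ℝ} {ρ : ℕ → ℕ} {D : ℝ}

/-- The largest idle time of a choice is itself a value of `idle`, so bounds on idle times may be
restricted to the entries of `Vs`. -/
theorem IsRanking.exists_max (hV : IsRanking n a b Vs ρ) {χ : ℕ → ℕ} {M : ℕ}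
    (hM : champ b M = M) (hχ : ∀ M' ≤ M, champ b M' = M' → χ M' < n) :
    ∃ v < n, (∀ M' ≤ M, champ b M' = M' → idle a b (χ M') ≤ Vs v) ∧
      ∃ M' ≤ M, champ b M' = M' ∧ Vs v = idle a b (χ M') := by
  classical
  obtain ⟨m, hm, h⟩ := Finset.exists_max_image
    ((Finset.range (M + 1)).filter fun M' => champ b M' = M') (fun i => idle a b (χ i))
    ⟨M, by simp [hM]⟩
  simp only [Finset.mem_filter, Finset.mem_range, Nat.lt_succ_iff] at hm h
  have hmn := hχ m hm.1 hm.2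
  refine ⟨ρ (χ m), hV.lt _ hmn, fun M' h₁ h₂ => ?_, m, hm.1, hm.2, hV.eq _ hmn⟩
  rw [hV.eq _ hmn]; exact h M' ⟨h₁, h₂⟩

/-- Not postponing the champion at all gives the least idle time in its block. -/
theorem FeasibleBefore.idle_le {M : ℕ} {x : ℝ} (h : FeasibleBefore n a b Q M x D) {M' : ℕ}
    (hM : M' < M) (hc : champ b M' = M') : idle a b M' ≤ x := by
  obtain ⟨χ, hχ⟩ := h
  obtain ⟨_, h₁, h₂, _⟩ := hχ M' hM hc
  refine (idle_mono ?_ (by rw [h₁, hc])).trans h₂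
  have := champ_le b (χ M'); omega

/-- A choice for the champions before `M`, extended to `M`. -/
theorem FeasibleBefore.extend {M j : ℕ} {x : ℝ} (h : FeasibleBefore n a b Q M x D)
    (hj : j < n) (hjc : champ b j = M) (hx : idle a b j ≤ x) (hD : x + Q j ≤ D) :
    ∃ χ : ℕ → ℕ, ∀ M' ≤ M, champ b M' = M' → χ M' < n ∧ champ b (χ M') = M' ∧
      idle a b (χ M') ≤ x ∧ ∀ M'' ≤ M', champ b M'' = M'' →
        idle a b (χ M'') + Q (χ M') ≤ D := by
  obtain ⟨χ, hχ⟩ := h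
  refine ⟨Function.update χ M j, fun M' hM' hc => ?_⟩
  rcases Nat.lt_or_eq_of_le hM' with hlt | rfl
  · rw [Function.update_of_ne hlt.ne]
    obtain ⟨h₁, h₂, h₃, h₄⟩ := hχ M' hlt hc
    refine ⟨h₁, h₂, h₃, fun M'' h h' => ?_⟩
    rw [Function.update_of_ne (by omega)]
    exact h₄ M'' h h'
  · rw [Function.update_self]
    refine ⟨hj, hjc, hx, fun M'' h h' => ?_⟩
    rcases Nat.lt_or_eq_of_le h with hlt | rfl
    · rw [Function.update_of_ne hlt.ne]
      have := (hχ M'' hlt h').2.2.1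
      linarith
    · rw [Function.update_self]; linarith

theorem IsRanking.feasibleAt_of (hV : IsRanking n a b Vs ρ) (hD : 0 ≤ D) {χ : ℕ → ℕ} {M : ℕ}
    (hM : champ b M = M) (hχ : ∀ M' ≤ M, champ b M' = M' → χ M' < n ∧ champ b (χ M') = M' ∧
      ∀ M'' ≤ M', champ b M'' = M'' → idle a b (χ M'') + Q (χ M') ≤ D) :
    FeasibleAt n a b Q Vs (χ M) D := by
  obtain ⟨v, hv, h₁, M', h₂, h₃, h₄⟩ := hV.exists_max hM fun M' h h' => (hχ M' h h').1
  refine ⟨hD, v, hv, h₁ M le_rfl hM, ⟨χ, fun M' h h' => ?_⟩, ?_⟩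
  · rw [(hχ M le_rfl hM).2.1] at h
    have := hχ M' h.le h'
    exact ⟨this.1, this.2.1, h₁ M' h.le h', this.2.2⟩
  · rw [h₄]; exact (hχ M le_rfl hM).2.2 M' h₂ h₃

theorem IsRanking.feasible_iff (hV : IsRanking n a b Vs ρ) (hab : ∀ i < n, a i < b i)
    (hQ : IsDelayBound n a b Q) (hn : 0 < n) :
    Feasible n a b Q D ↔ ∃ j < n, champ b j = champ b (n - 1) ∧ FeasibleAt n a b Q Vs j D := by
  set M := champ b (n - 1) with hMdef
  have hMc : champ b M = M := champ_champ _ _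
  have hMn : M < n := by have := champ_le b (n - 1); omega
  have hlast : ∀ M' < n, champ b M' = M' → M' ≤ M := fun M' h h' => by
    rw [← h']; exact champ_mono b (by omega)
  constructor
  · rintro ⟨χ, hχ⟩
    obtain ⟨h₁, h₂, h₃⟩ := hχ M hMn hMc
    refine ⟨χ M, h₁, h₂, hV.feasibleAt_of ?_ hMc fun M' h h' => hχ M' (by omega) h'⟩
    -- The requirement `0 ≤ D` in `FeasibleAt` comes for free: moved behind `χ M`, the last champion
    -- cannot end before its own right endpoint.
    have h₄ := h₃ M le_rfl hMc
    have h₅ := ((hQ _ h₁ _).1 le_rfl).1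
    have h₆ := champ_le b (χ M)
    rw [h₂] at h₅ h₆
    have h₇ := idle_mono (a := a) h₆ (by rw [hMc, h₂])
    rw [idle_of_champ hMc] at h₇
    have h₈ := total_mono hab (show M + 1 ≤ χ M + 1 by omega) h₁
    rw [total_succ] at h₈
    linarith
  · rintro ⟨j, hj, hjc, hD, v, _, h₁, h₂, h₃⟩
    rw [hjc] at h₂
    obtain ⟨χ, hχ⟩ := h₂.extend hj hjc h₁ h₃
    refine ⟨χ, fun M' h h' => ?_⟩
    obtain ⟨g₁, g₂, _, g₃⟩ := hχ M' (hlast M' h h') h'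
    exact ⟨g₁, g₂, g₃⟩

/-- Going over to the next champion `r`. -/
theorem IsRanking.feasibleBefore_iff (hV : IsRanking n a b Vs ρ) {r v : ℕ} (hr : r + 1 < n)
    (hrc : champ b (r + 1) = r + 1) (hD : 0 ≤ D) :
    FeasibleBefore n a b Q (r + 1) (Vs v) D ↔ FeasibleBefore n a b Q (champ b r) (Vs v) D ∧
      ∃ j ≤ r, champ b j = champ b r ∧ idle a b j ≤ Vs v ∧ FeasibleAt n a b Q Vs j D := by
  set M := champ b r with hMdef
  have hMc : champ b M = M := champ_champ _ _
  have hMr : M ≤ r := champ_le b r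
  constructor
  · rintro ⟨χ, hχ⟩
    refine ⟨⟨χ, fun M' h => hχ M' (by omega)⟩, χ M, ?_, (hχ M (by omega) hMc).2.1,
      (hχ M (by omega) hMc).2.2.1, hV.feasibleAt_of hD hMc fun M' h h' => ?_⟩
    · by_contra hlt
      have := champ_mono b (show r + 1 ≤ χ M by omega)
      rw [(hχ M (by omega) hMc).2.1] at this
      omega
    · obtain ⟨h₁, h₂, _, h₃⟩ := hχ M' (by omega) h'
      exact ⟨h₁, h₂, h₃⟩
  · rintro ⟨hB, j, hj, hjc, hjv, -, v', hv', h₁, h₂, h₃⟩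
    rw [hjc] at h₂
    have hlast : ∀ M' < r + 1, champ b M' = M' → M' ≤ M := fun M' h h' => by
      rw [← h']; exact champ_mono b (by omega)
    -- `FeasibleAt` comes with a bound `Vs v'` of its own. If `v` has the smaller value, the choice
    -- for `v` can be extended by `j`, as `Vs v + Q j` is only smaller; otherwise the choice for
    -- `v'` also respects the bound of `v`. Hence the cost of the finished block decouples from `v`,
    -- except for the condition on `idle j`.
    rcases le_total (Vs v) (Vs v') with h | h
    · obtain ⟨χ, hχ⟩ := hB.extend (by omega) hjc hjv (show Vs v + Q j ≤ D by linarith)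
      exact ⟨χ, fun M' g g' => hχ M' (hlast M' g g') g'⟩
    · obtain ⟨χ, hχ⟩ := h₂.extend (by omega) hjc h₁ h₃
      refine ⟨χ, fun M' g g' => ?_⟩
      obtain ⟨g₁, g₂, g₃, g₄⟩ := hχ M' (hlast M' g g') g'
      exact ⟨g₁, g₂, g₃.trans h, g₄⟩

/-- `0` and the entries of `A` behind `v` are at most `D`. -/
def TailLe (n : ℕ) (A : ℕ → ℝ) (v : ℕ) (D : ℝ) : Prop := 0 ≤ D ∧ ∀ p, v < p → p ≤ n → A p ≤ D

/-- Raising the entry at `q` imposes the lower bound `lam` on the suffix maxima of all positions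
before `q`: a point update acts as a range update. -/
theorem tailLe_update {A : ℕ → ℝ} {q v : ℕ} (hq : q ≤ n) (lam : ℝ) :
    TailLe n (Function.update A q (max (A q) lam)) v D ↔ TailLe n A v D ∧ (v < q → lam ≤ D) := by
  constructor
  · rintro ⟨h, h'⟩
    refine ⟨⟨h, fun p hp hp' => ?_⟩, fun hv => ?_⟩
    · have := h' p hp hp'
      rcases eq_or_ne p q with rfl | hpq
      · rw [Function.update_self] at this; exact (le_max_left _ _).trans this
      · rwa [Function.update_of_ne hpq] at this
    · have := h' q hv hq
      rw [Function.update_self] at this; exact (le_max_right _ _).trans this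
  · rintro ⟨⟨h, h'⟩, h''⟩
    refine ⟨h, fun p hp hp' => ?_⟩
    rcases eq_or_ne p q with rfl | hpq
    · rw [Function.update_self]; exact max_le (h' p hp hp') (h'' hp)
    · rw [Function.update_of_ne hpq]; exact h' p hp hp'

/-- The meaning of the variables of the dynamic program, after `r + 1` intervals. -/
structure DPInv (n : ℕ) (a b Q Vs : ℕ → ℝ) (r : ℕ) (A : ℕ → ℝ) (lam : ℝ) (lo st : ℕ) : Prop where
  st_lt : st < n
  lo_le : ∀ v < n, (∀ M ≤ r, champ b M = M → idle a b M ≤ Vs v) → lo ≤ v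
  st_le : ∀ v < n, st ≤ v ↔ lo ≤ v ∧ idle a b r ≤ Vs v
  -- From `st` on, all choices of the current block made so far are admissible and better ones may
  -- follow, so the cost of this block is not yet entered. Between `lo` and `st` the later choices
  -- have too much idle time, and the cost of the admissible ones is final.
  high : ∀ v < n, st ≤ v → ∀ D,
    TailLe n A v D ↔ 0 ≤ D ∧ FeasibleBefore n a b Q (champ b r) (Vs v) D
  low : ∀ v, lo ≤ v → v < st → ∀ D, TailLe n A v D ↔ 0 ≤ D ∧
    FeasibleBefore n a b Q (champ b r) (Vs v) D ∧
      ∃ j ≤ r, champ b j = champ b r ∧ idle a b j ≤ Vs v ∧ FeasibleAt n a b Q Vs j D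
  lam_le : ∀ D, lam ≤ D ↔ ∃ j ≤ r, champ b j = champ b r ∧ FeasibleAt n a b Q Vs j D

/-- `L` is the smallest feasible delay when the current champion is moved behind `r`. -/
def IsLocalOpt (n : ℕ) (Q Vs A : ℕ → ℝ) (r st : ℕ) (L : ℝ) : Prop :=
  ∀ D, L ≤ D ↔ ∃ v < n, st ≤ v ∧ TailLe n A v D ∧ Vs v + Q r ≤ D

/-- Positions before `st` can be ignored: any `v` that admits a choice up to `r` has a value at
least the idle time of every champion so far and of `r`. -/
theorem IsRanking.localOpt_iff {A : ℕ → ℝ} {lo st r : ℕ} {L : ℝ}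
    (hL : IsLocalOpt n Q Vs A r st L)
    (lo_le : ∀ v < n, (∀ M ≤ r, champ b M = M → idle a b M ≤ Vs v) → lo ≤ v)
    (st_le : ∀ v < n, st ≤ v ↔ lo ≤ v ∧ idle a b r ≤ Vs v)
    (high : ∀ v < n, st ≤ v → ∀ D,
      TailLe n A v D ↔ 0 ≤ D ∧ FeasibleBefore n a b Q (champ b r) (Vs v) D) :
    L ≤ D ↔ FeasibleAt n a b Q Vs r D := by
  rw [hL]
  constructor
  · rintro ⟨v, hv, hst, h₁, h₂⟩
    obtain ⟨h₃, h₄⟩ := (high v hv hst D).1 h₁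
    exact ⟨h₃, v, hv, ((st_le v hv).1 hst).2, h₄, h₂⟩
  · rintro ⟨hD, v, hv, h₁, h₂, h₃⟩
    have hst : st ≤ v := (st_le v hv).2 ⟨lo_le v hv fun M hM hMc => ?_, h₁⟩
    · exact ⟨v, hv, hst, (high v hv hst D).2 ⟨hD, h₂⟩, h₃⟩
    · have h₄ : M ≤ champ b r := by rw [← hMc]; exact champ_mono b hM
      rcases Nat.lt_or_eq_of_le h₄ with hlt | rfl
      · exact h₂.idle_le hlt hMc
      · exact (idle_mono hM hMc).trans h₁

theorem DPInv.zero (hV : IsRanking n a b Vs ρ) (hn : 0 < n) {A : ℕ → ℝ}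
    (hA : ∀ p ≤ n, A p = 0) {L : ℝ} (hL : IsLocalOpt n Q Vs A 0 (ρ 0) L) :
    DPInv n a b Q Vs 0 A L (ρ 0) (ρ 0) := by
  have h₁ : ∀ v < n, (∀ M ≤ 0, champ b M = M → idle a b M ≤ Vs v) → ρ 0 ≤ v := fun v hv h =>
    (hV.le_iff 0 hn v hv).2 (h 0 le_rfl rfl)
  have h₂ : ∀ v < n, ρ 0 ≤ v ↔ ρ 0 ≤ v ∧ idle a b 0 ≤ Vs v := fun v hv => by
    rw [hV.le_iff 0 hn v hv, and_self]
  have h₃ : ∀ v < n, ρ 0 ≤ v → ∀ D,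
      TailLe n A v D ↔ 0 ≤ D ∧ FeasibleBefore n a b Q (champ b 0) (Vs v) D := by
    intro v _ _ D
    refine and_congr_right fun hD => ⟨fun _ => ⟨id, fun M' h => absurd h (Nat.not_lt_zero _)⟩,
      fun _ p _ hp => by rwa [hA p hp]⟩
  refine ⟨hV.lt 0 hn, h₁, h₂, h₃, fun v h h' => by omega, fun D => ?_⟩
  rw [IsRanking.localOpt_iff hL h₁ h₂ h₃]
  constructor
  · intro h; exact ⟨0, le_rfl, rfl, h⟩
  · rintro ⟨j, hj, _, h⟩; rwa [Nat.le_zero.1 hj] at h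

/-- A new champion closes the block, so the optimum `lam` of the block becomes a constraint at every
position. The extra entry `n`, behind all positions, serves this purpose. -/
theorem DPInv.step_champ (hV : IsRanking n a b Vs ρ) {r : ℕ} (hr : r + 1 < n) {A : ℕ → ℝ}
    {lam : ℝ} {lo st : ℕ} (h : DPInv n a b Q Vs r A lam lo st) (hc : champ b (r + 1) = r + 1)
    {L : ℝ} (hL : IsLocalOpt n Q Vs (Function.update A n (max (A n) lam)) (r + 1)
      (max lo (ρ (r + 1))) L) :
    DPInv n a b Q Vs (r + 1) (Function.update A n (max (A n) lam)) L
      (max lo (ρ (r + 1))) (max lo (ρ (r + 1))) := by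
  have hlo : lo < n := by
    by_contra hlt
    have := ((h.st_le st h.st_lt).1 le_rfl).1
    have := h.st_lt
    omega
  have h₁ : ∀ v < n, (∀ M ≤ r + 1, champ b M = M → idle a b M ≤ Vs v) →
      max lo (ρ (r + 1)) ≤ v := fun v hv h' =>
    max_le (h.lo_le v hv fun M hM => h' M (by omega))
      ((hV.le_iff _ hr v hv).2 (h' _ le_rfl hc))
  have h₂ : ∀ v < n, max lo (ρ (r + 1)) ≤ v ↔
      max lo (ρ (r + 1)) ≤ v ∧ idle a b (r + 1) ≤ Vs v := fun v hv => by
    rw [max_le_iff, hV.le_iff _ hr v hv]; tauto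
  have h₃ : ∀ v < n, max lo (ρ (r + 1)) ≤ v → ∀ D,
      TailLe n (Function.update A n (max (A n) lam)) v D ↔
        0 ≤ D ∧ FeasibleBefore n a b Q (champ b (r + 1)) (Vs v) D := by
    intro v hv hle D
    have hle' := (max_le_iff.1 hle).1
    rw [tailLe_update le_rfl, hc, h.lam_le]
    simp only [hv, forall_true_left]
    by_cases hD : 0 ≤ D
    swap
    · simp [hD, TailLe]
    rw [hV.feasibleBefore_iff hr hc hD]
    by_cases hst : st ≤ v
    · rw [h.high v hv hst]
      have : ∀ j ≤ r, champ b j = champ b r → idle a b j ≤ Vs v := fun j hj hjc =>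
        (idle_mono hj hjc).trans ((h.st_le v hv).1 hst).2
      constructor
      · rintro ⟨⟨g₁, g₂⟩, j, g₃, g₄, g₅⟩
        exact ⟨g₁, g₂, j, g₃, g₄, this j g₃ g₄, g₅⟩
      · rintro ⟨g₁, g₂, j, g₃, g₄, _, g₅⟩
        exact ⟨⟨g₁, g₂⟩, j, g₃, g₄, g₅⟩
    · rw [h.low v hle' (by omega)]
      constructor
      · rintro ⟨g, _⟩; exact g
      · rintro ⟨g₁, g₂, j, g₃, g₄, g₆, g₅⟩
        exact ⟨⟨g₁, g₂, j, g₃, g₄, g₆, g₅⟩, j, g₃, g₄, g₅⟩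
  refine ⟨max_lt hlo (hV.lt _ hr), h₁, h₂, h₃, fun v h h' => by omega, fun D => ?_⟩
  rw [IsRanking.localOpt_iff hL h₁ h₂ h₃]
  constructor
  · intro h; exact ⟨_, le_rfl, rfl, h⟩
  · rintro ⟨j, hj, hjc, h⟩
    have := champ_le b j
    rwa [show j = r + 1 by omega] at h

theorem DPInv.step (hV : IsRanking n a b Vs ρ) {r : ℕ} (hr : r + 1 < n) {A : ℕ → ℝ}
    {lam : ℝ} {lo st : ℕ} (h : DPInv n a b Q Vs r A lam lo st) (hc : champ b (r + 1) ≠ r + 1)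
    {L : ℝ} {st' : ℕ} (hst' : st' = max st (ρ (r + 1)))
    (hL : IsLocalOpt n Q Vs (Function.update A st' (max (A st') lam)) (r + 1) st' L) :
    DPInv n a b Q Vs (r + 1) (Function.update A st' (max (A st') lam)) (min lam L) lo st' := by
  have hc' := champ_succ_eq hc
  have hst'n : st' < n := by rw [hst']; exact max_lt h.st_lt (hV.lt _ hr)
  have hidle : idle a b r ≤ idle a b (r + 1) := idle_mono (by omega) hc'.symm
  have h₁ : ∀ v < n, (∀ M ≤ r + 1, champ b M = M → idle a b M ≤ Vs v) → lo ≤ v :=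
    fun v hv h' => h.lo_le v hv fun M hM => h' M (by omega)
  have h₂ : ∀ v < n, st' ≤ v ↔ lo ≤ v ∧ idle a b (r + 1) ≤ Vs v := fun v hv => by
    rw [hst', max_le_iff, hV.le_iff _ hr v hv, h.st_le v hv]
    constructor
    · rintro ⟨⟨g₁, _⟩, g₂⟩; exact ⟨g₁, g₂⟩
    · rintro ⟨g₁, g₂⟩; exact ⟨⟨g₁, hidle.trans g₂⟩, g₂⟩
  have hle : st ≤ st' := by rw [hst']; exact le_max_left _ _
  have h₃ : ∀ v < n, st' ≤ v → ∀ D,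
      TailLe n (Function.update A st' (max (A st') lam)) v D ↔
        0 ≤ D ∧ FeasibleBefore n a b Q (champ b (r + 1)) (Vs v) D := by
    intro v hv hle' D
    rw [tailLe_update hst'n.le, h.high v hv (by omega), hc']
    exact and_iff_left fun h => by omega
  refine ⟨hst'n, h₁, h₂, h₃, fun v hlo hv D => ?_, fun D => ?_⟩
  · rw [tailLe_update hst'n.le, hc', h.lam_le]
    simp only [hv, forall_true_left]
    have hnot : ¬ idle a b (r + 1) ≤ Vs v := fun h' => by
      have := (h₂ v (by omega)).2 ⟨hlo, h'⟩; omega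
    have key : (∃ j ≤ r + 1, champ b j = champ b r ∧ idle a b j ≤ Vs v ∧
        FeasibleAt n a b Q Vs j D) ↔
        ∃ j ≤ r, champ b j = champ b r ∧ idle a b j ≤ Vs v ∧ FeasibleAt n a b Q Vs j D := by
      constructor
      · rintro ⟨j, hj, g⟩
        rcases Nat.lt_or_eq_of_le hj with hlt | rfl
        · exact ⟨j, by omega, g⟩
        · exact absurd g.2.1 hnot
      · rintro ⟨j, hj, g⟩; exact ⟨j, by omega, g⟩
    rw [key]
    by_cases hst : st ≤ v
    · rw [h.high v (by omega) hst]
      have : ∀ j ≤ r, champ b j = champ b r → idle a b j ≤ Vs v := fun j hj hjc =>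
        (idle_mono hj hjc).trans ((h.st_le v (by omega)).1 hst).2
      constructor
      · rintro ⟨⟨g₁, g₂⟩, j, g₃, g₄, g₅⟩
        exact ⟨g₁, g₂, j, g₃, g₄, this j g₃ g₄, g₅⟩
      · rintro ⟨g₁, g₂, j, g₃, g₄, _, g₅⟩
        exact ⟨⟨g₁, g₂⟩, j, g₃, g₄, g₅⟩
    · rw [h.low v hlo (by omega)]
      constructor
      · rintro ⟨g, _⟩; exact g
      · rintro ⟨g₁, g₂, j, g₃, g₄, g₆, g₅⟩
        exact ⟨⟨g₁, g₂, j, g₃, g₄, g₆, g₅⟩, j, g₃, g₄, g₅⟩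
  · rw [min_le_iff, IsRanking.localOpt_iff hL h₁ h₂ h₃, h.lam_le, hc']
    constructor
    · rintro (⟨j, hj, g⟩ | g)
      · exact ⟨j, by omega, g⟩
      · exact ⟨r + 1, le_rfl, hc', g⟩
    · rintro ⟨j, hj, g⟩
      rcases Nat.lt_or_eq_of_le hj with hlt | rfl
      · exact Or.inl ⟨j, by omega, g⟩
      · exact Or.inr g.2

/-- The result of the dynamic program. -/
theorem DPInv.lam_le_iff_feasible (hV : IsRanking n a b Vs ρ) (hab : ∀ i < n, a i < b i)
    (hQ : IsDelayBound n a b Q) (hn : 0 < n) {A : ℕ → ℝ} {lam : ℝ} {lo st : ℕ}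
    (h : DPInv n a b Q Vs (n - 1) A lam lo st) (D : ℝ) : lam ≤ D ↔ Feasible n a b Q D := by
  rw [h.lam_le, hV.feasible_iff hab hQ hn]
  exact exists_congr fun j => and_congr_left fun _ => by omega

/-- The local optimum from the first position `x` where `Vs x + Q r` exceeds the tail of `A`. -/
theorem isLocalOpt_of {A : ℕ → ℝ} {r st x : ℕ} {acc acc' : ℝ}
    (hVs : ∀ v < n, ∀ u ≤ v, Vs u ≤ Vs v) (hst : st < n)
    (hacc : ∀ D, acc ≤ D ↔ TailLe n A x D) (hacc' : 0 < x → ∀ D, acc' ≤ D ↔ TailLe n A (x - 1) D)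
    (hx : x < n → acc ≤ Vs x + Q r) (hx' : 0 < x → x - 1 < n ∧ Vs (x - 1) + Q r ≤ acc') :
    (x ≤ st → IsLocalOpt n Q Vs A r st (Vs st + Q r)) ∧
    (st < x → x < n → IsLocalOpt n Q Vs A r st (min acc' (Vs x + Q r))) ∧
    (st < x → ¬ x < n → IsLocalOpt n Q Vs A r st acc') := by
  -- The tail decreases and `Vs v + Q r` increases with `v`. So the least maximum of both is
  -- attained at the crossing point `x` or just before it, and at `st` if the crossing is not beyond
  -- `st`.
  have anti : ∀ {u v D}, u ≤ v → TailLe n A u D → TailLe n A v D := fun huv h =>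
    ⟨h.1, fun p hp hp' => h.2 p (by omega) hp'⟩
  refine ⟨fun h D => ⟨fun hD => ⟨st, hst, le_rfl, ?_, hD⟩, ?_⟩, fun h h' D => ?_, fun h h' D => ?_⟩
  · refine anti h ((hacc D).1 ?_)
    have := hx (by omega)
    have := hVs st hst x h
    linarith
  · rintro ⟨v, hv, hv', _, h₂⟩
    have := hVs v hv st hv'
    linarith
  · obtain ⟨g₁, g₂⟩ := hx' (by omega)
    rw [min_le_iff]
    constructor
    · rintro (hD | hD)
      · exact ⟨x - 1, g₁, by omega, (hacc' (by omega) D).1 hD, g₂.trans hD⟩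
      · exact ⟨x, h', h.le, (hacc D).1 ((hx h').trans hD), hD⟩
    · rintro ⟨v, hv, _, h₁, h₂⟩
      rcases Nat.lt_or_ge v x with hvx | hvx
      · exact Or.inl ((hacc' (by omega) D).2 (anti (by omega) h₁))
      · have := hVs v hv x hvx
        exact Or.inr (by linarith)
  · obtain ⟨g₁, g₂⟩ := hx' (by omega)
    constructor
    · intro hD
      exact ⟨x - 1, g₁, by omega, (hacc' (by omega) D).1 hD, g₂.trans hD⟩
    · rintro ⟨v, hv, _, h₁, h₂⟩
      exact (hacc' (by omega) D).2 (anti (by omega) h₁)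

end IntervalSeparation

namespace IntervalSeparation

/-! ### Constructing a schedule -/

variable {n : ℕ} {a b Q : ℕ → ℝ} {D : ℝ} {χ : ℕ → ℕ}

/-- The intervals in `E` have been scheduled before time `C`. -/
structure Emitted (a b : ℕ → ℝ) (E : Set ℕ) (C : ℝ) (s : ℕ → ℝ) : Prop where
  le : ∀ i ∈ E, a i ≤ s i
  end_le : ∀ i ∈ E, s i + (b i - a i) ≤ C
  disj : ∀ i ∈ E, ∀ j ∈ E, i ≠ j → s i + (b i - a i) ≤ s j ∨ s j + (b j - a j) ≤ s i

theorem Emitted.emit {E E' : Set ℕ} {C : ℝ} {s : ℕ → ℝ} (h : Emitted a b E C s) {i : ℕ}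
    (hi : a i < b i) (hE : ∀ j ∈ E', j = i ∨ j ≠ i ∧ j ∈ E) :
    Emitted a b E' (max C (a i) + (b i - a i)) (Function.update s i (max C (a i))) where
  le j hj := by
    rcases hE j hj with rfl | ⟨hji, hj⟩
    · rw [Function.update_self]; exact le_max_right _ _
    · rw [Function.update_of_ne hji]; exact h.le j hj
  end_le j hj := by
    rcases hE j hj with rfl | ⟨hji, hj⟩
    · rw [Function.update_self]
    · rw [Function.update_of_ne hji]
      have := h.end_le j hj
      have := le_max_left C (a i)
      linarith
  disj j hj k hk hjk := by
    rcases hE j hj with rfl | ⟨hji, hj⟩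
    · rcases hE k hk with rfl | ⟨hki, hk⟩
      · exact absurd rfl hjk
      · rw [Function.update_self, Function.update_of_ne hki]
        exact Or.inr ((h.end_le k hk).trans (le_max_left _ _))
    · rcases hE k hk with rfl | ⟨hki, hk⟩
      · rw [Function.update_self, Function.update_of_ne hji]
        exact Or.inl ((h.end_le j hj).trans (le_max_left _ _))
      · rw [Function.update_of_ne hki, Function.update_of_ne hji]
        exact h.disj j hj k hk hjk

/-- The state of the construction after interval `r`. The interval `pend` is held back, the others
have been scheduled; `dn` tells whether it is decided behind which interval the current
champion is moved, and `fl` whether that is `r`. -/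
structure EmitInv (n : ℕ) (a b Q : ℕ → ℝ) (D : ℝ) (χ : ℕ → ℕ) (r R : ℕ) (C c : ℝ)
    (fl dn pend : ℕ) (s : ℕ → ℝ) : Prop where
  pend_le : pend ≤ r
  champ_pend : champ b pend = champ b r
  emitted : Emitted a b {i | i ≤ r ∧ i ≠ pend} C s
  -- `c` is the largest idle time caused so far. The greedy choice never comes later than `χ`, so
  -- `c` is dominated by an idle time of `χ`.
  c_le : ∃ M ≤ champ b r, champ b M = M ∧ c ≤ idle a b (χ M)
  -- `R` is the next index behind which the champion may be moved: `r` before the test at `r`, and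
  -- `r + 1` after it. Intervals that overtake the undecided champion need no delay bound yet, hence
  -- the alternative `champ b r < i`.
  undone : dn = 0 → fl = 0 ∧ pend = champ b r ∧ R ≤ χ (champ b r) ∧
    max C (a pend) ≤ total a b (r + 1) - (b pend - a pend) + max c (idle a b r) ∧
    ∀ i ≤ r, i ≠ pend → s i ≤ a i + D ∨ champ b r < i
  done : dn ≠ 0 → max C (a pend) + (b pend - a pend) ≤ total a b (r + 1) + c ∧
    max C (a pend) ≤ a pend + D ∧ (∀ i ≤ r, i ≠ pend → s i ≤ a i + D) ∧
    ∃ r₀ ≤ r, champ b r₀ = champ b r ∧ c + Q r₀ ≤ D ∧ (fl ≠ 0 → r = r₀ ∧ pend = champ b r) ∧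
      (fl = 0 → r₀ < pend ∧ (∀ k, r₀ < k → k ≤ r → b k ≤ b pend) ∧ b (champ b r) ≤ C)

/-- `χ` witnesses feasibility. -/
def IsChoice (n : ℕ) (a b Q : ℕ → ℝ) (D : ℝ) (χ : ℕ → ℕ) : Prop :=
  ∀ M < n, champ b M = M → χ M < n ∧ champ b (χ M) = M ∧
    ∀ M' ≤ M, champ b M' = M' → idle a b (χ M') + Q (χ M) ≤ D

theorem EmitInv.zero (h : IsChoice n a b Q D χ) (hn : 0 < n) (s : ℕ → ℝ) :
    EmitInv n a b Q D χ 0 0 (a 0) (idle a b 0) 0 0 0 s where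
  pend_le := le_rfl
  champ_pend := rfl
  emitted := ⟨fun i hi => absurd (Nat.le_zero.1 hi.1) hi.2,
    fun i hi => absurd (Nat.le_zero.1 hi.1) hi.2, fun i hi => absurd (Nat.le_zero.1 hi.1) hi.2⟩
  c_le := ⟨0, le_rfl, rfl, idle_mono (Nat.zero_le _) (h 0 hn rfl).2.1.symm⟩
  undone _ := ⟨rfl, rfl, Nat.zero_le _, by simp [total, idle],
    fun i hi hi' => absurd (Nat.le_zero.1 hi) hi'⟩
  done h := absurd rfl h

/-- Deciding to move the current champion behind `r`. -/
theorem EmitInv.decide (hQ : IsDelayBound n a b Q) (hab : ∀ i < n, a i < b i)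
    (ha : ∀ j < n, ∀ i ≤ j, a i ≤ a j) (hχ : IsChoice n a b Q D χ) {r : ℕ} (hr : r < n) {C c : ℝ}
    {pend : ℕ} {s : ℕ → ℝ} (h : EmitInv n a b Q D χ r r C c 0 0 pend s)
    (hD : max c (idle a b r) + Q r ≤ D) :
    EmitInv n a b Q D χ r (r + 1) C (max c (idle a b r)) 1 1 pend s := by
  obtain ⟨_, h₁, h₂, h₃, h₄⟩ := h.undone rfl
  have hMn : champ b r < n := (champ_le b r).trans_lt hr
  have hMab := hab _ hMn
  have hstart : max C (a pend) ≤ a pend + D := by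
    have := ((hQ r hr (D - max c (idle a b r))).1 (by linarith)).1
    rw [← h₁] at this
    linarith
  refine ⟨h.pend_le, h.champ_pend, h.emitted, ?_, fun h => by omega, fun _ => ⟨?_, hstart,
    fun i hi hi' => ?_, r, le_rfl, rfl, hD, fun _ => ⟨rfl, h₁⟩, fun h => by omega⟩⟩
  · obtain ⟨M, hM, hMc, hc⟩ := h.c_le
    rcases le_total (idle a b r) c with h' | h'
    · exact ⟨M, hM, hMc, by rwa [max_eq_left h']⟩
    · refine ⟨champ b r, le_rfl, champ_champ _ _, ?_⟩
      rw [max_eq_right h']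
      exact idle_mono h₂ (hχ _ hMn (champ_champ _ _)).2.1.symm
  · linarith
  · rcases h₄ i hi hi' with h' | h'
    · exact h'
    -- An interval that overtook the champion starts before it and has no smaller left endpoint, so
    -- its delay is at most that of the champion.
    · have g₁ := h.emitted.end_le i ⟨hi, hi'⟩
      have g₂ := hab i (by omega)
      have g₃ := ha i (by omega) pend (by omega)
      have := le_max_left C (a pend)
      linarith

/-- Not moving the current champion behind `r`. -/
theorem EmitInv.skip (hχ : IsChoice n a b Q D χ) {r : ℕ} (hr : r < n) {C c : ℝ}
    {pend : ℕ} {s : ℕ → ℝ} (h : EmitInv n a b Q D χ r r C c 0 0 pend s)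
    (hD : ¬ max c (idle a b r) + Q r ≤ D) :
    EmitInv n a b Q D χ r (r + 1) C c 0 0 pend s := by
  obtain ⟨h₀, h₁, h₂, h₃, h₄⟩ := h.undone rfl
  refine ⟨h.pend_le, h.champ_pend, h.emitted, h.c_le, fun _ => ⟨h₀, h₁, ?_, h₃, h₄⟩, h.done⟩
  rcases Nat.lt_or_eq_of_le h₂ with hlt | heq
  · exact hlt
  -- If `r` is the choice of `χ`, the test cannot fail: both `c` and `idle r` are at most idle times
  -- of `χ`, and these satisfy the criterion together with `Q r`.
  · exfalso
    have hMn : champ b r < n := (champ_le b r).trans_lt hr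
    obtain ⟨M, hM, hMc, hc⟩ := h.c_le
    have h₅ := (hχ _ hMn (champ_champ _ _)).2.2 M hM hMc
    have h₆ := (hχ _ hMn (champ_champ _ _)).2.2 _ le_rfl (champ_champ _ _)
    rw [← heq] at h₅ h₆
    apply hD
    rcases max_choice c (idle a b r) with h' | h' <;> rw [h'] <;> linarith

theorem EmitInv.of_done {r R R' : ℕ} {C c : ℝ} {fl dn pend : ℕ} {s : ℕ → ℝ}
    (h : EmitInv n a b Q D χ r R C c fl dn pend s) (hdn : dn ≠ 0) :
    EmitInv n a b Q D χ r R' C c fl dn pend s :=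
  ⟨h.pend_le, h.champ_pend, h.emitted, h.c_le, fun h => absurd h hdn, h.done⟩

/-- Scheduling the interval held back, and holding back `r + 1` instead. -/
theorem EmitInv.emit_pend (hQ : IsDelayBound n a b Q) (hab : ∀ i < n, a i < b i)
    (hχ : IsChoice n a b Q D χ) {r : ℕ} (hr : r + 1 < n) {C c : ℝ} {fl dn pend : ℕ} {s : ℕ → ℝ}
    (h : EmitInv n a b Q D χ r (r + 1) C c fl dn pend s) (hfl : fl ≠ 0 ∨ b pend ≤ b (r + 1))
    {dn' : ℕ} (hdn₁ : champ b (r + 1) = r + 1 → dn' = 0)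
    (hdn₂ : champ b (r + 1) ≠ r + 1 → dn' = dn) :
    EmitInv n a b Q D χ (r + 1) (r + 1) (max C (a pend) + (b pend - a pend)) c 0 dn' (r + 1)
      (Function.update s pend (max C (a pend))) := by
  have hpend := h.pend_le
  have hpab := hab pend (by omega)
  have hMn : champ b r < n := (champ_le b r).trans_lt (by omega)
  have hrab := hab (r + 1) hr
  have hC₁ := le_max_left C (a pend)
  have hC₂ := le_max_right C (a pend)
  have hem := h.emitted.emit (E' := {i | i ≤ r + 1 ∧ i ≠ r + 1}) hpab fun j hj => by
    by_cases hjp : j = pend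
    · exact Or.inl hjp
    · exact Or.inr ⟨hjp, by have := hj.1; have := hj.2; omega, hjp⟩
  -- An undecided champion is given up only to a new champion `r + 1`; but then `χ` of the old one
  -- lies in its block, at most at `r`, although all indices up to `r` have been tested.
  have hdone : dn ≠ 0 := by
    intro h0
    obtain ⟨h₁, h₂, h₃, _⟩ := h.undone h0
    rcases hfl with h' | h'
    · exact h' h₁
    · rw [h₂] at h'
      have h₄ := champ_succ_eq_self_iff.2 h'
      have h₅ := (hχ _ hMn (champ_champ _ _)).2.1
      have := champ_mono b h₃
      have := champ_le b r
      omega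
  obtain ⟨h₁, h₂, h₃, r₀, hr₀, hr₀c, h₄, h₅, h₆⟩ := h.done hdone
  have hdelay : ∀ i ≤ r + 1, i ≠ r + 1 →
      Function.update s pend (max C (a pend)) i ≤ a i + D := by
    intro i hi hi'
    by_cases hip : i = pend
    · subst hip; rwa [Function.update_self]
    · rw [Function.update_of_ne hip]; exact h₃ i (by omega) hip
  by_cases hc : champ b (r + 1) = r + 1
  · have hidle := idle_of_champ (a := a) hc
    refine ⟨le_rfl, rfl, hem, ?_, fun _ => ⟨rfl, hc.symm, ?_, ?_, fun i hi hi' =>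
      Or.inl (hdelay i hi hi')⟩, fun h' => absurd (hdn₁ hc) h'⟩
    · obtain ⟨M, hM, g⟩ := h.c_le
      exact ⟨M, hM.trans (champ_mono b (by omega)), g⟩
    · rw [hc]
      have := (hχ _ hr hc).2.1
      have := champ_le b (χ (r + 1))
      omega
    · rw [total_succ a b (r + 1), add_sub_cancel_right]
      refine max_le ?_ ?_
      · have := le_max_left c (idle a b (r + 1)); linarith
      · have := le_max_right c (idle a b (r + 1)); linarith
  · have hce := champ_succ_eq hc
    have hlt : b (r + 1) < b (champ b r) := not_le.1 (mt champ_succ_eq_self_iff.2 hc)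
    -- the champion has been scheduled
    have hMC : b (champ b r) ≤ max C (a pend) + (b pend - a pend) := by
      by_cases h0 : fl = 0
      · have := (h₆ h0).2.2; linarith
      · rw [← (h₅ h0).2]; linarith
    have hmax : max (max C (a pend) + (b pend - a pend)) (a (r + 1)) =
        max C (a pend) + (b pend - a pend) := max_eq_left (by linarith)
    have hbig : ∀ k, r₀ < k → k ≤ r + 1 → b k ≤ b (r + 1) := by
      intro k hk hk'
      rcases Nat.lt_or_eq_of_le hk' with hk'' | rfl
      · by_cases h0 : fl = 0
        · exact ((h₆ h0).2.1 k hk (by omega)).trans (hfl.resolve_left (fun h => h h0))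
        · have := (h₅ h0).1; omega
      · exact le_rfl
    refine ⟨le_rfl, rfl, hem, by rw [hce]; exact h.c_le,
      fun h' => absurd ((hdn₂ hc).symm.trans h') hdone, fun _ => ⟨?_, ?_, hdelay, r₀, by omega,
        by rw [hce, hr₀c], h₄, fun h => absurd rfl h, fun _ => ⟨by omega, hbig, by rwa [hce]⟩⟩⟩
    · rw [hmax, total_succ a b (r + 1)]; linarith
    · rw [hmax]
      -- The delay bound speaks of some `k` behind `r₀`; `r + 1` has the largest right endpoint
      -- there and can replace it.
      obtain ⟨k, hk, hk', hk''⟩ := ((hQ r₀ (by omega) (D - c)).1 (by linarith)).2 (r + 1)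
        (by omega) hr (by rw [hce, hr₀c])
      have := hbig k hk hk'
      rw [total_succ a b (r + 1)] at hk''
      linarith

/-- Scheduling `r + 1` immediately. -/
theorem EmitInv.emit_new (hQ : IsDelayBound n a b Q) (hab : ∀ i < n, a i < b i)
    (ha : ∀ j < n, ∀ i ≤ j, a i ≤ a j) {r : ℕ} (hr : r + 1 < n) {C c : ℝ} {dn pend : ℕ} {s : ℕ → ℝ}
    (h : EmitInv n a b Q D χ r (r + 1) C c 0 dn pend s) (hb : b (r + 1) < b pend) :
    champ b (r + 1) ≠ r + 1 ∧
    EmitInv n a b Q D χ (r + 1) (r + 1) (max C (a (r + 1)) + (b (r + 1) - a (r + 1))) c 0 dn pend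
      (Function.update s (r + 1) (max C (a (r + 1)))) := by
  have hpend := h.pend_le
  have hrab := hab (r + 1) hr
  have hpr := ha (r + 1) hr pend (by omega)
  have hlt : b (r + 1) < b (champ b r) := hb.trans_le (le_champ b hpend)
  have hc : champ b (r + 1) ≠ r + 1 := mt champ_succ_eq_self_iff.1 (not_le.2 hlt)
  have hce := champ_succ_eq hc
  have htot := total_succ a b (r + 1)
  have hem := h.emitted.emit (E' := {i | i ≤ r + 1 ∧ i ≠ pend}) hrab fun j hj => by
    by_cases hjp : j = r + 1
    · exact Or.inl hjp
    · exact Or.inr ⟨hjp, by have := hj.1; omega, hj.2⟩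
  have hC := le_max_left C (a (r + 1))
  have hC' := le_max_right C (a (r + 1))
  have hmax : max (max C (a (r + 1)) + (b (r + 1) - a (r + 1))) (a pend) =
      max C (a (r + 1)) + (b (r + 1) - a (r + 1)) := max_eq_left (by linarith)
  refine ⟨hc, by omega, by rw [hce, h.champ_pend], hem, by rw [hce]; exact h.c_le,
    fun h0 => ?_, fun h0 => ?_⟩
  · obtain ⟨_, h₁, h₂, h₃, h₄⟩ := h.undone h0
    rw [hce]
    refine ⟨rfl, h₁, h₂, ?_, fun i hi hi' => ?_⟩
    -- The overtaking interval starts at `C` or at its left endpoint; the two cases correspond to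
    -- the two terms of the maximum defining `idle (r + 1)`.
    · rw [hmax, htot, idle_succ hc, ← h₁]
      rw [max_le_iff] at h₃
      have g₁ := le_max_right c (max (idle a b r)
        (a (r + 1) - total a b (r + 1) + (b pend - a pend)))
      have g₂ := le_max_left c (max (idle a b r)
        (a (r + 1) - total a b (r + 1) + (b pend - a pend)))
      have g₃ := le_max_right (idle a b r) (a (r + 1) - total a b (r + 1) + (b pend - a pend))
      have g₄ := le_max_left (idle a b r) (a (r + 1) - total a b (r + 1) + (b pend - a pend))
      have g₅ : max c (idle a b r) ≤ max c (max (idle a b r)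
        (a (r + 1) - total a b (r + 1) + (b pend - a pend))) := max_le_max le_rfl g₄
      have : max C (a (r + 1)) ≤ total a b (r + 1) - (b pend - a pend) + max c (max (idle a b r)
        (a (r + 1) - total a b (r + 1) + (b pend - a pend))) := max_le (by linarith) (by linarith)
      linarith
    · by_cases hir : i = r + 1
      · have := champ_le b r
        right; omega
      · rw [Function.update_of_ne hir]; exact h₄ i (by omega) hi'
  · obtain ⟨h₁, h₂, h₃, r₀, hr₀, hr₀c, h₄, h₅, h₆⟩ := h.done h0
    obtain ⟨h₇, h₈, h₉⟩ := h₆ rfl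
    -- The champion has ended, at its right endpoint or later, so both `r + 1` and the interval held
    -- back are already released and no idle time arises.
    have e₁ : max C (a (r + 1)) = C := max_eq_left (by linarith)
    have e₂ : max C (a pend) = C := max_eq_left (by linarith)
    have hbig : ∀ k, r₀ < k → k ≤ r + 1 → b k ≤ b pend := by
      intro k hk hk'
      rcases Nat.lt_or_eq_of_le hk' with hk'' | rfl
      · exact h₈ k hk (by omega)
      · exact hb.le
    rw [hmax, e₁]
    rw [e₂] at h₁ h₂
    refine ⟨by rw [htot]; linarith, ?_, fun i hi hi' => ?_, r₀, by omega, by rw [hce, hr₀c], h₄,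
      fun h => absurd rfl h, fun _ => ⟨h₇, hbig, by rw [hce]; linarith⟩⟩
    · obtain ⟨k, hk, hk', hk''⟩ := ((hQ r₀ (by omega) (D - c)).1 (by linarith)).2 (r + 1)
        (by omega) hr (by rw [hce, hr₀c])
      have := hbig k hk hk'
      rw [htot] at hk''
      linarith
    · by_cases hir : i = r + 1
      · rw [hir, Function.update_self]; linarith
      · rw [Function.update_of_ne hir]; exact h₃ i (by omega) hi'

/-- Scheduling the last interval. -/
theorem EmitInv.final (hab : ∀ i < n, a i < b i) (hχ : IsChoice n a b Q D χ) (hn : 0 < n)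
    {C c : ℝ} {fl dn pend : ℕ} {s : ℕ → ℝ}
    (h : EmitInv n a b Q D χ (n - 1) n C c fl dn pend s) :
    IsSchedule n a b D (Function.update s pend (max C (a pend))) := by
  have hpend := h.pend_le
  have hem := h.emitted.emit (E' := {i | i < n}) (hab pend (by omega)) fun j hj => by
    by_cases hjp : j = pend
    · exact Or.inl hjp
    · exact Or.inr ⟨hjp, by have : j < n := hj; omega, hjp⟩
  have hdone : dn ≠ 0 := by
    intro h0
    obtain ⟨_, _, h₃, _⟩ := h.undone h0
    have := (hχ _ ((champ_le b (n - 1)).trans_lt (by omega)) (champ_champ _ _)).1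
    omega
  obtain ⟨_, h₂, h₃, _⟩ := h.done hdone
  refine ⟨hem.le, fun i hi => ?_, hem.disj⟩
  by_cases hip : i = pend
  · rw [hip, Function.update_self]; exact h₂
  · rw [Function.update_of_ne hip]; exact h₃ i (by omega) hip

end IntervalSeparation

namespace RealRAM

/-! ### Loops -/

/-- Do nothing. -/
def nop : Cmd := .wset 30 (wc 0)

/-- Loop rule, with a potential `φ` that bounds the number of ticks that remain. -/
theorem WP.while_potential {n B : ℕ} {b : BExp} {c : Cmd} {s₀ : Store} (Inv : ℕ → Store → Prop)
    {φ₀ : ℕ} (h₀ : Inv φ₀ s₀)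
    (hb : ∀ φ s, Inv φ s → Frame c s₀ s → b.ok n B s ∧
      (b.eval s → WP n B c s fun t s' => ∃ φ', Inv φ' s' ∧ t + 1 + φ' ≤ φ)) :
    WP n B (.while b c) s₀ fun t s' =>
      ∃ φ, Inv φ s' ∧ ¬ b.eval s' ∧ Frame (.while b c) s₀ s' ∧ t + φ ≤ φ₀ + 1 := by
  suffices ∀ φ s, Inv φ s → Frame c s₀ s → WP n B (.while b c) s fun t s' =>
      ∃ φ', Inv φ' s' ∧ ¬ b.eval s' ∧ t + φ' ≤ φ + 1 by
    obtain ⟨t, s', h, φ, h₁, h₂, h₃⟩ := this _ _ h₀ (.refl _ _)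
    exact ⟨t, s', h, φ, h₁, h₂, h.frame, h₃⟩
  intro φ
  induction φ using Nat.strong_induction_on with
  | _ φ ih =>
    intro s hI hF
    obtain ⟨hok, hw⟩ := hb φ s hI hF
    by_cases h : b.eval s
    · obtain ⟨t, s', he, φ', hI', ht⟩ := hw h
      obtain ⟨t', s'', he', φ'', hI'', hn, ht'⟩ := ih φ' (by omega) s' hI' (hF.trans he.frame)
      exact ⟨_, _, .while_true _ _ _ _ _ _ _ hok h he he', φ'', hI'', hn, by omega⟩
    · exact ⟨_, _, .while_false _ _ _ hok h, φ, hI, h, by omega⟩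

/-- Repeat `c`, counting up the register `d`, while it is smaller than the register `0`. -/
def forLoop (d : ℕ) (c : Cmd) : Cmd :=
  .while (.wlt (wr d) (wr 0)) (c ;; .wset d (wr d + wc 1))

/-- Each round costs two ticks beyond the body, for the test and the increment. The counter may
start above `n`, hence the conditional form of its final value. -/
theorem WP.forLoop {n B : ℕ} (hB : 66 * n + 1200 ≤ B) {d : ℕ} {c : Cmd} {s₀ : Store} (T : ℕ)
    (Inv : Store → Prop) (hd : d ≠ 0) (hcd : c.writesW d = false) (hc0 : c.writesW 0 = false)
    (h0 : s₀.w 0 = n) (h₀ : Inv s₀)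
    (hb : ∀ s, Inv s → Frame (RealRAM.forLoop d c) s₀ s → s.w 0 = n → s.w d < n →
      WP n B c s fun t s' => t ≤ T ∧ Inv (s'.setW d (s.w d + 1))) :
    WP n B (RealRAM.forLoop d c) s₀ fun t s' =>
      Inv s' ∧ n ≤ s'.w d ∧ (s₀.w d ≤ n → s'.w d = n) ∧ Frame (RealRAM.forLoop d c) s₀ s' ∧
        t ≤ (T + 2) * (n - s₀.w d) + 1 := by
  refine (WP.while (fun s => Inv s ∧ (s₀.w d ≤ n → s.w d ≤ n)) (fun s => (T + 2) * (n - s.w d))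
    ⟨h₀, id⟩ ?_).mono ?_
  · rintro s ⟨hI, hle⟩ hF
    have hw0 : s.w 0 = n := by
      rw [hF.w 0 (by simp [Cmd.writesW, hc0, hd.symm]), h0]
    refine ⟨by simp, fun h => ?_⟩
    simp only [BExp.eval, WExp.eval, hw0] at h
    rw [wp_seq]
    refine (hb s hI ⟨hF.w, hF.r, hF.A, hF.F⟩ hw0 h).frame.mono ?_
    rintro t s' ⟨⟨ht, hI'⟩, hF'⟩
    have hwd : s'.w d = s.w d := hF'.w d hcd
    rw [wp_wset]
    simp only [WExp.eval, Op.wval, hwd]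
    refine ⟨by simp [hwd]; omega, ⟨hI', fun _ => by simp; omega⟩, ?_⟩
    obtain ⟨e, he⟩ : ∃ e, n - s.w d = e + 1 := ⟨n - s.w d - 1, by omega⟩
    simp only [Store.setW_w, if_true]
    rw [he, show n - (s.w d + 1) = e by omega, Nat.mul_succ]
    omega
  · rintro t s' ⟨⟨hI, hle⟩, h, hF, ht⟩
    have hw0 : s'.w 0 = n := by
      rw [hF.w 0 (by simp [Cmd.writesW, hc0, hd.symm]), h0]
    simp only [BExp.eval, WExp.eval, hw0] at h
    exact ⟨hI, by omega, fun h' => by have := hle h'; omega, hF, ht⟩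

/-! ### Reading the input -/

/-- Copy the endpoints to the arrays `0` and `1`. -/
def load : Cmd :=
  .wset 2 (wc 32) ;;
  forLoop 2 (.fset 0 (wr 2) (ra 16 (wr 2 + wr 2)) ;; .fset 1 (wr 2) (ra 16 (wr 2 + wr 2 + wc 1)))

/-- Find a power of two larger than the number of intervals. -/
def findSize : Cmd :=
  .wset 1 (wc 1) ;; .while (.wlt (wr 1) (wr 0 + wc 1)) (.wset 1 (wr 1 + wr 1))

section

variable {n B : ℕ} (hB : 66 * n + 1200 ≤ B)
include hB

/-- The endpoints of the first 32 intervals arrive in the 64 cells used as registers and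
temporaries. They have been rescued into the arrays beforehand, so the loop starts at 32. -/
theorem load_spec {s : Store} {α β : ℕ → ℝ} (h0 : s.w 0 = n)
    (h₁ : ∀ i < 32, i < n → s.F 0 i = α i ∧ s.F 1 i = β i)
    (h₂ : ∀ i, 32 ≤ i → i < n → s.F 16 (i + i) = α i ∧ s.F 16 (i + i + 1) = β i) :
    WP n B load s fun t s' => t ≤ 4 * n + 2 ∧ ∀ i < n, s'.F 0 i = α i ∧ s'.F 1 i = β i := by
  rw [load, wp_seq, wp_wset]
  refine ⟨by simp, (WP.forLoop hB 2 (fun s' => 32 ≤ s'.w 2 ∧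
    ∀ i < s'.w 2, i < n → s'.F 0 i = α i ∧ s'.F 1 i = β i) (by norm_num) rfl rfl
    (by simp [h0]) ?_ ?_).mono ?_⟩
  · simpa using h₁
  · rintro s' ⟨g₀, g₁⟩ hF hw0 hlt
    have hF16 : s'.F 16 = s.F 16 := by rw [hF.F 16 rfl]; simp
    simp [Function.update_apply]
    refine ⟨by omega, by omega, by omega, fun i hi hin => ?_⟩
    split_ifs with hi2
    · rw [hi2, hF16]; exact h₂ _ g₀ hlt
    · exact g₁ i (by omega) hin
  · rintro t s' ⟨⟨_, g₁⟩, g₂, _, _, ht⟩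
    simp at ht
    exact ⟨by omega, fun i hi => g₁ i (by omega) hi⟩

/-- At least `n + 1` leaves are needed because the dynamic program uses the positions `0, …, n`. -/
theorem findSize_spec {s : Store} (h0 : s.w 0 = n) :
    WP n B findSize s fun t s' => t ≤ 2 * n + 2 ∧ ∃ h, s'.w 1 = 2 ^ h ∧ n + 1 ≤ 2 ^ h ∧
      2 ^ h ≤ 2 * n + 1 := by
  rw [findSize, wp_seq, wp_wset]
  refine ⟨by simp, (WP.while (fun s' => (∃ h, s'.w 1 = 2 ^ h) ∧ 1 ≤ s'.w 1 ∧
    s'.w 1 ≤ 2 * n + 1) (fun s' => 2 * (n + 1 - s'.w 1)) ?_ ?_).mono ?_⟩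
  · simp; exact ⟨0, rfl⟩
  · rintro s' ⟨⟨h, hh⟩, g₁, g₂⟩ hF
    have hw0 : s'.w 0 = n := by rw [hF.w 0 rfl]; simp [h0]
    simp [hw0]
    exact ⟨by omega, fun hlt => ⟨by omega, ⟨⟨h + 1, by rw [hh]; ring⟩, by omega, by omega⟩,
      by omega⟩⟩
  · rintro t s' ⟨⟨⟨h, hh⟩, g₁, g₂⟩, hb, hF, ht⟩
    have hw0 : s'.w 0 = n := by rw [hF.w 0 rfl]; simp [h0]
    simp [hw0] at hb ht
    exact ⟨by omega, h, hh, by omega, by omega⟩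

end

end RealRAM

open IntervalSeparation

namespace RealRAM

/-! ### Right endpoints, champions and idle times -/

/-- Arrange the endpoints in the order of the array `1`. -/
def arrange : Cmd :=
  .wset 2 (wc 0) ;;
  forLoop 2 (.fset 2 (wr 2) (ra 0 (wa 1 (wr 2))) ;; .fset 3 (wr 2) (ra 1 (wa 1 (wr 2))))

/-- Compute the total lengths, the champions and the idle times. -/
def forward : Cmd :=
  .rset 0 (rc 0) ;; .rset 1 (ra 3 (wc 0)) ;; .wset 2 (wc 0) ;;
  forLoop 2
    (.fset 4 (wr 2) (rr 0) ;; .rset 4 (ra 2 (wr 2)) ;; .rset 5 (ra 3 (wr 2)) ;;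
      .ite (.rlt (rr 5) (rr 1))
        (.aset 2 (wr 2) (wc 0) ;; .rset 6 (rr 4 - rr 0 + rr 2) ;;
          .ite (.rlt (rr 3) (rr 6)) (.rset 3 (rr 6)) nop)
        (.aset 2 (wr 2) (wc 1) ;; .rset 1 (rr 5) ;; .rset 2 (rr 5 - rr 4) ;;
          .rset 3 (rr 4 - rr 0)) ;;
      .fset 5 (wr 2) (rr 3) ;; .fset 6 (wr 2) (rr 1) ;; .rset 0 (rr 0 + (rr 5 - rr 4))) ;;
  -- Sentinels at `n`: the largest right endpoint stops every search along the links, and the entry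
  -- `1` makes `n` count as a champion.
  .fset 4 (wr 0) (rr 0) ;; .fset 3 (wr 0) (rr 1) ;; .aset 2 (wr 0) (wc 1)

/-- The arrays after `forward`, up to index `m`. -/
structure ForwardInv (a b : ℕ → ℝ) (s : Store) (m : ℕ) : Prop where
  total : ∀ i < m, s.F 4 i = total a b i
  idle : ∀ i < m, s.F 5 i = idle a b i
  top : ∀ i < m, s.F 6 i = b (champ b i)
  isChamp : ∀ i < m, s.A 2 i = 0 ↔ champ b i ≠ i

section

variable {n B : ℕ} (hB : 66 * n + 1200 ≤ B)
include hB

theorem arrange_spec {s : Store} (h0 : s.w 0 = n) (hσ : ∀ i < n, s.A 1 i < n) :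
    WP n B arrange s fun t s' => t ≤ 4 * n + 2 ∧ ∀ i < n, s'.F 2 i = s.F 0 (s.A 1 i) ∧
      s'.F 3 i = s.F 1 (s.A 1 i) := by
  rw [arrange, wp_seq, wp_wset]
  refine ⟨by simp, (WP.forLoop hB 2 (fun s' => ∀ i < s'.w 2, s'.F 2 i = s.F 0 (s.A 1 i) ∧
      s'.F 3 i = s.F 1 (s.A 1 i)) (by norm_num) rfl rfl (by simp [h0]) ?_ ?_).mono ?_⟩
  · simp
  · rintro s' g₁ hF hw0 hlt
    have hF0 : s'.F 0 = s.F 0 := by rw [hF.F 0 rfl]; simp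
    have hF1 : s'.F 1 = s.F 1 := by rw [hF.F 1 rfl]; simp
    have hA1 : s'.A 1 = s.A 1 := by rw [hF.A 1 rfl]; simp
    have := hσ _ hlt
    simp [Function.update_apply, hA1, hF0, hF1]
    refine ⟨by omega, fun i hi => ?_⟩
    split_ifs with hi2
    · rw [hi2]; exact ⟨rfl, rfl⟩
    · exact g₁ i (by omega)
  · rintro t s' ⟨g₁, g₂, _, _, ht⟩
    simp at ht
    exact ⟨by omega, fun i hi => g₁ i (by omega)⟩

theorem forward_spec {s : Store} {a b : ℕ → ℝ} (h0 : s.w 0 = n) (hn : 0 < n)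
    (hF2 : ∀ i < n, s.F 2 i = a i) (hF3 : ∀ i < n, s.F 3 i = b i) :
    WP n B forward s fun t s' => t ≤ 20 * n + 10 ∧ (∀ i < n, s'.F 3 i = b i) ∧
      s'.F 3 n = b (champ b (n - 1)) ∧ ForwardInv a b s' n ∧ s'.F 4 n = total a b n ∧
      s'.A 2 n = 1 := by
  simp only [forward, wp_seq (c₁ := .rset _ _), wp_seq (c₁ := .wset _ _), wp_rset, wp_wset]
  refine ⟨by simp, by simp, by simp, ?_⟩
  rw [wp_seq]
  -- Before the first round `r 1` equals `b 0`, so that the strict comparison fails and interval `0`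
  -- becomes a champion; `r 2` and `r 3` carry no information yet.
  refine (WP.forLoop hB 14 (fun s' => ForwardInv a b s' (s'.w 2) ∧ s'.r 0 = total a b (s'.w 2) ∧
    (s'.w 2 = 0 → s'.r 1 = b 0) ∧ ∀ j, s'.w 2 = j + 1 → s'.r 1 = b (champ b j) ∧
      s'.r 2 = b (champ b j) - a (champ b j) ∧ s'.r 3 = idle a b j)
      (by norm_num) rfl rfl (by simp [h0]) ?_ ?_).mono ?_
  · simp [hF3 0 hn, total]
    exact ⟨by simp, by simp, by simp, by simp⟩
  · rintro s' ⟨g, g₁, g₂, g₃⟩ hF hw0 hlt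
    have hF2' : s'.F 2 = s.F 2 := by rw [hF.F 2 rfl]; simp
    have hF3' : s'.F 3 = s.F 3 := by rw [hF.F 3 rfl]; simp
    have ha : s'.F 2 (s'.w 2) = a (s'.w 2) := by rw [hF2', hF2 _ hlt]
    have hb : s'.F 3 (s'.w 2) = b (s'.w 2) := by rw [hF3', hF3 _ hlt]
    generalize hj : s'.w 2 = j at *
    have main : ∀ s'' : Store, s''.F 4 = Function.update (s'.F 4) j (s'.r 0) →
        s''.F 5 = Function.update (s'.F 5) j (idle a b j) →
        s''.F 6 = Function.update (s'.F 6) j (b (champ b j)) →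
        (∃ v, s''.A 2 = Function.update (s'.A 2) j v ∧ (v = 0 ↔ champ b j ≠ j)) →
        ForwardInv a b s'' (j + 1) := by
      rintro s'' e₁ e₂ e₃ ⟨v, e₄, e₅⟩
      refine ⟨fun i hi => ?_, fun i hi => ?_, fun i hi => ?_, fun i hi => ?_⟩
      · rw [e₁, Function.update_apply]
        split_ifs with h
        · rw [h, g₁]
        · exact g.total i (by omega)
      · rw [e₂, Function.update_apply]
        split_ifs with h
        · rw [h]
        · exact g.idle i (by omega)
      · rw [e₃, Function.update_apply]
        split_ifs with h
        · rw [h]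
        · exact g.top i (by omega)
      · rw [e₄, Function.update_apply]
        split_ifs with h
        · rw [h, e₅]
        · exact g.isChamp i (by omega)
    have htot := total_succ a b j
    simp [nop, hj, ha, hb]
    have hlow : b j < s'.r 1 → champ b j ≠ j ∧ s'.r 1 = b (champ b j) ∧
        s'.r 2 = b (champ b j) - a (champ b j) ∧
        idle a b j = max (s'.r 3) (a j - total a b j + s'.r 2) := by
      intro h
      obtain _ | k := j
      · rw [g₂ rfl] at h; exact absurd h (lt_irrefl _)
      · obtain ⟨e₁, e₂, e₃⟩ := g₃ k rfl
        have hc : champ b (k + 1) ≠ k + 1 :=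
          mt champ_succ_eq_self_iff.1 (not_le.2 (by rwa [e₁] at h))
        rw [idle_succ hc, e₃, e₂, champ_succ_eq hc]
        exact ⟨champ_succ_eq hc ▸ hc, e₁, rfl, rfl⟩
    have hhigh : s'.r 1 ≤ b j → champ b j = j := by
      intro h
      obtain _ | k := j
      · rfl
      · rw [(g₃ k rfl).1] at h; exact champ_succ_eq_self_iff.2 h
    refine ⟨by omega, fun h => ?_, fun h => ?_⟩
    · obtain ⟨e₁, e₂, e₃, e₄⟩ := hlow h
      refine ⟨by omega, fun h' => ?_, fun h' => ?_⟩
      · have e₅ : a j - s'.r 0 + s'.r 2 = idle a b j := by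
          rw [e₄, g₁, max_eq_right]; rw [← g₁]; exact h'.le
        refine ⟨by omega, main _ (by simp) (by simp [e₅]) (by simp [e₂]) ⟨0, by simp, by simp [e₁]⟩,
          by rw [htot, g₁], e₂, e₃, e₅⟩
      · have e₅ : s'.r 3 = idle a b j := by
          rw [e₄, max_eq_left]; rw [← g₁]; exact h'
        refine ⟨by omega, main _ (by simp) (by simp [e₅]) (by simp [e₂]) ⟨0, by simp, by simp [e₁]⟩,
          by rw [htot, g₁], e₂, e₃, e₅⟩
    · have hc := hhigh h
      have e₅ : a j - s'.r 0 = idle a b j := by rw [idle_of_champ hc, g₁]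
      refine ⟨by omega, main _ (by simp) (by simp [e₅]) (by simp [hc]) ⟨1, by simp, by simp [hc]⟩,
        by rw [htot, g₁], by rw [hc], by rw [hc], e₅⟩
  · rintro t s' ⟨⟨g, g₁, g₂, g₃⟩, _, h₂, hF, ht⟩
    simp at ht h₂
    have hw0' : s'.w 0 = n := by rw [hF.w 0 rfl]; simp [h0]
    have hF3' : s'.F 3 = s.F 3 := by rw [hF.F 3 rfl]; simp
    rw [h₂] at g g₁ g₃
    obtain ⟨m, rfl⟩ : ∃ m, n = m + 1 := ⟨n - 1, by omega⟩
    have := g₃ m rfl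
    simp [hw0', g₁, hF3', this.1]
    and_intros
    all_goals try omega
    · intro i hi
      rw [Function.update_of_ne (by omega), hF3 i (by omega)]
    · refine ⟨fun i hi => ?_, fun i hi => ?_, fun i hi => ?_, fun i hi => ?_⟩
      · simp [Function.update_of_ne (show i ≠ m + 1 by omega), g.total i hi]
      · simp [g.idle i hi]
      · simp [g.top i hi]
      · simp [Function.update_of_ne (show i ≠ m + 1 by omega), g.isChamp i hi]

end

end RealRAM

namespace IntervalSeparation

/-! ### Computing the delays -/

variable {n : ℕ} {a b : ℕ → ℝ}

/-- Rephrases lying in the same block as the absence of champions in between, which the backward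
scan can check one index at a time. -/
theorem champ_eq_iff {i j : ℕ} (hij : i ≤ j) :
    champ b j = champ b i ↔ ∀ k, i < k → k ≤ j → champ b k ≠ k := by
  induction j with
  | zero => rw [Nat.le_zero.1 hij]; simp; omega
  | succ j ih =>
    rcases Nat.lt_or_eq_of_le hij with h | rfl
    · rw [Nat.lt_succ_iff] at h
      have hi := champ_le b i
      constructor
      · intro hc k hk hkj hck
        have := champ_mono b hkj
        omega
      · intro hc
        rw [champ_succ_eq (hc _ (by omega) le_rfl), ih h]
        exact fun k hk hkj => hc k hk (by omega)
    · simp; omega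

/-- `x` is the largest delay of the intervals that follow `j`, `j` included, up to the next
champion. -/
def IsTailDelay (n : ℕ) (a b : ℕ → ℝ) (j : ℕ) (x : ℝ) : Prop :=
  ∀ D, x ≤ D ↔ ∀ i, j ≤ i → i < n → (∀ k, j < k → k ≤ i → champ b k ≠ k) →
    ∃ k, j ≤ k ∧ k ≤ i ∧ total a b (i + 1) - b k ≤ D

/-- The delays from `j` on, in terms of the next interval `g` with a larger right endpoint. -/
theorem IsTailDelay.step (hab : ∀ i < n, a i < b i) {j g : ℕ} (hjg : j < g) (hg : g ≤ n)
    (hlt : ∀ k, j < k → k < g → b k < b j) (hle : g < n → b j ≤ b g) {x y : ℝ}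
    (hy : g < n → champ b g ≠ g → IsTailDelay n a b g y ∧ x = max (total a b g - b j) y)
    (hx : ¬ (g < n ∧ champ b g ≠ g) → x = total a b g - b j) : IsTailDelay n a b j x := by
  have hrec : ∀ k, j < k → k < g → champ b k ≠ k := fun k hk hkg hc => by
    have h₁ := le_champ b hk.le
    rw [hc] at h₁
    have := hlt k hk hkg
    linarith
  -- Up to `g - 1` the largest right endpoint stays `b j` while the total length grows, so among
  -- these prefixes the one ending at `g - 1` is the worst.
  have key : ∀ D, (∀ i, j ≤ i → i < n → (∀ k, j < k → k ≤ i → champ b k ≠ k) →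
      ∃ k, j ≤ k ∧ k ≤ i ∧ total a b (i + 1) - b k ≤ D) → total a b g - b j ≤ D := by
    intro D h
    obtain ⟨k, hk, hkg, hD⟩ := h (g - 1) (by omega) (by omega) fun k hk hkg => hrec k hk (by omega)
    rw [show g - 1 + 1 = g by omega] at hD
    rcases Nat.lt_or_eq_of_le hk with hk | rfl
    · have := hlt k hk (by omega)
      linarith
    · exact hD
  have key' : ∀ D, total a b g - b j ≤ D → ∀ i, j ≤ i → i < g →
      ∃ k, j ≤ k ∧ k ≤ i ∧ total a b (i + 1) - b k ≤ D := fun D hD i hi hig =>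
    ⟨j, le_rfl, hi, by have := total_mono hab (show i + 1 ≤ g by omega) hg; linarith⟩
  intro D
  by_cases hgc : g < n ∧ champ b g ≠ g
  · obtain ⟨ty, rfl⟩ := hy hgc.1 hgc.2
    rw [max_le_iff, ty D]
    constructor
    · rintro ⟨h₁, h₂⟩ i hi hin hc
      rcases Nat.lt_or_ge i g with hig | hig
      · exact key' D h₁ i hi hig
      · obtain ⟨k, hk, hki, hD⟩ := h₂ i hig hin fun k hk => hc k (by omega)
        exact ⟨k, by omega, hki, hD⟩
    · refine fun h => ⟨key D h, fun i hi hin hc => ?_⟩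
      obtain ⟨k, hk, hki, hD⟩ := h i (by omega) hin fun k hk hki => by
        rcases Nat.lt_trichotomy k g with h' | rfl | h'
        · exact hrec k hk h'
        · exact hgc.2
        · exact hc k h' hki
      rcases Nat.lt_or_ge k g with hkg | hkg
      -- A witness before `g` can be replaced by `g`, whose right endpoint is at least `b j` and
      -- hence at least that of the witness.
      · refine ⟨g, le_rfl, hi, ?_⟩
        have := hle hgc.1
        rcases Nat.lt_or_eq_of_le hk with hk | rfl
        · have := hlt k hk hkg
          linarith
        · linarith
      · exact ⟨k, hkg, hki, hD⟩
  · rw [hx hgc]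
    refine ⟨fun h₁ i hi hin hc => ?_, key D⟩
    rcases Nat.lt_or_ge i g with hig | hig
    · exact key' D h₁ i hi hig
    · exact absurd ⟨by omega, hc g hjg hig⟩ hgc

/-- The delays when the champion is moved behind `r`. -/
theorem delay_le_iff {r : ℕ} {x y D : ℝ}
    (hy : r + 1 < n → champ b (r + 1) ≠ r + 1 →
      IsTailDelay n a b (r + 1) y ∧ x = max (total a b (r + 1) - b (champ b r)) y)
    (hx : ¬ (r + 1 < n ∧ champ b (r + 1) ≠ r + 1) → x = total a b (r + 1) - b (champ b r)) :
    x ≤ D ↔ total a b (r + 1) - b (champ b r) ≤ D ∧ ∀ j, r < j → j < n →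
      champ b j = champ b r → ∃ k, r < k ∧ k ≤ j ∧ total a b (j + 1) - b k ≤ D := by
  by_cases hc : r + 1 < n ∧ champ b (r + 1) ≠ r + 1
  · obtain ⟨ty, rfl⟩ := hy hc.1 hc.2
    rw [max_le_iff, ty D]
    refine and_congr_right fun _ => forall_congr' fun j => ?_
    constructor
    · intro h hj hjn hjc
      rw [champ_eq_iff hj.le] at hjc
      exact h hj hjn fun k hk hkj => hjc k (by omega) hkj
    · intro h hj hjn hjc
      refine h hj hjn ((champ_eq_iff (by omega)).2 fun k hk hkj => ?_)
      rcases Nat.lt_or_eq_of_le (show r + 1 ≤ k from hk) with h' | rfl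
      · exact hjc k h' hkj
      · exact hc.2
  · rw [hx hc]
    refine ⟨fun h => ⟨h, fun j hj hjn hjc => absurd ⟨by omega, ?_⟩ hc⟩, fun h => h.1⟩
    exact (champ_eq_iff hj.le).1 hjc _ (by omega) hj

end IntervalSeparation

/-! ### The backward scan for the delays -/

namespace RealRAM

open IntervalSeparation

/-- Raise the register `4` to the entry `w 3` of the array `7`, unless `w 3` is a champion. -/
def raise : Cmd :=
  .ite (.weq (wa 2 (wr 3)) (wc 0)) (.ite (.rlt (rr 4) (ra 7 (wr 3))) (.rset 4 (ra 7 (wr 3))) nop) nop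

/-- Find the next interval with a right endpoint at least that of the interval `w 2`. -/
def findNext : Cmd := .while (.rlt (ra 3 (wr 3)) (ra 3 (wr 2))) (.wset 3 (wa 5 (wr 3)))

/-- Compute the delays. -/
def backward : Cmd :=
  .wset 2 (wr 0) ;;
  .while (.wlt (wc 0) (wr 2))
    (.wset 2 (wr 2 - wc 1) ;; .wset 3 (wr 2 + wc 1) ;; findNext ;; .aset 5 (wr 2) (wr 3) ;;
      .rset 4 (ra 4 (wr 3) - ra 3 (wr 2)) ;; raise ;; .fset 7 (wr 2) (rr 4) ;;
      .wset 3 (wr 2 + wc 1) ;; .rset 4 (ra 4 (wr 3) - ra 6 (wr 2)) ;; raise ;;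
      .fset 8 (wr 2) (rr 4))

/-- From `g`, `k` steps along the links `N` lead to `n`. -/
inductive Chain (n : ℕ) (N : ℕ → ℕ) : ℕ → ℕ → Prop
  | nil : Chain n N n 0
  | cons {g k : ℕ} (h : g < n) (h' : Chain n N (N g) k) : Chain n N g (k + 1)

theorem Chain.congr {n : ℕ} {N N' : ℕ → ℕ} {g k m : ℕ} (h : Chain n N g k) (hm : m ≤ g)
    (hN : ∀ i, m ≤ i → N' i = N i) (hlt : ∀ i, m ≤ i → i < n → i < N i) : Chain n N' g k := by
  induction h with
  | nil => exact .nil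
  | cons h _ ih =>
    refine .cons h ?_
    rw [hN _ hm]
    exact ih (by have := hlt _ hm h; omega)

/-- The arrays during `backward`, when the intervals from `m` on have been processed. -/
structure BackwardInv (n : ℕ) (a b : ℕ → ℝ) (s : Store) (m : ℕ) : Prop where
  next_gt : ∀ j, m ≤ j → j < n → j < s.A 5 j ∧ s.A 5 j ≤ n
  next_lt : ∀ j, m ≤ j → j < n → ∀ k, j < k → k < s.A 5 j → b k < b j
  tail : ∀ j, m ≤ j → j < n → IsTailDelay n a b j (s.F 7 j)
  delay : ∀ j, m ≤ j → j < n → ∀ D, s.F 8 j ≤ D ↔ total a b (j + 1) - b (champ b j) ≤ D ∧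
    ∀ i, j < i → i < n → champ b i = champ b j → ∃ k, j < k ∧ k ≤ i ∧ total a b (i + 1) - b k ≤ D

theorem raise_spec {n B : ℕ} {s : Store} (h : s.w 3 ≤ n) :
    WP n B raise s fun t s' => t ≤ 3 ∧
      s'.r 4 = if s.A 2 (s.w 3) = 0 then max (s.r 4) (s.F 7 (s.w 3)) else s.r 4 := by
  simp [raise, nop]
  refine ⟨by omega, fun h₁ => ⟨by omega, fun h₂ => ?_, fun h₂ => ?_⟩, fun h₁ => ?_⟩
  · exact ⟨by omega, by rw [if_pos h₁, max_eq_right h₂.le]⟩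
  · exact fun _ => h₂
  · exact fun h => absurd h h₁

section

variable {n B : ℕ} (hB : 66 * n + 1200 ≤ B)
include hB

theorem findNext_spec {s : Store} {b : ℕ → ℝ} {j k : ℕ} (hj : j < n) (hw2 : s.w 2 = j)
    (hw3 : s.w 3 = j + 1) (hb : ∀ i < n, s.F 3 i = b i) (hbn : s.F 3 n = b (champ b (n - 1)))
    (hgt : ∀ i, j < i → i < n → i < s.A 5 i ∧ s.A 5 i ≤ n)
    (hlt : ∀ i, j < i → i < n → ∀ k, i < k → k < s.A 5 i → b k < b i)
    (hch : Chain n (s.A 5) (j + 1) k) :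
    WP n B findNext s fun t s' => ∃ k', Chain n (s.A 5) (s'.w 3) k' ∧ t + 2 * k' ≤ 2 * k + 1 ∧
      j < s'.w 3 ∧ s'.w 3 ≤ n ∧ (∀ i, j < i → i < s'.w 3 → b i < b j) ∧
      (s'.w 3 < n → b j ≤ b (s'.w 3)) := by
  refine (WP.while_potential (fun φ s' => ∃ k', φ = 2 * k' ∧ Chain n (s.A 5) (s'.w 3) k' ∧
    j < s'.w 3 ∧ s'.w 3 ≤ n ∧ (∀ i, j < i → i < s'.w 3 → b i < b j))
    ⟨k, rfl, by rwa [hw3], by omega, by omega, fun i h h' => by omega⟩ ?_).mono ?_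
  · rintro φ s' ⟨k', rfl, h₁, h₂, h₃, h₄⟩ hF
    have e2 : s'.w 2 = j := by rw [hF.w 2 rfl, hw2]
    have e3 : s'.F 3 = s.F 3 := hF.F 3 rfl
    have e5 : s'.A 5 = s.A 5 := hF.A 5 rfl
    refine ⟨by simp; omega, fun hlt' => ?_⟩
    simp only [BExp.eval, RExp.eval, WExp.eval, e2, e3, hb j hj] at hlt'
    -- The sentinel is no smaller than any right endpoint, so the loop test fails at `n`.
    have hne : s'.w 3 ≠ n := by
      intro h
      rw [h, hbn] at hlt'
      have := le_champ b (show j ≤ n - 1 by omega)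
      linarith
    have hg : s'.w 3 < n := by omega
    rw [hb _ hg] at hlt'
    obtain ⟨g₁, g₂⟩ := hgt _ h₂ hg
    have g₃ := hlt _ h₂ hg
    cases h₁ with
    | nil => omega
    | @cons _ k'' _ h' =>
      simp only [wp_wset, WExp.eval, e5, Store.setW_w, if_true]
      refine ⟨by simp; omega, 2 * k'', ⟨k'', rfl, h', by omega, g₂, fun i hi hi' => ?_⟩, by omega⟩
      rcases Nat.lt_trichotomy i (s'.w 3) with hi₃ | rfl | hi₃
      · exact h₄ i hi hi₃
      · exact hlt'
      · exact (g₃ i hi₃ hi').trans hlt'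
  · rintro t s' ⟨φ, ⟨k', rfl, h₁, h₂, h₃, h₄⟩, hlt', hF, ht⟩
    have e2 : s'.w 2 = j := by rw [hF.w 2 rfl, hw2]
    have e3 : s'.F 3 = s.F 3 := hF.F 3 rfl
    simp only [BExp.eval, RExp.eval, WExp.eval, e2, e3, hb j hj] at hlt'
    refine ⟨k', h₁, ht, h₂, h₃, h₄, fun h => ?_⟩
    rw [hb _ h] at hlt'
    exact not_lt.1 hlt'

/-- The chain of links from the current interval acts as a stack: every link followed by `findNext`
leaves the chain for good, and each interval adds one link. With the chain length in the potential,
the scan takes linear time. -/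
theorem backward_spec {s : Store} {a b : ℕ → ℝ} (h0 : s.w 0 = n) (hn : 0 < n)
    (hab : ∀ i < n, a i < b i) (hb : ∀ i < n, s.F 3 i = b i)
    (hbn : s.F 3 n = b (champ b (n - 1))) (hfw : ForwardInv a b s n)
    (htot : s.F 4 n = total a b n) (hA : s.A 2 n = 1) :
    WP n B backward s fun t s' => t ≤ 24 * n + 10 ∧ IsDelayBound n a b (s'.F 8) := by
  have htot' : ∀ i ≤ n, s.F 4 i = total a b i := fun i hi => by
    rcases Nat.lt_or_eq_of_le hi with h | rfl
    · exact hfw.total i h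
    · exact htot
  have hchamp : ∀ g ≤ n, s.A 2 g = 0 ↔ g < n ∧ champ b g ≠ g := by
    intro g hg
    rcases Nat.lt_or_eq_of_le hg with h | rfl
    · rw [hfw.isChamp g h]; simp [h]
    · simp [hA]
  rw [backward, wp_seq, wp_wset]
  refine ⟨by simp, ?_⟩
  refine (WP.while_potential (fun φ s' => s'.w 2 ≤ n ∧ BackwardInv n a b s' (s'.w 2) ∧
    ∃ k, Chain n (s'.A 5) (s'.w 2) k ∧ φ = 20 * s'.w 2 + 2 * k) (φ₀ := 20 * n)
    ?_ ?_).mono ?_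
  · simp only [Store.setW_w, if_true, WExp.eval, h0]
    refine ⟨le_rfl, ⟨?_, ?_, ?_, ?_⟩, 0, .nil, rfl⟩ <;> intro j hj hjn <;> omega
  · rintro φ s' ⟨hle, hI, k, hch, rfl⟩ hF
    have e0 : s'.w 0 = n := by rw [hF.w 0 rfl]; simp [h0]
    have eA2 : s'.A 2 = s.A 2 := by rw [hF.A 2 rfl]; simp
    have e3 : s'.F 3 = s.F 3 := by rw [hF.F 3 rfl]; simp
    have e4 : s'.F 4 = s.F 4 := by rw [hF.F 4 rfl]; simp
    have e6 : s'.F 6 = s.F 6 := by rw [hF.F 6 rfl]; simp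
    refine ⟨by simp, fun hpos => ?_⟩
    simp at hpos
    obtain ⟨j, hj⟩ : ∃ j, s'.w 2 = j + 1 := ⟨s'.w 2 - 1, by omega⟩
    rw [hj] at hle hI hch ⊢
    have hjn : j < n := hle
    simp only [wp_seq, wp_wset, wp_aset, wp_rset, wp_fset, WExp.eval, Op.wval, Store.setW_w, hj,
      if_true]
    refine ⟨by simp, by simp [hj]; omega, ?_⟩
    refine (findNext_spec hB (b := b) (j := j) (k := k) hjn ?_ ?_ ?_ ?_ ?_ ?_ ?_).frame.mono ?_
    · simp [hj]
    · simp [hj]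
    · simpa [e3] using hb
    · simpa [e3] using hbn
    · exact fun i hi => hI.next_gt i hi
    · exact fun i hi => hI.next_lt i hi
    · exact hch
    rintro t₁ s₁ ⟨⟨k', h₁, h₂, h₃, h₄, h₅, h₆⟩, hF₁⟩
    have d2 : s₁.w 2 = j := by rw [hF₁.w 2 rfl]; simp [hj]
    have dA2 : s₁.A 2 = s.A 2 := by rw [hF₁.A 2 rfl]; simp [eA2]
    have dA5 : s₁.A 5 = s'.A 5 := by rw [hF₁.A 5 rfl]; simp
    have d3 : s₁.F 3 = s.F 3 := by rw [hF₁.F 3 rfl]; simp [e3]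
    have d4 : s₁.F 4 = s.F 4 := by rw [hF₁.F 4 rfl]; simp [e4]
    have d6 : s₁.F 6 = s.F 6 := by rw [hF₁.F 6 rfl]; simp [e6]
    have d7 : s₁.F 7 = s'.F 7 := by rw [hF₁.F 7 rfl]; simp
    have d8 : s₁.F 8 = s'.F 8 := by rw [hF₁.F 8 rfl]; simp
    simp only [Store.setW_A] at h₁
    generalize hg : s₁.w 3 = g at *
    refine ⟨⟨trivial, trivial, by omega⟩, by simp [d2, hg]; omega, ?_⟩
    refine (raise_spec ?_).frame.mono ?_
    · simpa [hg] using h₄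
    rintro t₂ s₂ ⟨⟨ht₂, hr₂⟩, hF₂⟩
    have f2 : s₂.w 2 = j := by rw [hF₂.w 2 rfl]; simp [d2]
    have fA2 : s₂.A 2 = s.A 2 := by rw [hF₂.A 2 rfl]; simp [dA2]
    have fA5 : s₂.A 5 = Function.update (s'.A 5) j g := by rw [hF₂.A 5 rfl]; simp [dA5, d2, hg]
    have f4 : s₂.F 4 = s.F 4 := by rw [hF₂.F 4 rfl]; simp [d4]
    have f6 : s₂.F 6 = s.F 6 := by rw [hF₂.F 6 rfl]; simp [d6]
    have f7 : s₂.F 7 = s'.F 7 := by rw [hF₂.F 7 rfl]; simp [d7]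
    have f8 : s₂.F 8 = s'.F 8 := by rw [hF₂.F 8 rfl]; simp [d8]
    simp [hg, dA2, d4, d3, d2, d7, hchamp g h₄, htot' g h₄, hb j hjn] at hr₂
    refine ⟨by simp [f2]; omega, by simp [f2]; omega, by simp [f2]; omega, ?_⟩
    refine (raise_spec ?_).frame.mono ?_
    · simp [f2]; omega
    rintro t₃ s₃ ⟨⟨ht₃, hr₃⟩, hF₃⟩
    have k2 : s₃.w 2 = j := by rw [hF₃.w 2 rfl]; simp [f2]
    have kA5 : s₃.A 5 = Function.update (s'.A 5) j g := by rw [hF₃.A 5 rfl]; simp [fA5]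
    have k7 : s₃.F 7 = Function.update (s'.F 7) j (s₂.r 4) := by rw [hF₃.F 7 rfl]; simp [f7, f2]
    have k8 : s₃.F 8 = s'.F 8 := by rw [hF₃.F 8 rfl]; simp [f8]
    simp [f2, fA2, f4, f6, f7, hchamp (j + 1) hjn, htot' (j + 1) hjn, hfw.top j hjn] at hr₃
    have upd : ∀ {α : Type} (f : ℕ → α) (x : α) (i : ℕ), j + 1 ≤ i → Function.update f j x i = f i :=
      fun f x i hi => Function.update_of_ne (by omega) _ _
    have cases_le : ∀ {p : ℕ → Prop}, p j → (∀ i, j + 1 ≤ i → i < n → p i) →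
        ∀ i, j ≤ i → i < n → p i := by
      intro p h h' i hi hin
      rcases Nat.lt_or_eq_of_le hi with hi | rfl
      · exact h' i hi hin
      · exact h
    have htail : IsTailDelay n a b j (s₂.r 4) := by
      refine IsTailDelay.step (y := s'.F 7 g) hab h₃ h₄ h₅ h₆ (fun g₁ g₂ => ⟨?_, ?_⟩) fun g₁ => ?_
      · exact hI.tail g h₃ g₁
      · rw [hr₂, if_pos ⟨g₁, g₂⟩]
      · rw [hr₂, if_neg g₁]
    have hdelay : ∀ D, s₃.r 4 ≤ D ↔ total a b (j + 1) - b (champ b j) ≤ D ∧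
        ∀ i, j < i → i < n → champ b i = champ b j → ∃ k, j < k ∧ k ≤ i ∧
          total a b (i + 1) - b k ≤ D := by
      intro D
      refine delay_le_iff (y := s'.F 7 (j + 1)) (fun g₁ g₂ => ⟨?_, ?_⟩) fun g₁ => ?_
      · exact hI.tail (j + 1) le_rfl g₁
      · rw [hr₃, if_pos ⟨g₁, g₂⟩]
      · rw [hr₃, if_neg g₁]
    refine ⟨⟨trivial, trivial, by simp [k2]; omega⟩, 20 * j + 2 * (k' + 1), ⟨?_, ?_, k' + 1, ?_, ?_⟩, ?_⟩
    · simp [k2]; omega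
    · simp only [Store.setF_w, k2]
      refine ⟨cases_le ?_ ?_, cases_le ?_ ?_, cases_le ?_ ?_, cases_le ?_ ?_⟩
      · simpa [kA5] using ⟨h₃, h₄⟩
      · intro i hi hin
        simpa [kA5, upd _ _ i hi] using hI.next_gt i hi hin
      · simpa [kA5] using h₅
      · intro i hi hin
        simpa [kA5, upd _ _ i hi] using hI.next_lt i hi hin
      · simpa [k7] using htail
      · intro i hi hin
        simpa [k7, upd _ _ i hi] using hI.tail i hi hin
      · simpa using hdelay
      · intro i hi hin
        simpa [k8, upd _ _ i hi] using hI.delay i hi hin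
    · simp only [Store.setF_w, Store.setF_A, k2, kA5]
      refine .cons hjn ?_
      rw [Function.update_self]
      exact h₁.congr (m := j + 1) h₃ (fun i hi => upd _ _ i hi)
        fun i hi hin => (hI.next_gt i hi hin).1
    · simp [k2]
    · omega
  · rintro t s' ⟨φ, ⟨hle, hI, _⟩, hpos, _, ht⟩
    simp at hpos
    rw [hpos] at hI
    exact ⟨by omega, fun r hr => hI.delay r (Nat.zero_le _) hr⟩

end

end RealRAM

namespace RealRAM

open IntervalSeparation

/-! ### Ranking the idle times -/

theorem SortedBy.exists_eq {n : ℕ} {κ : ℕ → ℝ} {σ : ℕ → ℕ} (h : SortedBy n κ σ) {r : ℕ}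
    (hr : r < n) : ∃ i < n, σ i = r := by
  have hinj : Set.InjOn σ (Finset.range n : Set ℕ) := by
    intro i hi j hj hij
    simp at hi hj
    rcases Nat.lt_trichotomy i j with h' | h' | h'
    · exact absurd hij (h.ne j hj i h')
    · exact h'
    · exact absurd hij.symm (h.ne i hi j h')
  have himg : (Finset.range n).image σ = Finset.range n := by
    refine Finset.eq_of_subset_of_card_le (fun x hx => ?_) ?_
    · obtain ⟨i, hi, rfl⟩ := Finset.mem_image.1 hx
      simp at hi ⊢
      exact h.lt i hi
    · rw [Finset.card_image_of_injOn hinj]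
  have : r ∈ (Finset.range n).image σ := by rw [himg]; simpa using hr
  simpa using this

/-- Compute the sorted idle times and the positions of the idle times. -/
def ranks : Cmd :=
  .wset 3 (wc 0) ;; .rset 4 (ra 5 (wa 3 (wc 0))) ;; .wset 2 (wc 0) ;;
  forLoop 2
    (.fset 9 (wr 2) (ra 5 (wa 3 (wr 2))) ;;
      .ite (.rlt (rr 4) (ra 9 (wr 2))) (.wset 3 (wr 2)) nop ;;
      .rset 4 (ra 9 (wr 2)) ;; .aset 4 (wa 3 (wr 2)) (wr 3))

/-- The state of `ranks` after `j` values: `p` is the first position of the last value. -/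
structure RankInv (κ : ℕ → ℝ) (σ : ℕ → ℕ) (Vs : ℕ → ℝ) (ρ : ℕ → ℕ) (x : ℝ) (p j : ℕ) : Prop where
  vals : ∀ i < j, Vs i = κ (σ i)
  last : x = κ (σ (j - 1))
  pos_le : p ≤ j - 1
  pos_eq : κ (σ p) = κ (σ (j - 1))
  lt_pos : ∀ u < p, κ (σ u) < κ (σ p)
  rank : ∀ i < j, ρ (σ i) ≤ i ∧ κ (σ (ρ (σ i))) = κ (σ i) ∧ ∀ u < ρ (σ i), κ (σ u) < κ (σ i)

/-- For `j = 0` the truncated `j - 1` is `0`, in accordance with the initialization by the first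
value: the first comparison finds equality and keeps `p = 0`. -/
theorem RankInv.step {κ : ℕ → ℝ} {σ : ℕ → ℕ} {Vs : ℕ → ℝ} {ρ : ℕ → ℕ} {x : ℝ} {p j n : ℕ}
    (h : RankInv κ σ Vs ρ x p j) (hσ : SortedBy n κ σ) (hj : j < n) {p' : ℕ}
    (hp : p' = if x < κ (σ j) then j else p) :
    RankInv κ σ (Function.update Vs j (κ (σ j))) (Function.update ρ (σ j) p') (κ (σ j)) p'
      (j + 1) := by
  have hp' : p' ≤ j ∧ κ (σ p') = κ (σ j) ∧ ∀ u < p', κ (σ u) < κ (σ p') := by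
    rw [hp, h.last]
    split_ifs with hlt
    · refine ⟨le_rfl, rfl, fun u hu => lt_of_le_of_lt ?_ hlt⟩
      rcases Nat.lt_or_eq_of_le (show u ≤ j - 1 by omega) with h' | rfl
      · exact hσ.le _ (by omega) _ h'
      · exact le_rfl
    · refine ⟨h.pos_le.trans (by omega), ?_, h.lt_pos⟩
      rw [h.pos_eq]
      refine le_antisymm ?_ (not_lt.1 hlt)
      rcases Nat.eq_zero_or_pos j with rfl | h'
      · exact le_rfl
      · exact hσ.le j hj _ (by omega)
  refine ⟨fun i hi => ?_, rfl, hp'.1, hp'.2.1, hp'.2.2, fun i hi => ?_⟩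
  · rw [Function.update_apply]
    split_ifs with h'
    · rw [h']
    · exact h.vals i (by omega)
  · rcases Nat.lt_or_eq_of_le (Nat.lt_succ_iff.1 hi) with h' | rfl
    · rw [Function.update_of_ne (hσ.ne j hj i h')]
      exact h.rank i h'
    · rw [Function.update_self]
      exact ⟨hp'.1, hp'.2.1, fun u hu => hp'.2.1 ▸ hp'.2.2 u hu⟩

/-- Equal idle times share their first position. Therefore every position before the rank has a
strictly smaller value, and comparing ranks with positions amounts to comparing values. -/
theorem RankInv.isRanking {a b Vs : ℕ → ℝ} {κ : ℕ → ℝ} {σ ρ : ℕ → ℕ} {x : ℝ} {p n : ℕ}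
    (h : RankInv κ σ Vs ρ x p n) (hσ : SortedBy n κ σ) (hκ : ∀ i < n, κ i = idle a b i) :
    IsRanking n a b Vs ρ := by
  have hmono : ∀ v < n, ∀ u ≤ v, Vs u ≤ Vs v := fun v hv u hu => by
    rw [h.vals v hv, h.vals u (by omega)]
    rcases Nat.lt_or_eq_of_le hu with h | rfl
    · exact hσ.le v hv u h
    · exact le_rfl
  have key : ∀ r < n, ρ r < n ∧ Vs (ρ r) = idle a b r ∧ ∀ u < ρ r, Vs u < idle a b r := by
    intro r hr
    obtain ⟨i, hi, rfl⟩ := hσ.exists_eq hr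
    obtain ⟨h₁, h₂, h₃⟩ := h.rank i hi
    rw [hκ _ hr] at h₂ h₃
    refine ⟨by omega, by rw [h.vals _ (by omega), h₂], fun u hu => ?_⟩
    rw [h.vals _ (by omega)]; exact h₃ u hu
  refine ⟨hmono, fun r hr => (key r hr).1, fun r hr v hv => ⟨fun hle => ?_, fun hle => ?_⟩,
    fun r hr => (key r hr).2.1⟩
  · rw [← (key r hr).2.1]; exact hmono v hv _ hle
  · by_contra hlt
    exact absurd ((key r hr).2.2 v (by omega)) (not_lt.2 hle)

section

variable {n B : ℕ} (hB : 66 * n + 1200 ≤ B)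
include hB

theorem ranks_spec {s : Store} {a b : ℕ → ℝ} (h0 : s.w 0 = n) (hn : 0 < n)
    (hσ : SortedBy n (s.F 5) (s.A 3)) (hidle : ∀ i < n, s.F 5 i = idle a b i) :
    WP n B ranks s fun t s' => t ≤ 8 * n + 5 ∧ IsRanking n a b (s'.F 9) (s'.A 4) := by
  have hσ0 := hσ.lt 0 hn
  simp only [ranks, wp_seq (c₁ := .rset _ _), wp_seq (c₁ := .wset _ _), wp_rset, wp_wset]
  refine ⟨by simp, by simp; omega, by simp, ?_⟩
  refine (WP.forLoop hB 6 (fun s' => RankInv (s.F 5) (s.A 3) (s'.F 9) (s'.A 4) (s'.r 4) (s'.w 3)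
    (s'.w 2)) (by norm_num) rfl rfl (by simp [h0]) ?_ ?_).mono ?_
  · simp
    exact ⟨by simp, rfl, le_rfl, rfl, by simp, by simp⟩
  · rintro s' g hF hw0 hlt
    have e5 : s'.F 5 = s.F 5 := by rw [hF.F 5 rfl]; simp
    have eA : s'.A 3 = s.A 3 := by rw [hF.A 3 rfl]; simp
    have hσj := hσ.lt _ hlt
    simp [nop, eA, e5]
    refine ⟨⟨by omega, by omega⟩, by omega, fun h => ⟨by omega, ?_⟩, fun h => ⟨by omega, ?_⟩⟩
    · exact ⟨⟨by omega, by omega⟩, g.step hσ hlt (by rw [if_pos h])⟩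
    · exact ⟨⟨by omega, by omega⟩, g.step hσ hlt (by rw [if_neg (not_lt.2 h)])⟩
  · rintro t s' ⟨g, _, h₂, hF, ht⟩
    simp at h₂ ht
    rw [h₂] at g
    exact ⟨by omega, g.isRanking hσ hidle⟩

end

end RealRAM

namespace RealRAM

open IntervalSeparation

/-! ### Searching the tournament tree -/

/-- Find the first position `x` such that `Vs x + q` is at least the tail behind `x`. The node
`w 3` has `w 10` leaves, which end before `w 11`; `r 3` is the tail from there on. -/
def descend : Cmd :=
  .wset 3 (wc 1) ;; .wset 10 (wr 1) ;; .wset 11 (wr 1) ;; .rset 3 (rc 0) ;;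
  .while (.wlt (wc 1) (wr 10))
    (.wset 10 (wr 10 / wc 2) ;; .wset 11 (wr 11 - wr 10) ;;
      .rset 4 (rc 0 - ra 10 (wa 0 (wr 3 + wr 3 + wc 1))) ;;
      .ite (.rlt (rr 4) (rr 3)) (.rset 4 (rr 3)) nop ;;
      .wset 5 (wr 11 - wc 1) ;; .wset 12 (wc 1) ;;
      .ite (.wlt (wr 5) (wr 0)) (.ite (.rlt (ra 9 (wr 5) + rr 1) (rr 4)) (.wset 12 (wc 0)) nop)
        nop ;;
      .ite (.weq (wr 12) (wc 0)) (.wset 3 (wr 3 + wr 3 + wc 1) ;; .wset 11 (wr 11 + wr 10))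
        (.wset 3 (wr 3 + wr 3) ;; .rset 3 (rr 4)))

/-- The state of `descend` at the node `u` with `2 ^ d` leaves. -/
structure DescendInv (h n : ℕ) (A Vs : ℕ → ℝ) (q : ℝ) (u d e : ℕ) (acc : ℝ) : Prop where
  pos : u * 2 ^ d + 2 ^ d = 2 ^ h + e
  le_end : 2 ^ d ≤ e
  end_le : e ≤ 2 ^ h
  acc_le : ∀ D, acc ≤ D ↔ TailLe (2 ^ h - 1) A (e - 1) D
  -- Bisection: the last leaf of the current node meets the search condition, positions from `n` on
  -- counting as successes, and the leaf just before the node, if any, lies on the other side of the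
  -- crossing.
  good : e - 1 < n → acc ≤ Vs (e - 1) + q
  bad : 2 ^ d < e → e - 2 ^ d - 1 < n ∧ ∃ y, (∀ D, y ≤ D ↔ TailLe (2 ^ h - 1) A (e - 2 ^ d - 1) D) ∧
    Vs (e - 2 ^ d - 1) + q ≤ y

/-- The right child of the current node. -/
theorem DescendInv.right_child {h n : ℕ} {κ A Vs : ℕ → ℝ} {q : ℝ} {u d e : ℕ} {acc : ℝ}
    {T : ℕ → ℕ} (hA : ∀ p, A p = 0 - κ p)
    (hI : DescendInv h n A Vs q u (d + 1) e acc) (hT : IsTree (2 ^ h) κ {i | i < 2 ^ h} ∅ T) :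
    u + u + 1 < 2 * 2 ^ h ∧ T (u + u + 1) < 2 ^ h ∧
    (∀ D, max (0 - κ (T (u + u + 1))) acc ≤ D ↔ TailLe (2 ^ h - 1) A (e - 2 ^ d - 1) D) := by
  obtain ⟨h₁, h₂, h₃, h₄, -, -⟩ := hI
  have hd : 0 < 2 ^ d := by positivity
  have e₁ : (u + u + 1) * 2 ^ d = u * 2 ^ (d + 1) + 2 ^ d := by ring
  have e₂ : (u + u + 1 + 1) * 2 ^ d = u * 2 ^ (d + 1) + 2 ^ (d + 1) := by ring
  have e₃ : 2 ^ (d + 1) = 2 ^ d + 2 ^ d := by ring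
  have hu : u + u + 1 < 2 * 2 ^ h := by
    have : (u + u + 1 + 1) * 1 ≤ (u + u + 1 + 1) * 2 ^ d := Nat.mul_le_mul_left _ hd
    omega
  -- The leaves of the right child are the positions from `e - 2 ^ d` to `e - 1`; their maximum
  -- combined with `acc` gives the tail that decides between the children.
  have hs := hT.node_spec (by positivity) d (u + u + 1) (by omega) (by omega)
  rw [e₁, e₂] at hs
  rcases hs with ⟨_, hs⟩ | ⟨s₁, s₂, s₃, s₄⟩
  · exact absurd (by omega) (hs (e - 2 ^ d) (by simp; omega) (by omega))
  · refine ⟨hu, s₁, fun D => ?_⟩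
    rw [max_le_iff, h₄ D, ← hA]
    constructor
    · rintro ⟨g₁, g₂, g₃⟩
      refine ⟨g₂, fun p hp hp' => ?_⟩
      rcases Nat.lt_or_ge p e with hpe | hpe
      · have := s₄ p (by simp; omega) (by omega) (by omega)
        rw [hA] at g₁ ⊢
        linarith
      · exact g₃ p (by omega) hp'
    · rintro ⟨g₁, g₂⟩
      exact ⟨g₂ _ (by omega) (by omega), g₁, fun p hp hp' => g₂ p (by omega) hp'⟩

theorem DescendInv.left {h n : ℕ} {A Vs : ℕ → ℝ} {q : ℝ} {u d e : ℕ} {acc y : ℝ}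
    (hI : DescendInv h n A Vs q u (d + 1) e acc)
    (hy : ∀ D, y ≤ D ↔ TailLe (2 ^ h - 1) A (e - 2 ^ d - 1) D)
    (hgood : e - 2 ^ d - 1 < n → y ≤ Vs (e - 2 ^ d - 1) + q) :
    DescendInv h n A Vs q (u + u) d (e - 2 ^ d) y := by
  obtain ⟨h₁, h₂, h₃, h₄, -, h₅⟩ := hI
  have e₁ : (u + u) * 2 ^ d = u * 2 ^ (d + 1) := by ring
  have e₃ : 2 ^ (d + 1) = 2 ^ d + 2 ^ d := by ring
  refine ⟨by omega, by omega, (Nat.sub_le _ _).trans h₃, hy, hgood, fun hlt => ?_⟩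
  rw [Nat.sub_sub e, ← e₃]
  exact h₅ (by omega)

theorem DescendInv.right {h n : ℕ} {A Vs : ℕ → ℝ} {q : ℝ} {u d e : ℕ} {acc y : ℝ}
    (hI : DescendInv h n A Vs q u (d + 1) e acc)
    (hy : ∀ D, y ≤ D ↔ TailLe (2 ^ h - 1) A (e - 2 ^ d - 1) D)
    (hlt : e - 2 ^ d - 1 < n) (hbad : Vs (e - 2 ^ d - 1) + q ≤ y) :
    DescendInv h n A Vs q (u + u + 1) d e acc := by
  obtain ⟨h₁, h₂, h₃, h₄, h₅, -⟩ := hI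
  have e₁ : (u + u + 1) * 2 ^ d = u * 2 ^ (d + 1) + 2 ^ d := by ring
  have e₃ : 2 ^ (d + 1) = 2 ^ d + 2 ^ d := by ring
  exact ⟨by omega, by omega, by omega, h₄, h₅, fun _ => ⟨hlt, y, hy, hbad⟩⟩

section

variable {n B : ℕ} (hB : 66 * n + 1200 ≤ B)
include hB

/-- The keys are the negated entries, so the winner of a subtree carries its maximum. The node
shrinks to a single leaf in `h` rounds, and that leaf is the crossing point. -/
theorem descend_spec {s : Store} {h : ℕ} {A : ℕ → ℝ} (h0 : s.w 0 = n) (h1 : s.w 1 = 2 ^ h)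
    (hm : 2 ^ h ≤ 2 * n + 1) (hn : n + 1 ≤ 2 ^ h) (hA : ∀ p, A p = 0 - s.F 10 p)
    (hT : IsTree (2 ^ h) (s.F 10) {i | i < 2 ^ h} ∅ (s.A 0)) :
    WP n B descend s fun t s' => t ≤ 16 * h + 5 ∧ ∃ x, s'.w 11 = x + 1 ∧ x ≤ n ∧
      (∀ D, s'.r 3 ≤ D ↔ TailLe (2 ^ h - 1) A x D) ∧ (x < n → s'.r 3 ≤ s.F 9 x + s.r 1) ∧
      (0 < x → x - 1 < n ∧ ∃ y, (∀ D, y ≤ D ↔ TailLe (2 ^ h - 1) A (x - 1) D) ∧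
        s.F 9 (x - 1) + s.r 1 ≤ y) := by
  have hpos : 0 < 2 ^ h := by positivity
  simp only [descend, wp_seq (c₁ := .rset _ _), wp_seq (c₁ := .wset _ _), wp_rset, wp_wset]
  refine ⟨by simp, by simp, by simp, by simp, ?_⟩
  refine (WP.while_potential (fun φ s' => ∃ d, φ = 16 * d ∧ s'.w 10 = 2 ^ d ∧
    DescendInv h n A (s.F 9) (s.r 1) (s'.w 3) d (s'.w 11) (s'.r 3))
    ⟨h, rfl, by simp [h1], ?_⟩ ?_).mono ?_
  · simp [h1]
    refine ⟨by omega, le_rfl, le_rfl, fun D => ?_, fun h' => by omega, fun h' => by omega⟩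
    exact ⟨fun h => ⟨h, fun p hp hp' => by omega⟩, fun h => h.1⟩
  · rintro φ s' ⟨d, rfl, hd, hI⟩ hF
    have e0 : s'.w 0 = n := by rw [hF.w 0 rfl]; simp [h0]
    have er1 : s'.r 1 = s.r 1 := by rw [hF.r 1 rfl]; simp
    have eA : s'.A 0 = s.A 0 := by rw [hF.A 0 rfl]; simp
    have e9 : s'.F 9 = s.F 9 := by rw [hF.F 9 rfl]; simp
    have e10 : s'.F 10 = s.F 10 := by rw [hF.F 10 rfl]; simp
    refine ⟨by simp, fun hlt => ?_⟩
    simp [hd] at hlt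
    obtain ⟨d, rfl⟩ : ∃ d', d = d' + 1 := ⟨d - 1, by omega⟩
    have hd' : s'.w 10 / 2 = 2 ^ d := by rw [hd, pow_succ]; simp
    obtain ⟨c₁, c₂, c₃⟩ := hI.right_child hA hT
    have e₃ : 2 ^ (d + 1) = 2 ^ d + 2 ^ d := by ring
    have hd0 : 0 < 2 ^ d := by positivity
    have hle := hI.le_end
    have hle' := hI.end_le
    generalize hu : s'.w 3 = u at *
    generalize he : s'.w 11 = e at *
    simp [nop, hd', hu, he, er1, eA, e9, e10, e0]
    have hback : e - 2 ^ d + 2 ^ d = e := by omega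
    rw [hback]
    rw [zero_sub] at c₃
    have hB' : u + u + 1 < B := by omega
    refine ⟨⟨⟨⟨by omega, hB'⟩, by omega⟩, by omega⟩, fun g₁ => ⟨fun g₂ => ⟨by omega, fun g₃ => ?_,
      fun g₃ => ?_⟩, fun g₂ => ?_⟩, fun g₁ => ⟨fun g₂ => ⟨by omega, fun g₃ => ?_,
      fun g₃ => ?_⟩, fun g₂ => ?_⟩⟩
    · rw [max_eq_right g₁.le] at c₃
      exact ⟨⟨by omega, hB'⟩, by omega, hI.right c₃ g₂ g₃.le, by omega⟩
    · rw [max_eq_right g₁.le] at c₃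
      exact ⟨by omega, hI.left c₃ fun _ => g₃, by omega⟩
    · rw [max_eq_right g₁.le] at c₃
      exact ⟨by omega, hI.left c₃ fun h => absurd h (not_lt.2 g₂), by omega⟩
    · rw [max_eq_left g₁] at c₃
      exact ⟨⟨by omega, hB'⟩, by omega, hI.right c₃ g₂ g₃.le, by omega⟩
    · rw [max_eq_left g₁] at c₃
      exact ⟨by omega, hI.left c₃ fun _ => g₃, by omega⟩
    · rw [max_eq_left g₁] at c₃
      exact ⟨by omega, hI.left c₃ fun h => absurd h (not_lt.2 g₂), by omega⟩
  · rintro t s' ⟨φ, ⟨d, rfl, hd, hI⟩, hlt, hF, ht⟩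
    simp [hd] at hlt
    subst hlt
    obtain ⟨h₁, h₂, h₃, h₄, h₅, h₆⟩ := hI
    simp at h₁ h₂ h₆
    refine ⟨by omega, s'.w 11 - 1, by omega, ?_, h₄, h₅, fun hx => ?_⟩
    · by_contra hx
      have := (h₆ (by omega)).1
      omega
    · exact h₆ (by omega)

end

end RealRAM

/-! ### The dynamic program in terms of negated keys -/

namespace IntervalSeparation

variable {n h : ℕ} {a b Q Vs : ℕ → ℝ} {ρ : ℕ → ℕ}

/-- The state of the dynamic program before interval `i`; the keys `κ` are the negated values. -/
structure DPLoop (n h : ℕ) (a b Q Vs : ℕ → ℝ) (i : ℕ) (κ : ℕ → ℝ) (lam : ℝ) (lo st : ℕ) : Prop where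
  tail : ∀ p, n < p → p < 2 ^ h → κ p = 0
  zero : i = 0 → (∀ p ≤ n, κ p = 0) ∧ lam = 0 ∧ lo = 0
  succ : ∀ j, i = j + 1 → DPInv n a b Q Vs j (fun p => 0 - κ p) lam lo st

theorem neg_update_min (κ : ℕ → ℝ) (q : ℕ) (x : ℝ) :
    (fun p => 0 - Function.update κ q (min (κ q) (0 - x)) p) =
      Function.update (fun p => 0 - κ p) q (max (0 - κ q) x) := by
  funext p
  rcases eq_or_ne p q with rfl | h
  · simp only [Function.update_self, zero_sub]
    rw [← max_neg_neg, neg_neg]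
  · simp only [Function.update_of_ne h]

theorem DPLoop.step_champ (hV : IsRanking n a b Vs ρ) {i : ℕ} (hi : i < n) {κ : ℕ → ℝ} {lam : ℝ}
    {lo st : ℕ} (hI : DPLoop n h a b Q Vs i κ lam lo st) (hc : champ b i = i) {L : ℝ}
    (hL : IsLocalOpt n Q Vs (fun p => 0 - Function.update κ n (min (κ n) (0 - lam)) p) i
      (max lo (ρ i)) L) :
    DPLoop n h a b Q Vs (i + 1) (Function.update κ n (min (κ n) (0 - lam))) L
      (max lo (ρ i)) (max lo (ρ i)) := by
  refine ⟨fun p hp hp' => ?_, fun h => by omega, fun j hj => ?_⟩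
  · rw [Function.update_of_ne (by omega)]; exact hI.tail p hp hp'
  · obtain rfl : i = j := by omega
    rcases Nat.eq_zero_or_pos i with rfl | hpos
    · obtain ⟨h₁, rfl, rfl⟩ := hI.zero rfl
      rw [Nat.zero_max] at hL ⊢
      refine DPInv.zero hV hi (fun p hp => ?_) hL
      rw [Function.update_apply]
      split_ifs
      · simp [h₁ n le_rfl]
      · simp [h₁ p hp]
    · obtain ⟨j, rfl⟩ : ∃ j, i = j + 1 := ⟨i - 1, by omega⟩
      rw [neg_update_min] at hL ⊢
      exact (hI.succ j rfl).step_champ hV hi hc hL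

theorem DPLoop.step (hV : IsRanking n a b Vs ρ) {i : ℕ} (hi : i < n) {κ : ℕ → ℝ} {lam : ℝ}
    {lo st : ℕ} (hI : DPLoop n h a b Q Vs i κ lam lo st) (hc : champ b i ≠ i) {L : ℝ} {st' : ℕ}
    (hst' : st' = max st (ρ i))
    (hL : IsLocalOpt n Q Vs (fun p => 0 - Function.update κ st' (min (κ st') (0 - lam)) p) i
      st' L) :
    DPLoop n h a b Q Vs (i + 1) (Function.update κ st' (min (κ st') (0 - lam))) (min lam L)
      lo st' := by
  obtain ⟨j, rfl⟩ : ∃ j, i = j + 1 := ⟨i - 1, by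
    have : i ≠ 0 := by rintro rfl; exact hc rfl
    omega⟩
  have hstn : st' < n := by
    rw [hst']; exact max_lt (hI.succ j rfl).st_lt (hV.lt _ hi)
  refine ⟨fun p hp hp' => ?_, fun h => by omega, fun j' hj => ?_⟩
  · rw [Function.update_of_ne (by omega)]; exact hI.tail p hp hp'
  · obtain rfl : j' = j + 1 := by omega
    rw [neg_update_min] at hL ⊢
    exact (hI.succ j rfl).step hV hi hc hst' hL

/-- Leaves behind `n` keep the value `0`, which the condition `0 ≤ D` covers anyway, so the tree may
be longer than the array. -/
theorem DPLoop.tailLe_iff {κ : ℕ → ℝ} (hκ : ∀ p, n < p → p < 2 ^ h → κ p = 0)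
    (hn : n + 1 ≤ 2 ^ h) (v : ℕ) (D : ℝ) :
    TailLe (2 ^ h - 1) (fun p => 0 - κ p) v D ↔ TailLe n (fun p => 0 - κ p) v D := by
  refine and_congr_right fun hD => ⟨fun g p hp hp' => g p hp (by omega), fun g p hp hp' => ?_⟩
  rcases Nat.lt_or_ge n p with hpn | hpn
  · simpa [hκ p hpn (by omega)] using hD
  · exact g p hp hpn

end IntervalSeparation

namespace RealRAM

open IntervalSeparation

/-! ### The dynamic program -/

/-- Determine the first position `w 8` for interval `w 2`, and the position `w 9` to update. -/
def advance : Cmd :=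
  .ite (.weq (wa 2 (wr 2)) (wc 0))
    (.ite (.wlt (wr 8) (wa 4 (wr 2))) (.wset 8 (wa 4 (wr 2))) nop ;; .wset 9 (wr 8))
    (.ite (.wlt (wr 7) (wa 4 (wr 2))) (.wset 7 (wa 4 (wr 2))) nop ;; .wset 8 (wr 7) ;;
      .wset 9 (wr 0))

/-- Raise the value at position `w 9` to `r 0`. -/
def updateKey : Cmd :=
  .rset 2 (rc 0 - rr 0) ;; .ite (.rlt (rr 2) (ra 10 (wr 9))) (.fset 10 (wr 9) (rr 2)) nop ;;
  .wset 3 (wr 1 + wr 9) ;; walkUp 10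

/-- Compute the local optimum from the result of `descend`. -/
def select : Cmd :=
  .wset 5 (wr 11 - wc 1) ;;
  .ite (.wlt (wr 8) (wr 5))
    (.rset 4 (rc 0 - ra 10 (wr 5)) ;; .ite (.rlt (rr 4) (rr 3)) (.rset 4 (rr 3)) nop ;;
      .ite (.wlt (wr 5) (wr 0))
        (.rset 5 (ra 9 (wr 5) + rr 1) ;; .ite (.rlt (rr 5) (rr 4)) (.rset 4 (rr 5)) nop) nop)
    (.rset 4 (ra 9 (wr 8) + rr 1))

/-- Combine the local optimum with the previous ones of the same champion. -/
def combine : Cmd :=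
  .ite (.weq (wa 2 (wr 2)) (wc 0)) (.ite (.rlt (rr 4) (rr 0)) (.rset 0 (rr 4)) nop) (.rset 0 (rr 4))

/-- Compute the smallest feasible delay in the register `0`. -/
def dynamic : Cmd :=
  .wset 2 (wc 0) ;;
  .while (.wlt (wr 2) (wr 1)) (.fset 10 (wr 2) (rc 0) ;; .wset 2 (wr 2 + wc 1)) ;;
  .wset 6 (wr 1) ;; build 10 ;; .rset 0 (rc 0) ;; .wset 7 (wc 0) ;; .wset 8 (wc 0) ;;
  .wset 2 (wc 0) ;;
  forLoop 2 (advance ;; updateKey ;; .rset 1 (ra 8 (wr 2)) ;; descend ;; select ;; combine)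

theorem advance_spec {n B : ℕ} {s : Store} (h : s.w 2 < n) :
    WP n B advance s fun t s' => t ≤ 5 ∧
      (s.A 2 (s.w 2) = 0 → s'.w 7 = s.w 7 ∧ s'.w 8 = max (s.w 8) (s.A 4 (s.w 2)) ∧
        s'.w 9 = s'.w 8) ∧
      (s.A 2 (s.w 2) ≠ 0 → s'.w 7 = max (s.w 7) (s.A 4 (s.w 2)) ∧ s'.w 8 = s'.w 7 ∧
        s'.w 9 = s.w 0) := by
  simp [advance, nop]
  refine ⟨by omega, fun h₁ => ⟨by omega, fun h₂ => ?_, fun h₂ => ?_⟩, fun h₁ =>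
    ⟨by omega, fun h₂ => ?_, fun h₂ => ?_⟩⟩
  all_goals simp [h₁]; try omega

section

variable {n B : ℕ} (hB : 66 * n + 1200 ≤ B)
include hB

theorem updateKey_spec {s : Store} {h : ℕ} (h1 : s.w 1 = 2 ^ h) (hm : 2 ^ h ≤ 2 * n + 1)
    (hq : s.w 9 < 2 ^ h) (hT : IsTree (2 ^ h) (s.F 10) {i | i < 2 ^ h} ∅ (s.A 0)) :
    WP n B updateKey s fun t s' => t ≤ 8 * h + 8 ∧
      s'.F 10 = Function.update (s.F 10) (s.w 9) (min (s.F 10 (s.w 9)) (0 - s.r 0)) ∧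
      IsTree (2 ^ h) (s'.F 10) {i | i < 2 ^ h} ∅ (s'.A 0) := by
  set κ' := Function.update (s.F 10) (s.w 9) (min (s.F 10 (s.w 9)) (0 - s.r 0)) with hκ'
  have hmain : ∀ s₁ : Store, s₁.F 10 = κ' → s₁.A 0 = s.A 0 → s₁.w 1 = 2 ^ h →
      s₁.w 9 = s.w 9 → WP n B (.wset 3 (wr 1 + wr 9) ;; walkUp 10) s₁ fun t s' => t ≤ 8 * h + 2 ∧
        s'.F 10 = κ' ∧ IsTree (2 ^ h) (s'.F 10) {i | i < 2 ^ h} ∅ (s'.A 0) := by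
    intro s₁ e₁ e₂ e₃ e₄
    rw [wp_seq, wp_wset]
    refine ⟨by simp [e₃, e₄]; omega, ?_⟩
    refine (walkUp_spec hB (by norm_num) (al := {i | i < 2 ^ h}) ?_ ?_ ?_ ?_).frame.mono ?_
    · simp [e₃]; omega
    · simp [e₃, e₄]; omega
    · simp [e₃, e₄]; omega
    · simp only [Store.setW_w, Store.setW_F, Store.setW_A, WExp.eval, Op.wval, e₁, e₂, e₃, e₄,
        if_true]
      simp only [show (1 : ℕ) ≠ 3 by norm_num, if_false]
      have := hT.change (κ' := κ') (al' := {i | i < 2 ^ h}) (i := s.w 9) (x := s.w 9) hq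
        (fun j hj => by rw [hκ', Function.update_of_ne hj]) (fun j _ => Iff.rfl)
        (Or.inl ⟨hq, rfl⟩)
      -- All players stay in the tournament, so the leaf entry is already right; only a key has
      -- changed and the walk to the root suffices.
      have hupd : Function.update (s.A 0) (2 ^ h + s.w 9) (s.w 9) = s.A 0 := by
        conv_lhs => rw [← hT.mem _ hq hq]
        rw [hT.mem _ hq hq]
        exact Function.update_eq_self_iff.2 (hT.mem _ hq hq).symm
      rwa [hupd] at this
    · rintro t s' ⟨⟨ht, hT'⟩, hF⟩
      have e10 : s'.F 10 = κ' := by rw [hF.F 10 rfl]; simp [e₁]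
      simp [e₃, e₄, e₁] at ht hT'
      have hlog : Nat.log 2 (2 ^ h + s.w 9) ≤ h := by
        refine Nat.lt_succ_iff.1 (Nat.log_lt_of_lt_pow (by omega) ?_)
        rw [pow_succ]; omega
      exact ⟨by omega, e10, e10 ▸ hT'⟩
  rw [updateKey, wp_seq, wp_rset]
  refine ⟨by simp, ?_⟩
  rw [wp_seq, wp_ite]
  refine ⟨by simp; omega, fun hlt => ?_, fun hlt => ?_⟩
  · simp at hlt
    rw [wp_fset]
    refine ⟨by simp; omega, (hmain _ ?_ ?_ ?_ ?_).mono ?_⟩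
    · simp [hκ', min_eq_right hlt.le]
    · simp
    · simp [h1]
    · simp
    · rintro t s' ⟨ht, h'⟩; exact ⟨by omega, h'⟩
  · simp at hlt
    rw [nop, wp_wset]
    refine ⟨by simp, (hmain _ ?_ ?_ ?_ ?_).mono ?_⟩
    · simp [hκ', min_eq_left hlt]
    · simp
    · simp [h1]
    · simp
    · rintro t s' ⟨ht, h'⟩; exact ⟨by omega, h'⟩

/-- `descend` and `select` compute the local optimum. -/
theorem localOpt_spec {s : Store} {h r : ℕ} {Q : ℕ → ℝ} (h0 : s.w 0 = n) (h1 : s.w 1 = 2 ^ h)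
    (hm : 2 ^ h ≤ 2 * n + 1) (hn : n + 1 ≤ 2 ^ h) (hst : s.w 8 < n) (hQ : s.r 1 = Q r)
    (hVs : ∀ v < n, ∀ u ≤ v, s.F 9 u ≤ s.F 9 v)
    (hκ : ∀ p, n < p → p < 2 ^ h → s.F 10 p = 0)
    (hT : IsTree (2 ^ h) (s.F 10) {i | i < 2 ^ h} ∅ (s.A 0)) :
    WP n B (descend ;; select) s fun t s' => t ≤ 16 * h + 16 ∧
      IsLocalOpt n Q (s.F 9) (fun p => 0 - s.F 10 p) r (s.w 8) (s'.r 4) := by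
  have htail := DPLoop.tailLe_iff hκ hn
  rw [wp_seq]
  refine (descend_spec hB h0 h1 hm hn (fun p => rfl) hT).frame.mono ?_
  rintro t₁ s₁ ⟨⟨ht₁, x, hx, hxn, hacc, hgood, hbad⟩, hF⟩
  have e0 : s₁.w 0 = n := by rw [hF.w 0 rfl, h0]
  have e8 : s₁.w 8 = s.w 8 := hF.w 8 rfl
  have er1 : s₁.r 1 = Q r := by rw [hF.r 1 rfl, hQ]
  have e9 : s₁.F 9 = s.F 9 := hF.F 9 rfl
  have e10 : s₁.F 10 = s.F 10 := hF.F 10 rfl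
  simp only [htail] at hacc hbad
  rw [hQ] at hgood hbad
  have hacc' : 0 < x → ∀ D, max (0 - s.F 10 x) (s₁.r 3) ≤ D ↔
      TailLe n (fun p => 0 - s.F 10 p) (x - 1) D := by
    intro hx0 D
    rw [max_le_iff, hacc]
    constructor
    · rintro ⟨g₁, g₂, g₃⟩
      refine ⟨g₂, fun p hp hp' => ?_⟩
      rcases Nat.lt_or_eq_of_le (show x ≤ p by omega) with h' | rfl
      · exact g₃ p h' hp'
      · exact g₁
    · rintro ⟨g₁, g₂⟩
      exact ⟨g₂ x (by omega) hxn, g₁, fun p hp => g₂ p (by omega)⟩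
  obtain ⟨k₁, k₂, k₃⟩ := isLocalOpt_of (Q := Q) (r := r) (st := s.w 8) hVs hst hacc hacc' hgood
    fun hx0 => by
      obtain ⟨g₁, y, g₂, g₃⟩ := hbad hx0
      refine ⟨g₁, g₃.trans ?_⟩
      rw [g₂]
      exact (hacc' hx0 _).1 le_rfl
  simp [select, nop, hx, e0, e8, e9, e10, er1]
  simp only [zero_sub] at k₁ k₂ k₃
  refine ⟨fun g => ⟨by omega, fun g₁ => ⟨fun g₂ => ⟨by omega, fun g₃ => ⟨by omega, ?_⟩,
    fun g₃ => ⟨by omega, ?_⟩⟩, fun g₂ => ⟨by omega, ?_⟩⟩, fun g₁ => ⟨fun g₂ => ⟨by omega,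
    fun g₃ => ⟨by omega, ?_⟩, fun g₃ => ⟨by omega, ?_⟩⟩, fun g₂ => ⟨by omega, ?_⟩⟩⟩,
    fun g => ⟨by omega, by omega, k₁ g⟩⟩
  · have := k₂ g g₂
    rwa [max_eq_right g₁.le, min_eq_right g₃.le] at this
  · have := k₂ g g₂
    rwa [max_eq_right g₁.le, min_eq_left g₃] at this
  · have := k₃ g (not_lt.2 g₂)
    rwa [max_eq_right g₁.le] at this
  · have := k₂ g g₂
    rwa [max_eq_left g₁, min_eq_right g₃.le] at this
  · have := k₂ g g₂
    rwa [max_eq_left g₁, min_eq_left g₃] at this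
  · have := k₃ g (not_lt.2 g₂)
    rwa [max_eq_left g₁] at this

theorem dynamic_spec {s : Store} {h : ℕ} {a b : ℕ → ℝ} (h0 : s.w 0 = n) (h1 : s.w 1 = 2 ^ h)
    (hm : 2 ^ h ≤ 2 * n + 1) (hn : n + 1 ≤ 2 ^ h) (hpos : 0 < n) (hab : ∀ i < n, a i < b i)
    (hV : IsRanking n a b (s.F 9) (s.A 4)) (hQ : IsDelayBound n a b (s.F 8))
    (hA : ∀ i < n, s.A 2 i = 0 ↔ champ b i ≠ i) :
    WP n B dynamic s fun t s' => t ≤ 17 * 2 ^ h + n * (24 * h + 40) + 20 ∧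
      ∀ D, s'.r 0 ≤ D ↔ Feasible n a b (s.F 8) D := by
  rw [dynamic, wp_seq, wp_wset]
  refine ⟨by simp, ?_⟩
  rw [wp_seq]
  refine (WP.while (fun s' => s'.w 2 ≤ 2 ^ h ∧ ∀ p < s'.w 2, s'.F 10 p = 0)
    (fun s' => 3 * (2 ^ h - s'.w 2)) ?_ ?_).mono ?_
  · simp
  · rintro s' ⟨g₁, g₂⟩ hF
    have e1 : s'.w 1 = 2 ^ h := by rw [hF.w 1 rfl]; simp [h1]
    simp [e1]
    intro hlt
    refine ⟨by omega, by omega, ⟨by omega, fun p hp => ?_⟩, by omega⟩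
    rw [Function.update_apply]
    split_ifs
    · rfl
    · exact g₂ p (by omega)
  rintro t₁ s₁ ⟨⟨g₁, g₂⟩, hb, hF₁, ht₁⟩
  have e1 : s₁.w 1 = 2 ^ h := by rw [hF₁.w 1 rfl]; simp [h1]
  have e0 : s₁.w 0 = n := by rw [hF₁.w 0 rfl]; simp [h0]
  have e8 : s₁.F 8 = s.F 8 := by rw [hF₁.F 8 rfl]; simp
  have e9 : s₁.F 9 = s.F 9 := by rw [hF₁.F 9 rfl]; simp
  have e2 : s₁.A 2 = s.A 2 := by rw [hF₁.A 2 rfl]; simp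
  have e4 : s₁.A 4 = s.A 4 := by rw [hF₁.A 4 rfl]; simp
  simp [e1] at hb ht₁
  rw [show s₁.w 2 = 2 ^ h by omega] at g₂
  rw [wp_seq, wp_wset]
  refine ⟨by simp, ?_⟩
  rw [wp_seq]
  refine (build_spec hB (by norm_num) ?_ ?_).frame.mono ?_
  · simp [e1]; omega
  · simp [e1]; omega
  rintro t₂ s₂ ⟨⟨ht₂, hT₂⟩, hF₂⟩
  simp [e1] at ht₂ hT₂
  have f1 : s₂.w 1 = 2 ^ h := by rw [hF₂.w 1 rfl]; simp [e1]
  have f0 : s₂.w 0 = n := by rw [hF₂.w 0 rfl]; simp [e0]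
  have f8 : s₂.F 8 = s.F 8 := by rw [hF₂.F 8 rfl]; simp [e8]
  have f9 : s₂.F 9 = s.F 9 := by rw [hF₂.F 9 rfl]; simp [e9]
  have f10 : s₂.F 10 = s₁.F 10 := by rw [hF₂.F 10 rfl]; simp
  have f2 : s₂.A 2 = s.A 2 := by rw [hF₂.A 2 rfl]; simp [e2]
  have f4 : s₂.A 4 = s.A 4 := by rw [hF₂.A 4 rfl]; simp [e4]
  simp only [wp_seq (c₁ := .rset _ _), wp_seq (c₁ := .wset _ _), wp_rset, wp_wset]
  refine ⟨by simp, by simp, by simp, by simp, ?_⟩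
  refine (WP.forLoop hB (24 * h + 36) (fun s' =>
    IsTree (2 ^ h) (s'.F 10) {i | i < 2 ^ h} ∅ (s'.A 0) ∧
    DPLoop n h a b (s.F 8) (s.F 9) (s'.w 2) (s'.F 10) (s'.r 0) (s'.w 7) (s'.w 8))
    (by norm_num) rfl rfl (by simp [f0]) ?_ ?_).mono ?_
  · simp [f10]
    exact ⟨hT₂, fun p _ hp => g₂ p hp, fun _ => ⟨fun p hp => g₂ p (by omega), rfl, rfl⟩,
      fun j hj => by omega⟩
  · rintro s' ⟨hT, hI⟩ hF hw0 hlt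
    have k1 : s'.w 1 = 2 ^ h := by rw [hF.w 1 rfl]; simp [f1]
    have k8 : s'.F 8 = s.F 8 := by rw [hF.F 8 rfl]; simp [f8]
    have k9 : s'.F 9 = s.F 9 := by rw [hF.F 9 rfl]; simp [f9]
    have k2 : s'.A 2 = s.A 2 := by rw [hF.A 2 rfl]; simp [f2]
    have k4 : s'.A 4 = s.A 4 := by rw [hF.A 4 rfl]; simp [f4]
    generalize hi : s'.w 2 = i at *
    have hρ := hV.lt i hlt
    rw [wp_seq]
    refine (advance_spec (n := n) (by omega)).frame.mono ?_
    rintro t₃ s₃ ⟨⟨ht₃, p₁, p₂⟩, hF₃⟩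
    rw [k2, hi, k4, hw0] at p₂
    rw [k2, hi, k4] at p₁
    have hst : s₃.w 8 < n ∧ s₃.w 9 < 2 ^ h := by
      by_cases hc : s.A 2 i = 0
      · obtain ⟨_, q₁, q₂⟩ := p₁ hc
        obtain ⟨j, rfl⟩ : ∃ j, i = j + 1 := ⟨i - 1, by
          have : i ≠ 0 := by rintro rfl; exact (hA 0 hlt).1 hc rfl
          omega⟩
        have := (hI.succ j rfl).st_lt
        omega
      · obtain ⟨q₀, q₁, q₂⟩ := p₂ hc
        have : s'.w 7 < n := by
          rcases Nat.eq_zero_or_pos i with rfl | hi0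
          · rw [(hI.zero rfl).2.2]; omega
          · have hj := hI.succ (i - 1) (by omega)
            have h₁ := hj.st_lt
            have := ((hj.st_le _ h₁).1 le_rfl).1
            omega
        omega
    have l0 : s₃.w 0 = n := by rw [hF₃.w 0 rfl, hw0]
    have l1 : s₃.w 1 = 2 ^ h := by rw [hF₃.w 1 rfl, k1]
    have l2 : s₃.w 2 = i := by rw [hF₃.w 2 rfl, hi]
    have lA : s₃.A 0 = s'.A 0 := hF₃.A 0 rfl
    have l10 : s₃.F 10 = s'.F 10 := hF₃.F 10 rfl
    have lr : s₃.r 0 = s'.r 0 := hF₃.r 0 rfl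
    rw [wp_seq]
    refine (updateKey_spec hB l1 hm hst.2 (by rwa [lA, l10])).frame.mono ?_
    rintro t₄ s₄ ⟨⟨ht₄, hκ, hT₄⟩, hF₄⟩
    rw [l10, lr] at hκ
    have m0 : s₄.w 0 = n := by rw [hF₄.w 0 rfl, l0]
    have m1 : s₄.w 1 = 2 ^ h := by rw [hF₄.w 1 rfl, l1]
    have m2 : s₄.w 2 = i := by rw [hF₄.w 2 rfl, l2]
    have m8 : s₄.F 8 = s.F 8 := by rw [hF₄.F 8 rfl, hF₃.F 8 rfl, k8]
    have m9 : s₄.F 9 = s.F 9 := by rw [hF₄.F 9 rfl, hF₃.F 9 rfl, k9]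
    have mw8 : s₄.w 8 = s₃.w 8 := hF₄.w 8 rfl
    have mw7 : s₄.w 7 = s₃.w 7 := hF₄.w 7 rfl
    have mr : s₄.r 0 = s'.r 0 := by rw [hF₄.r 0 rfl, lr]
    have mA2 : s₄.A 2 = s.A 2 := by rw [hF₄.A 2 rfl, hF₃.A 2 rfl, k2]
    rw [wp_seq, wp_rset]
    refine ⟨by simp [m2]; omega, ?_⟩
    have hassoc : ∀ {c₁ c₂ c₃ : Cmd} {s : Store} {P : ℕ → Store → Prop},
        (WP n B (c₁ ;; c₂) s fun t s' => WP n B c₃ s' fun t' => P (t + t')) →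
          WP n B (c₁ ;; c₂ ;; c₃) s P := by
      intro c₁ c₂ c₃ s P h
      simpa [add_assoc] using h
    refine hassoc ?_
    have hκ0 : ∀ p, n < p → p < 2 ^ h → s₄.F 10 p = 0 := by
      intro p hp hp'
      rw [hκ, Function.update_apply]
      split_ifs with h'
      · exfalso
        by_cases hc : s.A 2 i = 0
        · have := (p₁ hc).2.2; omega
        · have := (p₂ hc).2.2; omega
      · exact hI.tail p hp hp'
    refine (localOpt_spec hB (r := i) (Q := s.F 8) (h := h) ?_ ?_ hm hn ?_ ?_ ?_ ?_ ?_).frame.mono ?_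
    · simp [m0]
    · simp [m1]
    · simp [mw8, hst.1]
    · simp [m8, m2]
    · simp [m9]; exact hV.mono
    · simpa using hκ0
    · simpa using hT₄
    rintro t₅ s₅ ⟨⟨ht₅, hL⟩, hF₅⟩
    simp only [Store.setR_F, m9, Store.setR_w, mw8] at hL
    have n2 : s₅.w 2 = i := by rw [hF₅.w 2 rfl]; simp [m2]
    have n7 : s₅.w 7 = s₃.w 7 := by rw [hF₅.w 7 rfl]; simp [mw7]
    have n8 : s₅.w 8 = s₃.w 8 := by rw [hF₅.w 8 rfl]; simp [mw8]
    have nr : s₅.r 0 = s'.r 0 := by rw [hF₅.r 0 rfl]; simp [mr]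
    have nA2 : s₅.A 2 = s.A 2 := by rw [hF₅.A 2 rfl]; simp [mA2]
    have nA0 : s₅.A 0 = s₄.A 0 := by rw [hF₅.A 0 rfl]; simp
    have n10 : s₅.F 10 = s₄.F 10 := by rw [hF₅.F 10 rfl]; simp
    have hmin : s.A 2 i = 0 → DPLoop n h a b (s.F 8) (s.F 9) (i + 1) (s₄.F 10)
        (min (s'.r 0) (s₅.r 4)) (s₃.w 7) (s₃.w 8) := by
      intro hc
      obtain ⟨q₀, q₁, q₂⟩ := p₁ hc
      rw [hκ, q₀, q₂]
      rw [hκ, q₂] at hL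
      exact hI.step hV hlt ((hA i hlt).1 hc) q₁ hL
    have hset : s.A 2 i ≠ 0 → DPLoop n h a b (s.F 8) (s.F 9) (i + 1) (s₄.F 10)
        (s₅.r 4) (s₃.w 7) (s₃.w 8) := by
      intro hc
      obtain ⟨q₀, q₁, q₂⟩ := p₂ hc
      rw [hκ, q₂, q₁, q₀]
      rw [hκ, q₂, q₁, q₀] at hL
      exact hI.step_champ hV hlt (not_not.1 (mt (hA i hlt).2 hc)) hL
    simp [combine, nop, n2, n7, n8, nA2, n10, nr, nA0]
    refine ⟨by omega, fun hc => ⟨fun h' => ⟨by omega, hT₄, ?_⟩, fun h' => ⟨by omega, hT₄, ?_⟩⟩,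
      fun hc => ⟨by omega, hT₄, hset hc⟩⟩
    · have := hmin hc; rwa [min_eq_right h'.le] at this
    · have := hmin hc; rwa [min_eq_left h'] at this
  · rintro t s' ⟨⟨hT, hI⟩, _, h₂, hF, ht⟩
    simp at h₂ ht
    rw [h₂] at hI
    refine ⟨?_, (hI.succ (n - 1) (by omega)).lam_le_iff_feasible hV hab hQ hpos⟩
    rw [show 24 * h + 36 + 2 = 24 * h + 38 by omega, mul_comm] at ht
    have : n * (24 * h + 40) = n * (24 * h + 38) + n * 2 := by ring
    omega

end

end RealRAM

namespace RealRAM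

open IntervalSeparation

/-! ### Producing the positions -/

/-- Schedule interval `w 3` at the time `r 1` or later. -/
def emit : Cmd :=
  .rset 3 (rr 1) ;; .ite (.rlt (rr 3) (ra 2 (wr 3))) (.rset 3 (ra 2 (wr 3))) nop ;;
  .fset 10 (wr 3) (rr 3) ;; .rset 1 (rr 3 + (ra 3 (wr 3) - ra 2 (wr 3)))

/-- Of the interval `w 2` and the interval `w 9`, schedule one and hold back the other. -/
def proceed : Cmd :=
  .wset 3 (wr 2) ;;
  .ite (.weq (wr 7) (wc 0))
    (.ite (.rlt (ra 3 (wr 2)) (ra 3 (wr 9))) nop (.wset 3 (wr 9) ;; .wset 9 (wr 2)))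
    (.wset 3 (wr 9) ;; .wset 9 (wr 2)) ;;
  emit ;; .wset 7 (wc 0) ;; .ite (.weq (wa 2 (wr 2)) (wc 0)) nop (.wset 8 (wc 0))

/-- Move the current champion behind the interval `w 2`, if the delay allows it. -/
def settle : Cmd :=
  .ite (.weq (wr 8) (wc 0))
    (.rset 3 (rr 2) ;; .ite (.rlt (rr 3) (ra 5 (wr 2))) (.rset 3 (ra 5 (wr 2))) nop ;;
      .ite (.rlt (rr 0) (rr 3 + ra 8 (wr 2))) nop
        (.wset 8 (wc 1) ;; .wset 7 (wc 1) ;; .rset 2 (rr 3)))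
    nop

/-- Compute a schedule with delays at most `r 0`. -/
def schedule : Cmd :=
  .rset 1 (ra 2 (wc 0)) ;; .rset 2 (ra 5 (wc 0)) ;; .wset 7 (wc 0) ;; .wset 8 (wc 0) ;;
  .wset 9 (wc 0) ;; .wset 2 (wc 0) ;;
  forLoop 2 (.ite (.wlt (wc 0) (wr 2)) proceed nop ;; settle) ;;
  .wset 3 (wr 9) ;; emit

/-- Translate the schedule back and return to the original order. -/
def unsort : Cmd :=
  .rset 1 (rr 0 * rc (1 / 2)) ;; .wset 2 (wc 0) ;;
  forLoop 2 (.fset 11 (wa 1 (wr 2)) (ra 10 (wr 2) - rr 1))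

/-- Copy the result to its place. -/
def store : Cmd := .wset 2 (wc 64) ;; forLoop 2 (.fset 16 (wr 2) (ra 11 (wr 2)))

theorem emit_spec {n B : ℕ} {s : Store} {i : ℕ} {x y : ℝ} (hi : i < n) (h3 : s.w 3 = i)
    (ha : s.F 2 i = x) (hb : s.F 3 i = y) :
    WP n B emit s fun t s' => t ≤ 5 ∧ s'.r 1 = max (s.r 1) x + (y - x) ∧
      s'.F 10 = Function.update (s.F 10) i (max (s.r 1) x) := by
  simp [emit, nop, h3, ha, hb]
  refine ⟨by omega, fun h => ⟨by omega, ?_⟩, fun h => ⟨by omega, ?_⟩⟩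
  · simp [max_eq_right h.le]
  · simp [h]

theorem proceed_spec {n B : ℕ} {s : Store} {a b Q : ℕ → ℝ} {D : ℝ} {χ : ℕ → ℕ} {r : ℕ}
    (hab : ∀ i < n, a i < b i) (hs : ∀ j < n, ∀ i ≤ j, a i ≤ a j) (ha : ∀ i < n, s.F 2 i = a i)
    (hb : ∀ i < n, s.F 3 i = b i) (hA : ∀ i < n, s.A 2 i = 0 ↔ champ b i ≠ i)
    (hQ : IsDelayBound n a b Q) (hχ : IsChoice n a b Q D χ) (hr : r + 1 < n) (h2 : s.w 2 = r + 1)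
    (h : EmitInv n a b Q D χ r (r + 1) (s.r 1) (s.r 2) (s.w 7) (s.w 8) (s.w 9) (s.F 10)) :
    WP n B proceed s fun t s' => t ≤ 16 ∧ s'.w 7 = 0 ∧
      EmitInv n a b Q D χ (r + 1) (r + 1) (s'.r 1) (s'.r 2) 0 (s'.w 8) (s'.w 9) (s'.F 10) := by
  have hp := h.pend_le
  -- The common end of all branches, where `i` is the interval to be scheduled now.
  have hfin : ∀ {s₁ : Store} {i : ℕ}, i < n → s₁.w 2 = r + 1 → s₁.w 3 = i → s₁.F 2 = s.F 2 →
      s₁.F 3 = s.F 3 → s₁.r 1 = s.r 1 → s₁.r 2 = s.r 2 → s₁.w 8 = s.w 8 → s₁.F 10 = s.F 10 →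
      s₁.A 2 = s.A 2 → (∀ dn', (champ b (r + 1) = r + 1 → dn' = 0) →
        (champ b (r + 1) ≠ r + 1 → dn' = s.w 8) → EmitInv n a b Q D χ (r + 1) (r + 1)
          (max (s.r 1) (a i) + (b i - a i)) (s.r 2) 0 dn' (s₁.w 9)
          (Function.update (s.F 10) i (max (s.r 1) (a i)))) →
      WP n B (emit ;; .wset 7 (wc 0) ;; .ite (.weq (wa 2 (wr 2)) (wc 0)) nop (.wset 8 (wc 0))) s₁
        fun t s' => t ≤ 9 ∧ s'.w 7 = 0 ∧ EmitInv n a b Q D χ (r + 1) (r + 1) (s'.r 1) (s'.r 2) 0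
          (s'.w 8) (s'.w 9) (s'.F 10) := by
    intro s₁ i hi e2 e3 ea eb er1 er2 e8 e10 eA hI
    rw [wp_seq]
    refine (emit_spec hi e3 (by rw [ea, ha i hi]) (by rw [eb, hb i hi])).frame.mono ?_
    rintro t s' ⟨⟨ht, h₁, h₂⟩, hF⟩
    have f2 : s'.w 2 = r + 1 := by rw [hF.w 2 rfl, e2]
    have f8 : s'.w 8 = s.w 8 := by rw [hF.w 8 rfl, e8]
    have f9 : s'.w 9 = s₁.w 9 := hF.w 9 rfl
    have fr2 : s'.r 2 = s.r 2 := by rw [hF.r 2 rfl, er2]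
    have fA : s'.A 2 = s.A 2 := by rw [hF.A 2 rfl, eA]
    simp [nop, f2, f9, fr2, fA, h₁, h₂, f8, er1, e10, hA (r + 1) hr]
    refine ⟨by omega, fun hc => ⟨by omega, hI _ (fun h => absurd h hc) fun _ => rfl⟩,
      fun hc => ⟨by omega, hI _ (fun _ => rfl) fun h => absurd hc h⟩⟩
  have hnew : s.w 7 = 0 → b (r + 1) < b (s.w 9) → ∀ dn', (champ b (r + 1) = r + 1 → dn' = 0) →
        (champ b (r + 1) ≠ r + 1 → dn' = s.w 8) → EmitInv n a b Q D χ (r + 1) (r + 1)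
          (max (s.r 1) (a (r + 1)) + (b (r + 1) - a (r + 1))) (s.r 2) 0 dn' (s.w 9)
          (Function.update (s.F 10) (r + 1) (max (s.r 1) (a (r + 1)))) := by
    intro h7 hlt dn' _ hdn
    rw [h7] at h
    obtain ⟨hc, hI⟩ := h.emit_new hQ hab hs hr hlt
    rwa [hdn hc]
  have hpend : (s.w 7 ≠ 0 ∨ b (s.w 9) ≤ b (r + 1)) → ∀ dn', (champ b (r + 1) = r + 1 → dn' = 0) →
        (champ b (r + 1) ≠ r + 1 → dn' = s.w 8) → EmitInv n a b Q D χ (r + 1) (r + 1)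
          (max (s.r 1) (a (s.w 9)) + (b (s.w 9) - a (s.w 9))) (s.r 2) 0 dn' (r + 1)
          (Function.update (s.F 10) (s.w 9) (max (s.r 1) (a (s.w 9)))) :=
    fun hfl dn' h₁ h₂ => h.emit_pend hQ hab hχ hr hfl h₁ h₂
  rw [proceed, wp_seq, wp_wset]
  refine ⟨by simp, ?_⟩
  rw [wp_seq, wp_ite]
  refine ⟨by simp, fun h7 => ?_, fun h7 => ?_⟩
  · simp at h7
    rw [wp_ite]
    refine ⟨by simp [h2]; omega, fun hlt => ?_, fun hlt => ?_⟩
    · simp [h2, hb _ hr, hb _ (show s.w 9 < n by omega)] at hlt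
      rw [nop, wp_wset]
      refine ⟨by simp, (hfin hr ?_ ?_ ?_ ?_ ?_ ?_ ?_ ?_ ?_ ?_).mono ?_⟩
      all_goals try simp [h2]
      · simpa [h2] using hnew h7 hlt
      · intro t s' ht h₁ h₂; exact ⟨by omega, h₁, h₂⟩
    · simp [h2, hb _ hr, hb _ (show s.w 9 < n by omega)] at hlt
      simp only [wp_seq (c₁ := .wset _ _), wp_wset]
      refine ⟨by simp, by simp, (hfin (i := s.w 9) (by omega) ?_ ?_ ?_ ?_ ?_ ?_ ?_ ?_ ?_ ?_).mono ?_⟩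
      all_goals try simp [h2]
      · simpa [h2] using hpend (Or.inr hlt)
      · intro t s' ht h₁ h₂; exact ⟨by omega, h₁, h₂⟩
  · simp at h7
    simp only [wp_seq (c₁ := .wset _ _), wp_wset]
    refine ⟨by simp, by simp, (hfin (i := s.w 9) (by omega) ?_ ?_ ?_ ?_ ?_ ?_ ?_ ?_ ?_ ?_).mono ?_⟩
    all_goals try simp [h2]
    · simpa [h2] using hpend (Or.inl h7)
    · intro t s' ht h₁ h₂; exact ⟨by omega, h₁, h₂⟩

theorem settle_spec {n B : ℕ} {s : Store} {a b Q : ℕ → ℝ} {χ : ℕ → ℕ} {r : ℕ}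
    (hab : ∀ i < n, a i < b i) (hs : ∀ j < n, ∀ i ≤ j, a i ≤ a j) (hidle : s.F 5 r = idle a b r)
    (hQ' : s.F 8 r = Q r) (hQ : IsDelayBound n a b Q) (hχ : IsChoice n a b Q (s.r 0) χ) (hr : r < n)
    (h2 : s.w 2 = r) (h7 : s.w 7 = 0)
    (h : EmitInv n a b Q (s.r 0) χ r r (s.r 1) (s.r 2) 0 (s.w 8) (s.w 9) (s.F 10)) :
    WP n B settle s fun t s' => t ≤ 8 ∧ EmitInv n a b Q (s.r 0) χ r (r + 1) (s'.r 1) (s'.r 2)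
      (s'.w 7) (s'.w 8) (s'.w 9) (s'.F 10) := by
  have hdec : s.w 8 = 0 → max (s.r 2) (idle a b r) + Q r ≤ s.r 0 →
      EmitInv n a b Q (s.r 0) χ r (r + 1) (s.r 1) (max (s.r 2) (idle a b r)) 1 1 (s.w 9)
        (s.F 10) := fun h8 hD => by
    rw [h8] at h; exact h.decide hQ hab hs hχ hr hD
  have hskip : s.w 8 = 0 → ¬ max (s.r 2) (idle a b r) + Q r ≤ s.r 0 →
      EmitInv n a b Q (s.r 0) χ r (r + 1) (s.r 1) (s.r 2) 0 0 (s.w 9) (s.F 10) := fun h8 hD => by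
    rw [h8] at h; exact h.skip hχ hr hD
  simp [settle, nop, h2, hidle, hQ', h7]
  refine ⟨fun h8 => ⟨by omega, fun g => ⟨by omega, fun g₁ => ?_, fun g₁ => ?_⟩,
    fun g => ⟨by omega, fun g₁ => ?_, fun g₁ => ?_⟩⟩, fun h8 => h.of_done h8⟩
  · rw [h8]; exact hskip h8 (by rw [max_eq_right g.le]; exact not_le.2 g₁)
  · have := hdec h8 (by rw [max_eq_right g.le]; exact g₁)
    rwa [max_eq_right g.le] at this
  · rw [h8]; exact hskip h8 (by rw [max_eq_left g]; exact not_le.2 g₁)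
  · have := hdec h8 (by rw [max_eq_left g]; exact g₁)
    rwa [max_eq_left g] at this

section

variable {n B : ℕ} (hB : 66 * n + 1200 ≤ B)
include hB

/-- The witness `χ` of feasibility occurs in the invariant only. The program does not need it,
because it settles each champion at the first index that passes the test. -/
theorem schedule_spec {s : Store} {a b : ℕ → ℝ} (h0 : s.w 0 = n) (hn : 0 < n)
    (hab : ∀ i < n, a i < b i) (hs : ∀ j < n, ∀ i ≤ j, a i ≤ a j) (ha : ∀ i < n, s.F 2 i = a i)
    (hb : ∀ i < n, s.F 3 i = b i) (hA : ∀ i < n, s.A 2 i = 0 ↔ champ b i ≠ i)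
    (hidle : ∀ i < n, s.F 5 i = idle a b i) (hQ : IsDelayBound n a b (s.F 8))
    (hfeas : Feasible n a b (s.F 8) (s.r 0)) :
    WP n B schedule s fun t s' => t ≤ 28 * n + 20 ∧ IsSchedule n a b (s.r 0) (s'.F 10) := by
  obtain ⟨χ, hχ⟩ := hfeas
  simp only [schedule, wp_seq (c₁ := .rset _ _), wp_seq (c₁ := .wset _ _), wp_rset, wp_wset]
  refine ⟨by simp, by simp, by simp, by simp, by simp, by simp, ?_⟩
  rw [wp_seq]
  refine (WP.forLoop hB 26 (fun s' =>
    (s'.w 2 = 0 → s'.r 1 = a 0 ∧ s'.r 2 = idle a b 0 ∧ s'.w 7 = 0 ∧ s'.w 8 = 0 ∧ s'.w 9 = 0) ∧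
    ∀ j, s'.w 2 = j + 1 → EmitInv n a b (s.F 8) (s.r 0) χ j (j + 1) (s'.r 1) (s'.r 2) (s'.w 7)
      (s'.w 8) (s'.w 9) (s'.F 10)) (by norm_num) rfl rfl (by simp [h0]) ?_ ?_).mono ?_
  · simp [ha 0 hn, hidle 0 hn]
  · rintro s' ⟨g₁, g₂⟩ hF hw0 hlt
    have k0 : s'.r 0 = s.r 0 := by rw [hF.r 0 rfl]; simp
    have k2 : s'.F 2 = s.F 2 := by rw [hF.F 2 rfl]; simp
    have k3 : s'.F 3 = s.F 3 := by rw [hF.F 3 rfl]; simp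
    have k5 : s'.F 5 = s.F 5 := by rw [hF.F 5 rfl]; simp
    have k8 : s'.F 8 = s.F 8 := by rw [hF.F 8 rfl]; simp
    have kA : s'.A 2 = s.A 2 := by rw [hF.A 2 rfl]; simp
    generalize hi : s'.w 2 = i at *
    have hfin : ∀ {s₁ : Store} {t₁ : ℕ}, t₁ ≤ 17 → s₁.w 2 = i → s₁.r 0 = s.r 0 →
        s₁.F 5 = s.F 5 → s₁.F 8 = s.F 8 → s₁.w 7 = 0 →
        EmitInv n a b (s.F 8) (s.r 0) χ i i (s₁.r 1) (s₁.r 2) 0 (s₁.w 8) (s₁.w 9) (s₁.F 10) →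
        WP n B settle s₁ fun t s₂ => t₁ + t ≤ 26 ∧
          (((s₂.setW 2 (i + 1)).w 2 = 0 → (s₂.setW 2 (i + 1)).r 1 = a 0 ∧
            (s₂.setW 2 (i + 1)).r 2 = idle a b 0 ∧ (s₂.setW 2 (i + 1)).w 7 = 0 ∧
            (s₂.setW 2 (i + 1)).w 8 = 0 ∧ (s₂.setW 2 (i + 1)).w 9 = 0) ∧
          ∀ j, (s₂.setW 2 (i + 1)).w 2 = j + 1 → EmitInv n a b (s.F 8) (s.r 0) χ j (j + 1)
            ((s₂.setW 2 (i + 1)).r 1) ((s₂.setW 2 (i + 1)).r 2) ((s₂.setW 2 (i + 1)).w 7)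
            ((s₂.setW 2 (i + 1)).w 8) ((s₂.setW 2 (i + 1)).w 9) ((s₂.setW 2 (i + 1)).F 10)) := by
      intro s₁ t₁ ht₁ e2 e0 e5 e8 e7 hI
      refine (settle_spec (Q := s.F 8) (χ := χ) (r := i) hab hs (by rw [e5, hidle i hlt])
        (by rw [e8]) hQ (by rw [e0]; exact hχ) hlt e2 e7 (by rw [e0]; exact hI)).mono ?_
      rintro t s₂ ⟨ht, hI'⟩
      rw [e0] at hI'
      refine ⟨by omega, fun h => by simp at h, fun j hj => ?_⟩
      simp at hj
      subst hj
      simpa using hI'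
    rw [wp_seq, wp_ite]
    refine ⟨by simp, fun hpos => ?_, fun hpos => ?_⟩
    · simp [hi] at hpos
      obtain ⟨r, rfl⟩ : ∃ r, i = r + 1 := ⟨i - 1, by omega⟩
      refine (proceed_spec (Q := s.F 8) (D := s.r 0) (χ := χ) hab hs (by rwa [k2]) (by rwa [k3])
        (by rwa [kA]) hQ hχ hlt hi (g₂ r rfl)).frame.mono ?_
      rintro t₁ s₁ ⟨⟨ht₁, h7, hI⟩, hF₁⟩
      exact hfin (by omega) (by rw [hF₁.w 2 rfl, hi]) (by rw [hF₁.r 0 rfl, k0])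
        (by rw [hF₁.F 5 rfl, k5]) (by rw [hF₁.F 8 rfl, k8]) h7 hI
    · simp [hi] at hpos
      subst hpos
      obtain ⟨e1, e2, e7, e8, e9⟩ := g₁ rfl
      rw [nop, wp_wset]
      refine ⟨by simp, hfin (by omega) (by simp [hi]) (by simp [k0]) (by simp [k5]) (by simp [k8])
        (by simp [e7]) ?_⟩
      simpa [e1, e2, e8, e9] using EmitInv.zero hχ hn _
  · rintro t s' ⟨⟨_, g⟩, _, h₂, hF, ht⟩
    simp at h₂ ht
    have k2 : s'.F 2 = s.F 2 := by rw [hF.F 2 rfl]; simp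
    have k3 : s'.F 3 = s.F 3 := by rw [hF.F 3 rfl]; simp
    have hI := g (n - 1) (by omega)
    have hp := hI.pend_le
    rw [show n - 1 + 1 = n by omega] at hI
    rw [wp_seq, wp_wset]
    refine ⟨by simp, (emit_spec (i := s'.w 9) (x := a (s'.w 9)) (y := b (s'.w 9)) (by omega)
      ?_ ?_ ?_).mono ?_⟩
    · simp
    · simpa [k2] using ha _ (by omega)
    · simpa [k3] using hb _ (by omega)
    rintro t₁ s₁ ⟨ht₁, _, h10⟩
    refine ⟨by omega, ?_⟩
    rw [h10]
    simpa using hI.final hab hχ hn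

theorem unsort_spec {s : Store} {κ : ℕ → ℝ} (h0 : s.w 0 = n) (hσ : SortedBy n κ (s.A 1)) :
    WP n B unsort s fun t s' => t ≤ 3 * n + 3 ∧
      ∀ i < n, s'.F 11 (s.A 1 i) = s.F 10 i - s.r 0 / 2 := by
  simp only [unsort, wp_seq (c₁ := .rset _ _), wp_seq (c₁ := .wset _ _), wp_rset, wp_wset]
  refine ⟨by simp, by simp, ?_⟩
  refine (WP.forLoop hB 1 (fun s' => ∀ i < s'.w 2, s'.F 11 (s.A 1 i) = s.F 10 i - s.r 0 / 2)
    (by norm_num) rfl rfl (by simp [h0]) ?_ ?_).mono ?_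
  · simp
  · rintro s' g hF hw0 hlt
    have e1 : s'.r 1 = s.r 0 / 2 := by rw [hF.r 1 rfl]; simp; ring
    have e10 : s'.F 10 = s.F 10 := by rw [hF.F 10 rfl]; simp
    have eA : s'.A 1 = s.A 1 := by rw [hF.A 1 rfl]; simp
    have := hσ.lt _ hlt
    simp [eA, e1, e10]
    refine ⟨by omega, fun i hi => ?_⟩
    rcases Nat.lt_or_eq_of_le hi with h' | rfl
    · rw [Function.update_of_ne (hσ.ne _ hlt i h')]; exact g i h'
    · simp
  · rintro t s' ⟨g, _, h₂, hF, ht⟩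
    simp at h₂ ht
    rw [h₂] at g
    exact ⟨by omega, g⟩

/-- Output cells below 64 are still in use as registers and temporaries; they are filled after the
structured program has ended. -/
theorem store_spec {s : Store} (h0 : s.w 0 = n) :
    WP n B store s fun t s' => t ≤ 3 * n + 3 ∧ ∀ i, 64 ≤ i → i < n → s'.F 16 i = s.F 11 i := by
  rw [store, wp_seq, wp_wset]
  refine ⟨by simp, (WP.forLoop hB 1 (fun s' => 64 ≤ s'.w 2 ∧ ∀ i, 64 ≤ i → i < s'.w 2 →
    s'.F 16 i = s.F 11 i) (by norm_num) rfl rfl (by simp [h0]) ?_ ?_).mono ?_⟩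
  · simp; intro i hi hi'; omega
  · rintro s' ⟨g, g'⟩ hF hw0 hlt
    have e11 : s'.F 11 = s.F 11 := by rw [hF.F 11 rfl]; simp
    simp [e11]
    refine ⟨by omega, by omega, fun i hi hi' => ?_⟩
    rcases Nat.lt_or_eq_of_le hi' with h' | rfl
    · rw [Function.update_of_ne h'.ne]; exact g' i hi h'
    · simp
  · rintro t s' ⟨⟨_, g⟩, _, h₂, hF, ht⟩
    simp at ht
    exact ⟨by omega, fun i hi hi' => g i hi (by omega)⟩

end

end RealRAM

namespace IntervalSeparation

open RealRAM

/-! ### From schedules to optimal separations -/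

theorem not_overlap_Icc_iff {p q l m : ℝ} (hl : 0 < l) (hm : 0 < m) :
    ¬ Overlap (Set.Icc p (p + l)) (Set.Icc q (q + m)) ↔ p + l ≤ q ∨ q + m ≤ p := by
  constructor
  · intro h
    by_contra! h'
    -- The two points are the ends of the intersection.
    refine h ⟨max p q, ⟨⟨le_max_left _ _, ?_⟩, le_max_right _ _, ?_⟩, min (p + l) (q + m),
      ⟨⟨?_, min_le_left _ _⟩, ?_, min_le_right _ _⟩, ne_of_lt ?_⟩ <;> simp <;> constructor <;>
      first | constructor <;> linarith | linarith
  · rintro h ⟨x, ⟨⟨h₁, h₂⟩, h₃, h₄⟩, y, ⟨⟨h₅, h₆⟩, h₇, h₈⟩, hne⟩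
    rcases h with h | h <;> exact hne (by linarith)

theorem abs_sub_le_maxMove {n : ℕ} (a x : Fin n → ℝ) (i : Fin n) : |x i - a i| ≤ maxMove a x :=
  le_ciSup (f := fun i => |x i - a i|) (Set.finite_range _).bddAbove i

theorem isOptimalSeparation_of_isEmpty {n : ℕ} (hn : n = 0) (a b x : Fin n → ℝ) :
    IsOptimalSeparation a b x := by
  subst hn
  exact ⟨fun i => i.elim0, fun y _ => by rw [Subsingleton.elim x y]⟩

/-- Moving left by half of the least maximum delay turns an optimal schedule for moves to the right
into an optimal separation. -/
theorem IsSchedule.isOptimalSeparation {n : ℕ} (hn : 0 < n) {a b x : Fin n → ℝ} {α β : ℕ → ℝ}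
    {Q s : ℕ → ℝ} {σ : ℕ → ℕ} {D : ℝ} (hab : ∀ i, a i < b i) (ha : ∀ i : Fin n, α i = a i)
    (hb : ∀ i : Fin n, β i = b i) (hσ : SortedBy n α σ)
    (hs : IsSchedule n (fun i => α (σ i)) (fun i => β (σ i)) D s)
    (hQ : IsDelayBound n (fun i => α (σ i)) (fun i => β (σ i)) Q)
    (hD : ∀ D', D ≤ D' ↔ Feasible n (fun i => α (σ i)) (fun i => β (σ i)) Q D')
    (hx : ∀ i < n, ∀ h : σ i < n, x ⟨σ i, h⟩ = s i - D / 2) : IsOptimalSeparation a b x := by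
  have hab' : ∀ i < n, α (σ i) < β (σ i) := fun i hi => by
    simpa [ha ⟨σ i, hσ.lt i hi⟩, hb ⟨σ i, hσ.lt i hi⟩] using hab ⟨σ i, hσ.lt i hi⟩
  have hmono : ∀ j < n, ∀ i ≤ j, α (σ i) ≤ α (σ j) := fun j hj i hi => by
    rcases Nat.lt_or_eq_of_le hi with h | rfl
    · exact hσ.le j hj i h
    · exact le_rfl
  have hsur : ∀ j : Fin n, ∃ i, ∃ hi : i < n, j = ⟨σ i, hσ.lt i hi⟩ := fun j => by
    obtain ⟨i, hi, h⟩ := hσ.exists_eq j.2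
    exact ⟨i, hi, Fin.ext h.symm⟩
  have hinj : ∀ i < n, ∀ j < n, i ≠ j → σ i ≠ σ j := fun i hi j hj hij => by
    rcases lt_or_gt_of_ne hij with h | h
    · exact hσ.ne j hj i h
    · exact (hσ.ne i hi j h).symm
  have hsep : ∀ (z : Fin n → ℝ) (i j : Fin n), ¬ Overlap (moved a b z i) (moved a b z j) ↔
      z i + (b i - a i) ≤ z j ∨ z j + (b j - a j) ≤ z i := fun z i j =>
    not_overlap_Icc_iff (by linarith [hab i]) (by linarith [hab j])
  have : Nonempty (Fin n) := ⟨⟨0, hn⟩⟩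
  refine ⟨fun i' j' hij => ?_, fun y hy => ?_⟩
  · obtain ⟨i, hi, rfl⟩ := hsur i'
    obtain ⟨j, hj, rfl⟩ := hsur j'
    rw [hsep, hx i hi, hx j hj, ← ha, ← hb, ← ha, ← hb]
    rcases hs.disj i hi j hj (fun h => hij (by simp [h])) with h | h
    · left; linarith
    · right; linarith
  · have h₁ : maxMove a x ≤ D / 2 := ciSup_le fun i' => by
      obtain ⟨i, hi, rfl⟩ := hsur i'
      rw [hx i hi, ← ha, abs_le]
      have := hs.le i hi
      have := hs.delay i hi
      constructor <;> dsimp only at * <;> linarith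
    have h₂ : D ≤ 2 * maxMove a y := by
      rw [hD]
      -- Shifting `y` to the right by its maximum moving distance makes all moves nonnegative and at
      -- most twice that distance, so the necessity of the criterion applies. The default `0` is
      -- never used, as `σ` maps indices below `n` to such.
      refine IsSchedule.feasible (s := fun i => if h : σ i < n then y ⟨σ i, h⟩ + maxMove a y else 0)
        ⟨fun i hi => ?_, fun i hi => ?_, fun i hi j hj hij => ?_⟩ hmono hab' hQ
      · have := abs_le.1 (abs_sub_le_maxMove a y ⟨σ i, hσ.lt i hi⟩)
        simp only [hσ.lt i hi, dif_pos, ha ⟨σ i, hσ.lt i hi⟩]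
        linarith
      · have := abs_le.1 (abs_sub_le_maxMove a y ⟨σ i, hσ.lt i hi⟩)
        simp only [hσ.lt i hi, dif_pos, ha ⟨σ i, hσ.lt i hi⟩]
        linarith
      · have := (hsep y _ _).1 (hy ⟨σ i, hσ.lt i hi⟩ ⟨σ j, hσ.lt j hj⟩
          (fun h => hinj i hi j hj hij (Fin.mk.inj h)))
        simp only [hσ.lt i hi, hσ.lt j hj, dif_pos, ha ⟨σ i, hσ.lt i hi⟩, hb ⟨σ i, hσ.lt i hi⟩,
          ha ⟨σ j, hσ.lt j hj⟩, hb ⟨σ j, hσ.lt j hj⟩]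
        rcases this with h | h
        · left; linarith
        · right; linarith
    linarith

end IntervalSeparation

namespace RealRAM

open IntervalSeparation

/-! ### The structured program -/

/-- Solve the problem for at least one interval. -/
def solvePos : Cmd :=
  load ;; findSize ;; sort 0 1 ;; arrange ;; forward ;; backward ;; sort 5 3 ;; ranks ;;
  dynamic ;; schedule ;; unsort ;; store

def solve : Cmd := .ite (.wlt (wc 0) (wr 0)) solvePos nop

section

variable {n B : ℕ} (hB : 66 * n + 1200 ≤ B)
include hB

theorem solvePos_spec {s : Store} {a b : Fin n → ℝ} {α β : ℕ → ℝ} (h0 : s.w 0 = n) (hn : 0 < n)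
    (hab : ∀ i, a i < b i) (ha : ∀ i : Fin n, α i = a i) (hb : ∀ i : Fin n, β i = b i)
    (h₁ : ∀ i < 32, i < n → s.F 0 i = α i ∧ s.F 1 i = β i)
    (h₂ : ∀ i, 32 ≤ i → i < n → s.F 16 (i + i) = α i ∧ s.F 16 (i + i + 1) = β i) :
    WP n B solvePos s fun t s' => (∃ h, 2 ^ h ≤ 2 * n + 1 ∧ t ≤ 40 * (n * h) + 240 * n + 200) ∧
      (∀ i, 64 ≤ i → i < n → s'.F 16 i = s'.F 11 i) ∧
      IsOptimalSeparation a b fun i => s'.F 11 i := by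
  rw [solvePos, wp_seq]
  refine (load_spec hB h0 h₁ h₂).frame.mono ?_
  rintro t₁ s₁ ⟨⟨ht₁, hl⟩, f₁⟩
  have w₁ : s₁.w 0 = n := by rw [f₁.w 0 rfl, h0]
  rw [wp_seq]
  refine (findSize_spec hB w₁).frame.mono ?_
  rintro t₂ s₂ ⟨⟨ht₂, h, hh, hle, hge⟩, f₂⟩
  have w₂ : s₂.w 0 = n := by rw [f₂.w 0 rfl, w₁]
  rw [wp_seq]
  refine (sort_spec hB (k := 0) (out := 1) (by norm_num) (by norm_num) w₂ hh (by omega)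
    (by omega)).frame.mono ?_
  rintro t₃ s₃ ⟨⟨ht₃, hσ⟩, f₃⟩
  have w₃ : s₃.w 0 = n := by rw [f₃.w 0 rfl, w₂]
  rw [wp_seq]
  refine (arrange_spec hB w₃ hσ.lt).frame.mono ?_
  rintro t₄ s₄ ⟨⟨ht₄, har⟩, f₄⟩
  have w₄ : s₄.w 0 = n := by rw [f₄.w 0 rfl, w₃]
  rw [f₂.F 0 rfl] at hσ
  rw [f₃.F 0 rfl, f₃.F 1 rfl, f₂.F 0 rfl, f₂.F 1 rfl] at har
  generalize hσ' : s₃.A 1 = σ at *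
  have hα : ∀ i < n, s₄.F 2 i = α (σ i) := fun i hi => by
    rw [(har i hi).1, (hl _ (hσ.lt i hi)).1]
  have hβ : ∀ i < n, s₄.F 3 i = β (σ i) := fun i hi => by
    rw [(har i hi).2, (hl _ (hσ.lt i hi)).2]
  replace hσ : SortedBy n α σ := ⟨hσ.lt, hσ.ne, fun i hi j hj => by
    have := hσ.le i hi j hj
    rwa [(hl _ (hσ.lt i hi)).1, (hl _ (hσ.lt j (hj.trans hi))).1] at this⟩
  have hab' : ∀ i < n, α (σ i) < β (σ i) := fun i hi => by
    simpa [ha ⟨σ i, hσ.lt i hi⟩, hb ⟨σ i, hσ.lt i hi⟩] using hab ⟨σ i, hσ.lt i hi⟩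
  have hmono : ∀ j < n, ∀ i ≤ j, α (σ i) ≤ α (σ j) := fun j hj i hi => by
    rcases Nat.lt_or_eq_of_le hi with h | rfl
    · exact hσ.le j hj i h
    · exact le_rfl
  rw [wp_seq]
  refine (forward_spec hB (a := fun i => α (σ i)) (b := fun i => β (σ i)) w₄ hn hα hβ).frame.mono ?_
  rintro t₅ s₅ ⟨⟨ht₅, hb₅, hbn, hfw, htot, hAn⟩, f₅⟩
  have w₅ : s₅.w 0 = n := by rw [f₅.w 0 rfl, w₄]
  rw [wp_seq]
  refine (backward_spec hB w₅ hn hab' hb₅ hbn hfw htot hAn).frame.mono ?_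
  rintro t₆ s₆ ⟨⟨ht₆, hQ⟩, f₆⟩
  have w₆ : s₆.w 0 = n := by rw [f₆.w 0 rfl, w₅]
  have w₆' : s₆.w 1 = 2 ^ h := by
    rw [f₆.w 1 rfl, f₅.w 1 rfl, f₄.w 1 rfl, f₃.w 1 rfl, hh]
  rw [wp_seq]
  refine (sort_spec hB (k := 5) (out := 3) (by norm_num) (by norm_num) w₆ w₆' (by omega)
    (by omega)).frame.mono ?_
  rintro t₇ s₇ ⟨⟨ht₇, hτ⟩, f₇⟩
  have w₇ : s₇.w 0 = n := by rw [f₇.w 0 rfl, w₆]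
  rw [wp_seq]
  refine (ranks_spec hB w₇ hn (by rw [f₇.F 5 rfl]; exact hτ) fun i hi => by
    rw [f₇.F 5 rfl, f₆.F 5 rfl, hfw.idle i hi]).frame.mono ?_
  rintro t₈ s₈ ⟨⟨ht₈, hV⟩, f₈⟩
  have w₈ : s₈.w 0 = n := by rw [f₈.w 0 rfl, w₇]
  have hQ₈ : s₈.F 8 = s₆.F 8 := by rw [f₈.F 8 rfl, f₇.F 8 rfl]
  have hA₈ : s₈.A 2 = s₅.A 2 := by rw [f₈.A 2 rfl, f₇.A 2 rfl, f₆.A 2 rfl]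
  rw [wp_seq]
  refine (dynamic_spec hB w₈ (by rw [f₈.w 1 rfl, f₇.w 1 rfl, w₆']) hge hle hn hab' hV
    (by rw [hQ₈]; exact hQ) (by rw [hA₈]; exact hfw.isChamp)).frame.mono ?_
  rintro t₉ s₉ ⟨⟨ht₉, hD⟩, f₉⟩
  have w₉ : s₉.w 0 = n := by rw [f₉.w 0 rfl, w₈]
  have hQ₉ : s₉.F 8 = s₈.F 8 := by rw [f₉.F 8 rfl]
  rw [hQ₈] at hD hQ₉
  rw [wp_seq]
  refine (schedule_spec hB w₉ hn hab' hmono ?_ ?_ ?_ ?_ (by rw [hQ₉]; exact hQ)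
    (by rw [hQ₉]; exact (hD _).1 le_rfl)).frame.mono ?_
  · rw [f₉.F 2 rfl, f₈.F 2 rfl, f₇.F 2 rfl, f₆.F 2 rfl, f₅.F 2 rfl]; exact hα
  · rw [f₉.F 3 rfl, f₈.F 3 rfl, f₇.F 3 rfl, f₆.F 3 rfl]; exact hb₅
  · rw [f₉.A 2 rfl, hA₈]; exact hfw.isChamp
  · rw [f₉.F 5 rfl, f₈.F 5 rfl, f₇.F 5 rfl, f₆.F 5 rfl]; exact hfw.idle
  rintro t₁₀ s₁₀ ⟨⟨ht₁₀, hs⟩, f₁₀⟩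
  have w₁₀ : s₁₀.w 0 = n := by rw [f₁₀.w 0 rfl, w₉]
  have hA₁₀ : s₁₀.A 1 = σ := by
    rw [f₁₀.A 1 rfl, f₉.A 1 rfl, f₈.A 1 rfl, f₇.A 1 rfl, f₆.A 1 rfl, f₅.A 1 rfl, f₄.A 1 rfl, hσ']
  rw [wp_seq]
  refine (unsort_spec hB (κ := α) w₁₀ (by rw [hA₁₀]; exact hσ)).frame.mono ?_
  rintro t₁₁ s₁₁ ⟨⟨ht₁₁, hx⟩, f₁₁⟩
  rw [hA₁₀, f₁₀.r 0 rfl] at hx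
  refine (store_spec hB (by rw [f₁₁.w 0 rfl, w₁₀])).frame.mono ?_
  rintro t₁₂ s₁₂ ⟨⟨ht₁₂, hout⟩, f₁₂⟩
  have e : s₁₂.F 11 = s₁₁.F 11 := f₁₂.F 11 rfl
  refine ⟨⟨h, hge, ?_⟩, by rw [e]; exact hout, ?_⟩
  · have g₃ : n * (8 * h + 6) = 8 * (n * h) + 6 * n := by ring
    have g₉ : n * (24 * h + 40) = 24 * (n * h) + 40 * n := by ring
    omega
  · exact hs.isOptimalSeparation hn hab ha hb hσ hQ hD fun i hi _ => by
      simp only [e]; exact hx i hi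

theorem solve_spec {s : Store} {a b : Fin n → ℝ} (h0 : s.w 0 = n) (hab : ∀ i, a i < b i)
    {α β : ℕ → ℝ} (ha : ∀ i : Fin n, α i = a i) (hb : ∀ i : Fin n, β i = b i)
    (h₁ : ∀ i < 32, i < n → s.F 0 i = α i ∧ s.F 1 i = β i)
    (h₂ : ∀ i, 32 ≤ i → i < n → s.F 16 (i + i) = α i ∧ s.F 16 (i + i + 1) = β i) :
    WP n B solve s fun t s' => t ≤ 280 * ((n + 1) * (Nat.log 2 (n + 1) + 1)) ∧
      (∀ i, 64 ≤ i → i < n → s'.F 16 i = s'.F 11 i) ∧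
      IsOptimalSeparation a b fun i => s'.F 11 i := by
  have hpos : 1 ≤ (n + 1) * (Nat.log 2 (n + 1) + 1) := Nat.mul_pos (by omega) (by omega)
  rw [solve, wp_ite]
  refine ⟨by simp, fun h => ?_, fun h => ?_⟩
  · simp [h0] at h
    refine (solvePos_spec hB h0 h hab ha hb h₁ h₂).mono ?_
    rintro t s' ⟨⟨k, hk, ht⟩, h'⟩
    refine ⟨?_, h'⟩
    have : k ≤ Nat.log 2 (n + 1) + 1 := by
      by_contra hc
      have h₁ : 2 ^ (Nat.log 2 (n + 1) + 2) ≤ 2 ^ k := Nat.pow_le_pow_right (by norm_num) (by omega)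
      have h₂ := Nat.lt_pow_succ_log_self (b := 2) (by norm_num) (n + 1)
      rw [pow_succ] at h₁
      simp only [Nat.succ_eq_add_one] at h₂
      omega
    have h₁ : n * k ≤ (n + 1) * (Nat.log 2 (n + 1) + 1) := Nat.mul_le_mul (by omega) this
    have h₂ : n + 1 ≤ (n + 1) * (Nat.log 2 (n + 1) + 1) := Nat.le_mul_of_pos_right _ (by omega)
    omega
  · simp [h0] at h
    simp only [nop, wp_wset]
    exact ⟨by simp, by omega, fun i _ hi => by omega, isOptimalSeparation_of_isEmpty h _ _ _⟩

end

end RealRAM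

namespace RealRAM

open IntervalSeparation

/-! ### The program -/

/-- Code for `R[W[32]]` to be the element `i` of the real array `k`. -/
def addrCode (k i : ℕ) : List Instr :=
  [.wconst 32 (64 + 16 * i + k), .wop .add 33 0 0, .wop .add 32 32 33]

/-- Copy the first `m` real cells to the beginnings of the arrays `0` and `1`. -/
def copyIn : ℕ → List Instr
  | 0 => []
  | m + 1 => copyIn m ++ (addrCode (m % 2) (m / 2) ++ [.rstore 32 m])

/-- Copy the first `m` elements of the array `11` to the first real cells. -/
def copyOut : ℕ → List Instr
  | 0 => []
  | m + 1 => copyOut m ++ (addrCode 11 m ++ [.rload m 32])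

/-- `W[1]` is word register `0`, while `W[0]` keeps `n` for address computations. The first 64 real
cells are saved unconditionally; for small `n` this also copies some zeros, which does no harm. -/
def prologue : List Instr := .wcopy 1 0 :: copyIn 64

def program : Program :=
  prologue ++ (solve.code prologue.length ++ (copyOut 64 ++ [.halt]))

theorem isLinear_of_mem_addrCode (k i : ℕ) : ∀ c ∈ addrCode k i, c.IsLinear := by
  simp [addrCode, Instr.IsLinear]

theorem isLinear_of_mem_copyIn (m : ℕ) : ∀ c ∈ copyIn m, c.IsLinear := by
  induction m with
  | zero => simp [copyIn]
  | succ m ih =>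
    simp only [copyIn, List.mem_append]
    rintro c (h | h | h)
    · exact ih c h
    · exact isLinear_of_mem_addrCode _ _ _ h
    · simp only [List.mem_singleton] at h; simp [h, Instr.IsLinear]

theorem isLinear_of_mem_copyOut (m : ℕ) : ∀ c ∈ copyOut m, c.IsLinear := by
  induction m with
  | zero => simp [copyOut]
  | succ m ih =>
    simp only [copyOut, List.mem_append]
    rintro c (h | h | h)
    · exact ih c h
    · exact isLinear_of_mem_addrCode _ _ _ h
    · simp only [List.mem_singleton] at h; simp [h, Instr.IsLinear]

theorem length_copyIn (m : ℕ) : (copyIn m).length = 4 * m := by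
  induction m with
  | zero => rfl
  | succ m ih => simp [copyIn, addrCode, ih]; omega

theorem length_copyOut (m : ℕ) : (copyOut m).length = 4 * m := by
  induction m with
  | zero => rfl
  | succ m ih => simp [copyOut, addrCode, ih]; omega

section

variable {n B : ℕ} (hB : 66 * n + 1200 ≤ B)
include hB

theorem addrCode_spec {W : ℕ → ℕ} {R : ℕ → ℝ} {k i : ℕ} (hk : k < 16) (hi : i < 64)
    (h0 : W 0 = n) (hs : ∀ a, W a < B) :
    ∃ W', RunsTo n B (addrCode k i) W R W' R ∧ W' 32 = realAddr n k i ∧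
      (∀ a < 32, W' a = W a) ∧ ∀ a, W' a < B := by
  refine ⟨_, .cons (runsTo_wconst (by omega) (by omega)) (.cons (runsTo_wop (by omega) (by omega)
    (by omega) ?_ ?_) (runsTo_wop (by omega) (by omega) (by omega) ?_ ?_)), ?_, ?_, ?_⟩
  · simp [h0]; omega
  · simp [h0]; omega
  · simp [h0]; omega
  · simp; omega
  · simp [h0, realAddr, hk.ne]; omega
  · intro a ha
    rw [Function.update_of_ne (by omega), Function.update_of_ne (by omega),
      Function.update_of_ne (by omega)]
  · refine update_lt (update_lt (update_lt hs (by omega)) ?_) ?_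
    · simp [h0]; omega
    · simp [h0]; omega

theorem copyIn_spec {W : ℕ → ℕ} {R : ℕ → ℝ} (h0 : W 0 = n) (hs : ∀ a, W a < B) {m : ℕ}
    (hm : m ≤ 64) :
    ∃ W' R', RunsTo n B (copyIn m) W R W' R' ∧ (∀ a < 32, W' a = W a) ∧ (∀ a, W' a < B) ∧
      (∀ a < 2 * n + 64, R' a = R a) ∧
      ∀ c < m, R' (realAddr n (c % 2) (c / 2)) = R c := by
  induction m with
  | zero => exact ⟨W, R, runsTo_nil, fun _ _ => rfl, hs, fun _ _ => rfl, fun c hc => by omega⟩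
  | succ m ih =>
    obtain ⟨W₁, R₁, hr, hW, hs₁, hR, hc⟩ := ih (by omega)
    obtain ⟨W₂, hr₂, h32, hW₂, hs₂⟩ := addrCode_spec hB (R := R₁) (k := m % 2) (i := m / 2)
      (by omega) (by omega) (by rw [hW 0 (by omega), h0]) hs₁
    refine ⟨W₂, _, .append hr (.append hr₂ (runsTo_rstore (by omega) (by omega) ?_)),
      fun a ha => by rw [hW₂ a ha, hW a ha], hs₂, fun a ha => ?_, fun c hcm => ?_⟩
    · rw [h32]; unfold realAddr; split_ifs <;> omega
    · rw [Function.update_of_ne, hR a ha]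
      rw [h32]; unfold realAddr; split_ifs <;> omega
    · rw [h32]
      rcases Nat.lt_or_eq_of_le (Nat.le_of_lt_succ hcm) with h | rfl
      · rw [Function.update_of_ne, hc c h]
        unfold realAddr; split_ifs <;> omega
      · rw [Function.update_self, hR _ (by omega)]

theorem copyOut_spec {W : ℕ → ℕ} {R : ℕ → ℝ} (h0 : W 0 = n) (hs : ∀ a, W a < B) {m : ℕ}
    (hm : m ≤ 64) :
    ∃ W' R', RunsTo n B (copyOut m) W R W' R' ∧ (∀ a < 32, W' a = W a) ∧ (∀ a, W' a < B) ∧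
      (∀ a, m ≤ a → R' a = R a) ∧ ∀ c < m, R' c = R (realAddr n 11 c) := by
  induction m with
  | zero => exact ⟨W, R, runsTo_nil, fun _ _ => rfl, hs, fun _ _ => rfl, fun c hc => by omega⟩
  | succ m ih =>
    obtain ⟨W₁, R₁, hr, hW, hs₁, hR, hc⟩ := ih (by omega)
    obtain ⟨W₂, hr₂, h32, hW₂, hs₂⟩ := addrCode_spec hB (R := R₁) (k := 11) (i := m)
      (by omega) (by omega) (by rw [hW 0 (by omega), h0]) hs₁
    refine ⟨W₂, _, .append hr (.append hr₂ (runsTo_rload (by omega) (by omega) ?_)),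
      fun a ha => by rw [hW₂ a ha, hW a ha], hs₂, fun a ha => ?_, fun c hcm => ?_⟩
    · rw [h32]; unfold realAddr; split_ifs <;> omega
    · rw [Function.update_of_ne (by omega), hR a (by omega)]
    · rcases Nat.lt_or_eq_of_le (Nat.le_of_lt_succ hcm) with h | rfl
      · rw [Function.update_of_ne h.ne, hc c h]
      · rw [Function.update_self, h32, hR]
        unfold realAddr; split_ifs <;> omega

-- The store is read off from the memory, so the structured program can start from whatever the
-- prologue leaves.
omit hB in
theorem exists_sim {W : ℕ → ℕ} {R : ℕ → ℝ} (h0 : W 0 = n) (hs : ∀ a, W a < B) :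
    Sim n B ⟨fun i => W (1 + i), R, fun k i => W (64 + 8 * i + k), fun k i => R (realAddr n k i)⟩
      W R :=
  ⟨h0, hs, fun _ _ => rfl, fun _ _ _ _ => rfl, fun _ _ => rfl, fun _ _ _ _ => rfl⟩

theorem program_spec {a b : Fin n → ℝ} (hab : ∀ i, a i < b i) :
    ∃ t τ, t ≤ (513 + solve.width * 280) * ((n + 1) * (Nat.log 2 (n + 1) + 1)) ∧
      HaltsIn program (66 * n + 1200) B t (input a b) τ ∧
      IsOptimalSeparation a b (output n τ) := by
  have hP : CodeAt program 0 (prologue ++ (solve.code prologue.length ++ (copyOut 64 ++ [.halt]))) :=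
    fun i _ => by rw [Nat.zero_add]; rfl
  simp only [codeAt_append, Nat.zero_add, Cmd.length_code] at hP
  obtain ⟨hP₁, hP₂, hP₃, hP₄⟩ := hP
  generalize hW : (input a b).W = W
  generalize hR : (input a b).R = R
  have hin : input a b = ⟨0, W, R⟩ := by rw [← hW, ← hR]; rfl
  have hW0 : W 0 = n := by rw [← hW]; rfl
  have hWs : ∀ a, W a < B := fun a => by
    rw [← hW]; simp only [input]; split_ifs <;> omega
  obtain ⟨W₁, R₁, hr₁, hW₁, hs₁, hR₁, hc₁⟩ := copyIn_spec hB (W := Function.update W 1 (W 0))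
    (R := R) (by simpa using hW0) (update_lt hWs (hWs 0)) (m := 64) le_rfl
  have hst₁ := RunsTo.steps (P := program) (p := 0)
    (.cons (runsTo_wcopy (by omega) (by omega) (hWs 0)) hr₁) (l := prologue)
    (fun c hc => by
      rcases List.mem_cons.1 hc with rfl | h
      · trivial
      · exact isLinear_of_mem_copyIn _ _ h) hP₁
  obtain ⟨t, s', he, ht, h16, hopt⟩ := solve_spec hB (a := a) (b := b)
    (s := ⟨fun i => W₁ (1 + i), R₁, fun k i => W₁ (64 + 8 * i + k),
      fun k i => R₁ (realAddr n k i)⟩) (α := fun i => R (2 * i)) (β := fun i => R (2 * i + 1))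
    (by simp [hW₁, hW0]) hab (fun i => by simp [← hR, input])
    (fun i => by simp [← hR, input, Nat.mul_add_div])
    (fun i hi _ => by
      have h₁ := hc₁ (2 * i) (by omega)
      have h₂ := hc₁ (2 * i + 1) (by omega)
      rw [show 2 * i % 2 = 0 by omega, show 2 * i / 2 = i by omega] at h₁
      rw [show (2 * i + 1) % 2 = 1 by omega, show (2 * i + 1) / 2 = i by omega] at h₂
      exact ⟨h₁, h₂⟩)
    (fun i hi hin => by
      simp only [realAddr, if_true]
      rw [hR₁ _ (by omega), hR₁ _ (by omega), two_mul]
      exact ⟨rfl, rfl⟩)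
  obtain ⟨t₂, W₂, R₂, ht₂, hst₂, sim⟩ := he.steps hB (by decide) le_rfl hP₂
    (exists_sim (by rw [hW₁ 0 (by omega)]; simpa using hW0) hs₁)
  obtain ⟨W₃, R₃, hr₃, -, -, hR₃, hc₃⟩ := copyOut_spec hB (R := R₂) sim.size sim.small (m := 64)
    le_rfl
  have hst₃ := hr₃.steps (isLinear_of_mem_copyOut _) hP₃
  rw [Nat.zero_add] at hst₁
  rw [hin]
  refine ⟨_, _, ?_, ((hst₁.trans hst₂).trans hst₃).haltsIn ?_, ?_⟩
  rotate_left
  · have := hP₄ 0 (by simp)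
    simpa using this
  · convert hopt using 1
    funext i
    simp only [output]
    by_cases hi : (i : ℕ) < 64
    · rw [hc₃ i hi, sim.F 11 (by norm_num) i (by simp; omega)]
    · rw [hR₃ i (by omega), ← h16 i (by omega) i.2, ← sim.F 16 le_rfl i (by simp; omega)]
      simp [realAddr]
  -- The constant 513 counts the straight-line parts: `1 + 4 * 64` instructions before the
  -- structured program and `4 * 64` after it.
  · have h1 : 1 ≤ (n + 1) * (Nat.log 2 (n + 1) + 1) := Nat.mul_pos (by omega) (by omega)
    have h2 := Nat.mul_le_mul_left solve.width ht
    simp only [prologue, List.length_cons, length_copyIn, length_copyOut]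
    rw [add_mul, mul_assoc]
    omega

end

/-! ### Asymptotics -/

/-- From `n + 1 ≤ n ^ 2` and `log 2 ≤ log n`, the left side is at most `3 * log n / log 2`, and `log
2` exceeds one half. -/
theorem natLog_succ_add_one_le {n : ℕ} (hn : 2 ≤ n) :
    ((Nat.log 2 (n + 1) : ℕ) : ℝ) + 1 ≤ 6 * Real.log n := by
  have h2 := Real.log_two_gt_d9
  have hn' : (2 : ℝ) ≤ n := by exact_mod_cast hn
  have h₁ := Real.natLog_le_logb (n + 1) 2
  have h₂ : Real.log (n + 1) ≤ 2 * Real.log n := by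
    rw [← Real.log_rpow (by linarith)]
    apply Real.log_le_log (by linarith)
    norm_num
    nlinarith
  have h₃ : Real.log 2 ≤ Real.log n := Real.log_le_log (by norm_num) hn'
  rw [Real.logb, le_div_iff₀ (by push_cast; linarith)] at h₁
  push_cast at h₁
  nlinarith [Nat.cast_nonneg (α := ℝ) (Nat.log 2 (n + 1))]

end RealRAM

theorem mainTheorem1 :
    ∃ (P : RealRAM.Program) (T S w : ℕ → ℕ),
      -- time `O(n log n)`, space `O(n)`, words of `O(log n)` bits
      (fun n : ℕ => (T n : ℝ)) =O[Filter.atTop] (fun n : ℕ => (n : ℝ) * Real.log (n : ℝ)) ∧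
      (fun n : ℕ => (S n : ℝ)) =O[Filter.atTop] (fun n : ℕ => (n : ℝ)) ∧
      (fun n : ℕ => (w n : ℝ)) =O[Filter.atTop] (fun n : ℕ => Real.log (n : ℝ)) ∧
      -- the input and the output fit into the memory
      (∀ n : ℕ, 2 * n ≤ S n ∧ n < 2 ^ w n) ∧
      -- within these resources, the program solves every instance
      ∀ (n : ℕ) (a b : Fin n → ℝ), (∀ i, a i < b i) →
        ∃ (t : ℕ) (τ : RealRAM.Config), t ≤ T n ∧
          RealRAM.HaltsIn P (S n) (2 ^ w n) t (IntervalSeparation.input a b) τ ∧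
          IntervalSeparation.IsOptimalSeparation a b (IntervalSeparation.output n τ) := by
  -- Words must be able to hold every address. The exponent exceeds by 11 one for which the power is
  -- already larger than `n + 1`, and `2 ^ 11` is more than 66 and 1200.
  have hw : ∀ n : ℕ, 66 * n + 1200 ≤ 2 ^ (Nat.log 2 (n + 1) + 12) := fun n => by
    have := Nat.lt_pow_succ_log_self (b := 2) (by norm_num) (n + 1)
    rw [show Nat.log 2 (n + 1) + 12 = (Nat.log 2 (n + 1)).succ + 11 by omega, pow_add]
    omega
  refine ⟨RealRAM.program, fun n => (513 + RealRAM.solve.width * 280) *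
    ((n + 1) * (Nat.log 2 (n + 1) + 1)), fun n => 66 * n + 1200, fun n => Nat.log 2 (n + 1) + 12,
    ?_, ?_, ?_, fun n => ?_, fun n a b hab => RealRAM.program_spec (hw n) hab⟩
  · generalize 513 + RealRAM.solve.width * 280 = C
    refine .of_bound (C * 12) ?_
    filter_upwards [Filter.eventually_ge_atTop 2] with n hn
    have hn' : (2 : ℝ) ≤ n := by exact_mod_cast hn
    have h := RealRAM.natLog_succ_add_one_le hn
    have hlog := Real.log_nonneg (show (1 : ℝ) ≤ n by linarith)
    rw [Real.norm_of_nonneg (by positivity), Real.norm_of_nonneg (by positivity), Nat.cast_mul,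
      mul_assoc]
    refine mul_le_mul_of_nonneg_left ?_ C.cast_nonneg
    push_cast
    calc ((n : ℝ) + 1) * ((Nat.log 2 (n + 1) : ℕ) + 1) ≤ (2 * n) * (6 * Real.log n) := by
          gcongr; linarith
      _ = 12 * (n * Real.log n) := by ring
  · refine .of_bound 1266 ?_
    filter_upwards [Filter.eventually_ge_atTop 1] with n hn
    rw [Real.norm_of_nonneg (by positivity), Real.norm_of_nonneg (by positivity)]
    exact_mod_cast (by omega : 66 * n + 1200 ≤ 1266 * n)
  -- `72 = 12 * 6`, since `k + 12 ≤ 12 * (k + 1)`.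
  · refine .of_bound 72 ?_
    filter_upwards [Filter.eventually_ge_atTop 2] with n hn
    have hn' : (2 : ℝ) ≤ n := by exact_mod_cast hn
    have h := RealRAM.natLog_succ_add_one_le hn
    have hlog := Real.log_nonneg (show (1 : ℝ) ≤ n by linarith)
    rw [Real.norm_of_nonneg (by positivity), Real.norm_of_nonneg hlog]
    push_cast
    linarith [Nat.cast_nonneg (α := ℝ) (Nat.log 2 (n + 1))]
  · have := hw n
    dsimp only
    constructor <;> omega
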